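/- **Theorem 3 (The Main Theorem).** Let $G=(V,E)$ be a finite directed acyclic graph (parallel edges allowed) with three unicast sessions, session $i\in\{1,2,3\}$ having sender $s_i\in V$ and receiver $d_i\in V$. Extend $G$ by virtual senders $s'_i$, virtual receivers $d'_i$ and edges $\sigma_i=(s'_i,s_i)$, $\tau_i=(d_i,d'_i)$. Let $\mathbb F=\mathbb F_{2^m}$, let $\mathbf x=(x_{e'e})$ be indeterminates, one for each pair of consecutive edges $e',e$ of the extended graph, and let the transfer function $m_{ij}(\mathbf x)=\sum_P t(P)\in\mathbb F[\mathbf x]$ be the sum over all directed paths $P$ from $s'_j$ to $d'_i$ of the product $t(P)$ of the coefficients $x_{e'e}$ along $P$. Assume that all nine $m_{ij}$ are non-zero, and put $$p_1=\frac{m_{31}m_{12}}{m_{11}m_{32}},\quad p_2=\frac{m_{31}m_{22}}{m_{21}m_{32}},\quad p_3=\frac{m_{12}m_{33}}{m_{32}m_{13}},\quad \eta=\frac{m_{31}m_{12}m_{23}}{m_{21}m_{32}m_{13}}\quad\text{in }\mathbb F(\mathbf x).$$ For an integer $n\ge 1$ let $L_1=n+1$, $L_2=n$, $L=2n+1$.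 The rate tuple $\mathbf R^*_n=\left(\frac{n+1}{2n+1},\frac n{2n+1},\frac n{2n+1}\right)$ is *feasible through PBNA* (precoding-based network alignment) over $\mathbb F$ if there are values $\mathbf x^1,\dots,\mathbf x^{L}$ of $\mathbf x$ in $\mathbb F$, one for each of $L$ uses of the network, and matrices $\mathbf V_1\in\mathbb F^{L\times L_1}$, $\mathbf V_2,\mathbf V_3\in\mathbb F^{L\times L_2}$ such that, with $\mathbf M_{ij}=\mathrm{diag}(m_{ij}(\mathbf x^1),\dots,m_{ij}(\mathbf x^{L}))$, the matrices $\mathbf M_{ij}$ with $i\ne j$ are invertible, and $$\mathrm{span}(\mathbf M_{12}\mathbf V_2)=\mathrm{span}(\mathbf M_{13}\mathbf V_3),\quad \mathrm{span}(\mathbf M_{23}\mathbf V_3)\subseteq\mathrm{span}(\mathbf M_{21}\mathbf V_1),\quad \mathrm{span}(\mathbf M_{32}\mathbf V_2)\subseteq\mathrm{span}(\mathbf M_{31}\mathbf V_1),$$ $$\mathrm{rank}(\mathbf M_{11}\mathbf V_1\ \ \mathbf M_{12}\mathbf V_2)=\mathrm{rank}(\mathbf M_{21}\mathbf V_1\ \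 \mathbf M_{22}\mathbf V_2)=\mathrm{rank}(\mathbf M_{31}\mathbf V_1\ \ \mathbf M_{33}\mathbf V_3)=L,$$ where $\mathrm{span}$ denotes the column span. Assume that $\eta$ is not constant and $n>1$. Then, for all sufficiently large $m$ (depending on the network and on $n$), $\mathbf R^*_n$ is feasible through PBNA over $\mathbb F_{2^m}$ if and only if for all $a,b\in\{0,1\}$ that are not both zero $$m_{11}\ne a\frac{m_{21}m_{13}}{m_{23}}+b\frac{m_{31}m_{12}}{m_{32}},\qquad m_{22}\ne a\frac{m_{32}m_{21}}{m_{31}}+b\frac{m_{12}m_{23}}{m_{13}},\qquad m_{33}\ne a\frac{m_{13}m_{32}}{m_{12}}+b\frac{m_{23}m_{31}}{m_{21}}$$ as rational functions. Moreover, these conditions are equivalent to $$p_1\notin\left\{1,\eta,\frac{\eta}{1+\eta}\right\},\qquad p_2\notin\{1,\eta,1+\eta\},\qquad p_3\notin\{1,\eta,1+\eta\}.$$ In particular the conditions are finite in number and do not depend on $n$. -/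

import Mathlib

open scoped Matrix

/-- Three unicast sessions over a finite delay-free directed acyclic (multi)graph with vertex set
`V` and edge set `E`.  Every edge carries one symbol per unit of time (parallel edges are allowed).
The sessions are indexed by `0, 1, 2 : Fin 3`. -/
structure UnicastNetwork (V E : Type*) where
  /-- the vertex an edge leaves -/
  tail : E → V
  /-- the vertex an edge enters -/
  head : E → V
  /-- there is no directed cycle -/
  acyclic : ∀ v, ¬ Relation.TransGen (fun a b => ∃ e, tail e = a ∧ head e = b) v v
  /-- the sender of each session -/
  sender : Fin 3 → V
  /-- the receiver of each session -/
  receiver : Fin 3 → V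

namespace UnicastNetwork

variable {V E : Type*}

/-- Vertices of the extended graph: the original ones, the virtual senders `s'ᵢ`, and the virtual
receivers `d'ᵢ`. -/
abbrev ExtVertex (V : Type*) : Type _ := V ⊕ (Fin 3 ⊕ Fin 3)

/-- Edges of the extended graph: the original ones, `σᵢ = (s'ᵢ, sᵢ)`, and `τᵢ = (dᵢ, d'ᵢ)`. -/
abbrev ExtEdge (E : Type*) : Type _ := E ⊕ (Fin 3 ⊕ Fin 3)

/-- The virtual edge `σᵢ = (s'ᵢ, sᵢ)`. -/
def sigma (i : Fin 3) : ExtEdge E := Sum.inr (Sum.inl i)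

/-- The virtual edge `τᵢ = (dᵢ, d'ᵢ)`. -/
def tau (i : Fin 3) : ExtEdge E := Sum.inr (Sum.inr i)

/-- Tails of the edges of the extended graph. -/
def extTail (N : UnicastNetwork V E) : ExtEdge E → ExtVertex V
  | Sum.inl e => Sum.inl (N.tail e)
  | Sum.inr (Sum.inl i) => Sum.inr (Sum.inl i)
  | Sum.inr (Sum.inr i) => Sum.inl (N.receiver i)

/-- Heads of the edges of the extended graph. -/
def extHead (N : UnicastNetwork V E) : ExtEdge E → ExtVertex V
  | Sum.inl e => Sum.inl (N.head e)
  | Sum.inr (Sum.inl i) => Sum.inl (N.sender i)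
  | Sum.inr (Sum.inr i) => Sum.inr (Sum.inr i)

/-- The indices of the coding coefficients `x_{e'e}`: pairs of consecutive edges `(e', e)` of the
extended graph. -/
abbrev CodingVar (N : UnicastNetwork V E) : Type _ :=
  {q : ExtEdge E × ExtEdge E // N.extHead q.1 = N.extTail q.2}

/-- `P` (a list of edges) is a directed path from the virtual sender `s'ⱼ` to the virtual receiver
`d'ᵢ`: it starts with `σⱼ`, ends with `τᵢ`, and any two successive edges are consecutive. -/
def IsPath (N : UnicastNetwork V E) (i j : Fin 3) (P : List (ExtEdge E)) : Prop :=
  P.head? = some (sigma j) ∧ P.getLast? = some (tau i) ∧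
    P.IsChain (fun e' e => N.extHead e' = N.extTail e)

open Classical in
/-- `t(P)`: the product of the coding coefficients along a path `P` (the value on a list that is not
a path is irrelevant). -/
noncomputable def pathTerm (F : Type*) [CommSemiring F] (N : UnicastNetwork V E) :
    List (ExtEdge E) → MvPolynomial N.CodingVar F
  | [] => 1
  | [_] => 1
  | e' :: e :: P =>
      (if h : N.extHead e' = N.extTail e then MvPolynomial.X ⟨(e', e), h⟩ else 0) *
        pathTerm F N (e :: P)

open Classical in
/-- The transfer function `m_{ij}(x) = ∑ t(P)`, the sum being over all paths `P` from `s'ⱼ` to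
`d'ᵢ`.  (No path of an acyclic graph repeats an edge, so the restriction to lists without repetition
only serves to have a finite sum.) -/
noncomputable def transfer (F : Type*) [CommSemiring F] [Fintype E] (N : UnicastNetwork V E)
    (i j : Fin 3) : MvPolynomial N.CodingVar F :=
  ∑ P : {P : List (ExtEdge E) // P.Nodup} with N.IsPath i j P.1, pathTerm F N P.1

/-- The field `F(x)` of rational functions in the coding coefficients. -/
abbrev RatFun (F : Type*) [Field F] (N : UnicastNetwork V E) : Type _ :=
  FractionRing (MvPolynomial N.CodingVar F)

section RationalFunctions

variable (F : Type*) [Field F] [Fintype E] (N : UnicastNetwork V E)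

/-- The transfer function `m_{ij}`, as an element of `F(x)`. -/
noncomputable def m (i j : Fin 3) : RatFun F N :=
  algebraMap (MvPolynomial N.CodingVar F) (RatFun F N) (N.transfer F i j)

/-- `η = (m₃₁ m₁₂ m₂₃) / (m₂₁ m₃₂ m₁₃)`; sessions `1, 2, 3` are `0, 1, 2 : Fin 3`. -/
noncomputable def eta : RatFun F N :=
  (N.m F 2 0 * N.m F 0 1 * N.m F 1 2) / (N.m F 1 0 * N.m F 2 1 * N.m F 0 2)

/-- `p₁ = (m₃₁ m₁₂) / (m₁₁ m₃₂)`. -/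
noncomputable def p₁ : RatFun F N :=
  (N.m F 2 0 * N.m F 0 1) / (N.m F 0 0 * N.m F 2 1)

/-- `p₂ = (m₃₁ m₂₂) / (m₂₁ m₃₂)`. -/
noncomputable def p₂ : RatFun F N :=
  (N.m F 2 0 * N.m F 1 1) / (N.m F 1 0 * N.m F 2 1)

/-- `p₃ = (m₁₂ m₃₃) / (m₃₂ m₁₃)`. -/
noncomputable def p₃ : RatFun F N :=
  (N.m F 0 1 * N.m F 2 2) / (N.m F 2 1 * N.m F 0 2)

/-- A rational function is constant if it is an element of the coefficient field `F`. -/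
def IsConst (r : RatFun F N) : Prop :=
  ∃ c : F, r = algebraMap (MvPolynomial N.CodingVar F) (RatFun F N) (MvPolynomial.C c)

end RationalFunctions

/-- The diagonal matrix `M_{ij}` whose `k`-th diagonal entry is `m_{ij}(xᵏ)`, where `xᵏ` is the
coding vector of the `k`-th use of the network. -/
noncomputable def transferMatrix {F : Type*} [Field F] [Fintype E] (N : UnicastNetwork V E)
    {L : ℕ} (x : Fin L → N.CodingVar → F) (i j : Fin 3) : Matrix (Fin L) (Fin L) F :=
  Matrix.diagonal fun k => MvPolynomial.eval (x k) (N.transfer F i j)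

/-- The span of the columns of a matrix. -/
def colSpan {F : Type*} [Field F] {r c : ℕ} (A : Matrix (Fin r) (Fin c) F) :
    Submodule F (Fin r → F) :=
  Submodule.span F (Set.range Aᵀ)

/-- With `L = L₁ + L₂` uses of the network, the rate tuple `(L₁ / L, L₂ / L, L₂ / L)` is feasible
over `F` through precoding-based network alignment: there are values of the coding vectors of the
`L` uses (at which the interference matrices `M_{ij}`, `i ≠ j`, are invertible) and of the precoding
matrices for which all interferences are aligned and all source symbols can be decoded. -/
def FeasiblePBNA (F : Type*) [Field F] [Fintype E] (N : UnicastNetwork V E) (L₁ L₂ : ℕ) : Prop :=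
  ∃ (x : Fin (L₁ + L₂) → N.CodingVar → F)
    (V₁ : Matrix (Fin (L₁ + L₂)) (Fin L₁) F)
    (V₂ V₃ : Matrix (Fin (L₁ + L₂)) (Fin L₂) F),
    (∀ i j : Fin 3, i ≠ j → IsUnit (N.transferMatrix x i j)) ∧
    -- alignment of the interferences at the three receivers
    colSpan (N.transferMatrix x 0 1 * V₂) = colSpan (N.transferMatrix x 0 2 * V₃) ∧
    colSpan (N.transferMatrix x 1 2 * V₃) ≤ colSpan (N.transferMatrix x 1 0 * V₁) ∧
    colSpan (N.transferMatrix x 2 1 * V₂) ≤ colSpan (N.transferMatrix x 2 0 * V₁) ∧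
    -- decodability at the three receivers
    (Matrix.fromCols (N.transferMatrix x 0 0 * V₁) (N.transferMatrix x 0 1 * V₂)).rank
      = L₁ + L₂ ∧
    (Matrix.fromCols (N.transferMatrix x 1 0 * V₁) (N.transferMatrix x 1 1 * V₂)).rank
      = L₁ + L₂ ∧
    (Matrix.fromCols (N.transferMatrix x 2 0 * V₁) (N.transferMatrix x 2 2 * V₃)).rank
      = L₁ + L₂

section Conditions

variable (F : Type*) [Field F] [Fintype E] (N : UnicastNetwork V E)

/-- The three families of non-identities between transfer functions: for all `a, b ∈ {0, 1}` that
are not both zero,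
`m₁₁ ≠ a (m₂₁ m₁₃ / m₂₃) + b (m₃₁ m₁₂ / m₃₂)`,
`m₂₂ ≠ a (m₃₂ m₂₁ / m₃₁) + b (m₁₂ m₂₃ / m₁₃)`,
`m₃₃ ≠ a (m₁₃ m₃₂ / m₁₂) + b (m₂₃ m₃₁ / m₂₁)`. -/
def TransferNonIdentities : Prop :=
  ∀ a b : RatFun F N, (a = 0 ∨ a = 1) → (b = 0 ∨ b = 1) → ¬ (a = 0 ∧ b = 0) →
    N.m F 0 0 ≠ a * (N.m F 1 0 * N.m F 0 2 / N.m F 1 2)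
        + b * (N.m F 2 0 * N.m F 0 1 / N.m F 2 1) ∧
    N.m F 1 1 ≠ a * (N.m F 2 1 * N.m F 1 0 / N.m F 2 0)
        + b * (N.m F 0 1 * N.m F 1 2 / N.m F 0 2) ∧
    N.m F 2 2 ≠ a * (N.m F 0 2 * N.m F 2 1 / N.m F 0 1)
        + b * (N.m F 1 2 * N.m F 2 0 / N.m F 1 0)

/-- `p₁ ∉ {1, η, η / (1 + η)}` and `p₂, p₃ ∉ {1, η, 1 + η}`. -/
def RatioNonIdentities : Prop :=
  N.p₁ F ∉ ({1, N.eta F, N.eta F / (1 + N.eta F)} : Set (RatFun F N)) ∧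
  N.p₂ F ∉ ({1, N.eta F, 1 + N.eta F} : Set (RatFun F N)) ∧
  N.p₃ F ∉ ({1, N.eta F, 1 + N.eta F} : Set (RatFun F N))

end Conditions

end UnicastNetwork

/-!
Write `T(a, b)` for the sum of the terms of all paths from the edge `a` to the edge `b`
(`UnicastNetwork.pathSum`, and `ratSum` as a rational function), so that `m_{ij} = T(σⱼ, τᵢ)`. All
conditions are equivalent to nine polynomial non-identities between transfer functions, three at
each receiver (`CyclicNonIdentities`), and as transfer functions have integer coefficients these
can be decided over the prime field. This is what makes the bound on the size of the field
uniform.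

*Necessity* (`FeasiblePBNA.cyclicNonIdentities`). Each of the nine identities, combined with the
alignment of the interference, gives a vector of the desired signal that lies in the space of the
interference. For `p₁ = η / (1 + η)` this uses that two `n`-dimensional spaces in an `(n +
1)`-dimensional one intersect, which is where `n > 1` enters.

*Sufficiency* (`exists_feasiblePBNA`). The columns of the precoding matrices are weighted powers
of `η`, so that alignment holds identically. A receiver can decode at a generic point if the
polynomials in the columns of its matrix are linearly independent over the prime field
(`det_rename_ne_zero`), and a linear dependence is a relation `f(η) = p g(η)` with polynomials
`f`, `g`, where `p` is one of `η / p₁`, `p₂`, `p₃`. So it has to be shown that such a relation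
forces `p ∈ {1, η, 1 + η}` (`ratio_cases`), whatever the degrees of `f` and `g`.

For this, let `e` be the last edge whose path sums to the receivers `j` and `k` have the same
ratio as those of the first sender (`exists_last_parallel`). By moving the coding coefficients
that leave `e`, the path sums `s = T(e, τⱼ)` and `t = T(e, τₖ)` can be given independent values
(`movePlane`), and the path sums to the receivers become affine in `s` and `t`. Then `p` is a
Möbius transformation of `s` or of `t`, hence generates the field of rational functions in this
variable, and the quotient of the coprime `f`, `g` has degree at most one
(`natDegree_le_one_of_moebius`). Over the prime field this leaves the six Möbius transformations
and the constant `1`. Comparing coefficients of `s` and `t` excludes the four transformations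
other than `η` and `1 + η` up to two degenerate cases, which are ruled out by the structure of the
graph (`sum_ratSum_mul_ne_zero` and `avoiding_mul_ne`).
-/


/-! ### Path sums and their dependence on the coefficients leaving an edge -/

namespace UnicastNetwork

variable {V E : Type*}

/-- Two edges of the extended graph are consecutive. -/
def Adj (N : UnicastNetwork V E) (a b : ExtEdge E) : Prop := N.extHead a = N.extTail b

/-- The edge `b` comes strictly after the edge `a` on some walk of the extended graph. -/
def Before (N : UnicastNetwork V E) : ExtEdge E → ExtEdge E → Prop := Relation.TransGen N.Adj

/-- A walk of the extended graph between two original vertices stays in the original graph. -/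
lemma transGen_of_ext (N : UnicastNetwork V E) {u w : ExtVertex V}
    (h : Relation.TransGen (fun a b => ∃ e, N.extTail e = a ∧ N.extHead e = b) u w) :
    ∀ v v', u = Sum.inl v → w = Sum.inl v' →
      Relation.TransGen (fun a b => ∃ e, N.tail e = a ∧ N.head e = b) v v' := by
  induction h with
  | single h =>
    rintro v v' rfl rfl
    obtain ⟨e | i | i, h1, h2⟩ := h
    · exact .single ⟨e, Sum.inl.inj h1, Sum.inl.inj h2⟩
    · simp [extTail] at h1
    · simp [extHead] at h2
  | tail h1 h2 ih =>
    rintro v v' rfl rfl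
    obtain ⟨e | i | i, h3, h4⟩ := h2
    · exact (ih v (N.tail e) rfl h3.symm).tail ⟨e, rfl, Sum.inl.inj h4⟩
    · exfalso
      -- no edge enters a virtual sender
      obtain ⟨x, _, e', _, h5⟩ := Relation.TransGen.tail'_iff.1 h1
      rw [← h3] at h5
      rcases e' with e' | j | j <;> simp [extHead, extTail] at h5
    · simp [extHead] at h4

lemma not_before_self (N : UnicastNetwork V E) (a : ExtEdge E) : ¬ N.Before a a := by
  intro h
  have h1 : Relation.TransGen (fun a b => ∃ e, N.extTail e = a ∧ N.extHead e = b)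
      (N.extTail a) (N.extTail a) := Relation.TransGen.lift (r := N.Adj)
        N.extTail (fun a b (hab : N.Adj a b) => ⟨a, rfl, hab⟩) _ _ h
  rcases a with e | i | i
  · exact N.acyclic _ (N.transGen_of_ext h1 _ _ rfl rfl)
  · obtain ⟨x, _, h5⟩ := Relation.TransGen.tail'_iff.1 h
    rcases x with e' | j | j <;> simp [Adj, extHead, extTail] at h5
  · obtain ⟨x, h5, _⟩ := Relation.TransGen.head'_iff.1 h
    rcases x with e' | j | j <;> simp [Adj, extHead, extTail] at h5

lemma not_adj_tau (N : UnicastNetwork V E) (i : Fin 3) (a : ExtEdge E) : ¬ N.Adj (tau i) a := by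
  intro h
  rcases a with e' | j | j <;> simp [Adj, extHead, extTail, tau] at h

lemma Before.trans {N : UnicastNetwork V E} {a b c : ExtEdge E} (h : N.Before a b)
    (h' : N.Before b c) : N.Before a c := Relation.TransGen.trans h h'

lemma Adj.before {N : UnicastNetwork V E} {a b : ExtEdge E} (h : N.Adj a b) : N.Before a b :=
  .single h

/-- The order of the edges is well founded from the receivers upwards, which allows induction on the
first edge of a path. -/
lemma wf_before [Finite E] (N : UnicastNetwork V E) :
    WellFounded (fun a b => N.Before b a) := by
  have : IsTrans (ExtEdge E) (fun a b => N.Before b a) := ⟨fun _ _ _ h h' => Before.trans h' h⟩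
  have : Std.Irrefl (fun a b => N.Before b a) := ⟨N.not_before_self⟩
  exact Finite.wellFounded_of_trans_of_irrefl _

section PathSum

variable (F : Type*) [CommSemiring F] (N : UnicastNetwork V E)

open Classical in
/-- The coding coefficient `x_{ab}` of a pair of consecutive edges, and `0` for other pairs. -/
noncomputable def edgeVar (a b : ExtEdge E) : MvPolynomial N.CodingVar F :=
  if h : N.extHead a = N.extTail b then MvPolynomial.X ⟨(a, b), h⟩ else 0

open Classical in
/-- The sum of the terms `t(P)` of all paths from the edge `a` to the edge `b`. -/
noncomputable def pathSum [Fintype E] (a b : ExtEdge E) : MvPolynomial N.CodingVar F :=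
  ∑ P : {P : List (ExtEdge E) // P.Nodup} with
    (P.1.head? = some a ∧ P.1.getLast? = some b ∧
      P.1.IsChain (fun e' e => N.extHead e' = N.extTail e)), pathTerm F N P.1

lemma transfer_eq_pathSum [Fintype E] (i j : Fin 3) :
    N.transfer F i j = N.pathSum F (sigma j) (tau i) := by
  classical
  unfold transfer pathSum IsPath
  congr!

variable {N} in
lemma nodup_of_isChain {P : List (ExtEdge E)}
    (h : P.IsChain (fun e' e => N.extHead e' = N.extTail e)) : P.Nodup := by
  have : IsTrans (ExtEdge E) N.Before := ⟨fun _ _ _ h h' => Before.trans h h'⟩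
  have h1 : P.IsChain N.Before := h.imp (fun a b hab => Adj.before hab)
  exact (List.isChain_iff_pairwise.1 h1).imp
    (fun {a b} (hab : N.Before a b) (h : a = b) => N.not_before_self b (h ▸ hab))

lemma pathSum_self [Fintype E] (b : ExtEdge E) : N.pathSum F b b = 1 := by
  classical
  rw [pathSum, Finset.sum_eq_single ⟨[b], List.nodup_singleton b⟩]
  · simp [pathTerm]
  · rintro ⟨P, hP⟩ h1 h2
    exfalso
    simp only [Finset.mem_filter, Finset.mem_univ, true_and] at h1
    obtain ⟨ha, hb, -⟩ := h1
    rcases P with _ | ⟨x, _ | ⟨y, P⟩⟩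
    · simp at ha
    · simp only [List.head?_cons, Option.some.injEq] at ha
      subst ha
      exact h2 rfl
    · simp only [List.head?_cons, Option.some.injEq] at ha
      subst ha
      rw [List.getLast?_cons_cons] at hb
      exact (List.nodup_cons.1 hP).1 (List.mem_of_getLast? hb)
  · intro h
    simp at h

/-- A path from `a` to another edge is an edge `c` consecutive to `a` and a path from `c`. -/
lemma pathSum_of_ne [Fintype E] {a b : ExtEdge E} (hab : a ≠ b) :
    N.pathSum F a b = ∑ c, N.edgeVar F a c * N.pathSum F c b := by
  classical
  have h0 : ∀ c, c ∉ Finset.univ.filter (fun c => N.extHead a = N.extTail c) →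
      N.edgeVar F a c * N.pathSum F c b = 0 := by
    intro c hc
    simp only [Finset.mem_filter, Finset.mem_univ, true_and] at hc
    simp [edgeVar, hc]
  rw [← Finset.sum_subset (Finset.filter_subset (fun c => N.extHead a = N.extTail c) Finset.univ)
    (fun c _ hc => h0 c hc)]
  simp only [pathSum, Finset.mul_sum]
  rw [Finset.sum_sigma']
  symm
  refine Finset.sum_bij (fun x hx => ⟨a :: x.2.1, ?_⟩) ?_ ?_ ?_ ?_
  · simp only [Finset.mem_sigma, Finset.mem_filter, Finset.mem_univ, true_and] at hx
    obtain ⟨h1, h2, h3, h4⟩ := hx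
    refine nodup_of_isChain (N := N) ?_
    rw [List.isChain_cons]
    refine ⟨fun y hy => ?_, h4⟩
    rw [h2] at hy
    simp only [Option.mem_def, Option.some.injEq] at hy
    exact hy ▸ h1
  · rintro ⟨c, P, hP⟩ hx
    simp only [Finset.mem_sigma, Finset.mem_filter, Finset.mem_univ, true_and] at hx ⊢
    obtain ⟨h1, h2, h3, h4⟩ := hx
    refine ⟨by simp, ?_, ?_⟩
    · rcases P with _ | ⟨x, P⟩
      · simp at h2
      · rw [List.getLast?_cons_cons]; exact h3
    · rw [List.isChain_cons]
      refine ⟨fun y hy => ?_, h4⟩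
      rw [h2] at hy
      simp only [Option.mem_def, Option.some.injEq] at hy
      exact hy ▸ h1
  · rintro ⟨c, P, hP⟩ hx ⟨c', P', hP'⟩ hx' h
    simp only [Finset.mem_sigma, Finset.mem_filter, Finset.mem_univ, true_and] at hx hx'
    simp only [Subtype.mk.injEq, List.cons.injEq, true_and] at h
    subst h
    have : c = c' := by
      have := hx.2.1.symm.trans hx'.2.1
      simpa using this
    subst this
    rfl
  · rintro ⟨P, hP⟩ hx
    simp only [Finset.mem_filter, Finset.mem_univ, true_and] at hx
    obtain ⟨h2, h3, h4⟩ := hx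
    rcases P with _ | ⟨x, _ | ⟨y, P⟩⟩
    · simp at h2
    · simp only [List.head?_cons, Option.some.injEq, List.getLast?_singleton] at h2 h3
      exact absurd (h2.symm.trans h3) hab
    · simp only [List.head?_cons, Option.some.injEq] at h2
      subst h2
      rw [List.isChain_cons_cons] at h4
      refine ⟨⟨y, ⟨y :: P, (List.nodup_cons.1 hP).2⟩⟩, ?_, rfl⟩
      simp only [Finset.mem_sigma, Finset.mem_filter, Finset.mem_univ, true_and]
      refine ⟨h4.1, by simp, ?_, h4.2⟩
      rw [List.getLast?_cons_cons] at h3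
      exact h3
  · rintro ⟨c, P, hP⟩ hx
    simp only [Finset.mem_sigma, Finset.mem_filter, Finset.mem_univ, true_and] at hx
    obtain ⟨h1, h2, h3, h4⟩ := hx
    rcases P with _ | ⟨x, P⟩
    · simp at h2
    · simp only [List.head?_cons, Option.some.injEq] at h2
      subst h2
      simp [pathTerm, edgeVar]

lemma pathSum_eq_zero [Fintype E] {a b : ExtEdge E} (hab : a ≠ b) (h : ¬ N.Before a b) :
    N.pathSum F a b = 0 := by
  induction a using N.wf_before.induction with
  | _ a ih =>
    rw [N.pathSum_of_ne F hab]
    refine Finset.sum_eq_zero fun c _ => ?_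
    by_cases hc : N.Adj a c
    · rw [ih c hc.before, mul_zero]
      · rintro rfl
        exact h hc.before
      · exact fun h' => h (hc.before.trans h')
    · have h' : ¬ N.extHead a = N.extTail c := hc
      rw [edgeVar, dif_neg h', zero_mul]

variable {F N} in
lemma before_of_pathSum_ne_zero [Fintype E] {a b : ExtEdge E} (h : N.pathSum F a b ≠ 0)
    (hab : a ≠ b) : N.Before a b := by
  by_contra h'
  exact h (N.pathSum_eq_zero F hab h')

lemma pathSum_eq_zero_of_before [Fintype E] {a b : ExtEdge E} (h : N.Before b a) :
    N.pathSum F a b = 0 :=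
  N.pathSum_eq_zero F (fun hab => N.not_before_self _ (hab ▸ h))
    (fun h' => N.not_before_self _ (h.trans h'))

end PathSum

section Eval

variable {F : Type*} [CommRing F] (N : UnicastNetwork V E) {R : Type*} [CommRing R]
  [Algebra F R]

open Classical in
/-- Given the evaluation at `v`, the homomorphism that takes the values
`A` on the coding coefficients leaving the edge `e` and agrees with `v` on the others. -/
noncomputable def reroute (v : N.CodingVar → R) (e : ExtEdge E) (A : ExtEdge E → R) :
    MvPolynomial N.CodingVar F →ₐ[F] R :=
  MvPolynomial.aeval (fun q => if q.1.1 = e then A q.1.2 else v q)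

open Classical in
/-- The linear form of the path sums from `e` to `b`, as a function of the values `A` of the coding
coefficients leaving `e`. -/
noncomputable def outForm (F : Type*) [CommRing F] [Algebra F R] [Fintype E] (v : N.CodingVar → R)
    (e : ExtEdge E) (A : ExtEdge E → R)
    (b : ExtEdge E) : R :=
  ∑ c with N.Adj e c, A c * MvPolynomial.aeval v (N.pathSum F c b)

variable (v : N.CodingVar → R) (e : ExtEdge E) (A : ExtEdge E → R)

lemma reroute_edgeVar_of_ne {a c : ExtEdge E} (h : a ≠ e) :
    N.reroute v e A (N.edgeVar F a c) = MvPolynomial.aeval v (N.edgeVar F a c) := by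
  by_cases hc : N.extHead a = N.extTail c
  · simp [reroute, edgeVar, hc, h]
  · simp [edgeVar, hc]

/-- How a path sum depends on the coding coefficients leaving `e`: paths through `e` contribute the
path sum up to `e` times a linear form. -/
lemma reroute_pathSum [Fintype E] {b : ExtEdge E} (hb : b ≠ e) (a : ExtEdge E) :
    N.reroute v e A (N.pathSum F a b) = MvPolynomial.aeval v (N.pathSum F a b) +
      MvPolynomial.aeval v (N.pathSum F a e) *
        (N.outForm F v e A b - MvPolynomial.aeval v (N.pathSum F e b)) := by
  classical
  induction a using N.wf_before.induction with
  | _ a ih =>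
    by_cases hae : a = e
    · subst hae
      rw [pathSum_self, map_one, one_mul, add_sub_cancel, N.pathSum_of_ne F hb.symm, map_sum,
        outForm, Finset.sum_filter]
      refine Finset.sum_congr rfl fun c _ => ?_
      by_cases hc : N.Adj a c
      · rw [if_pos hc, map_mul, ih c hc.before, N.pathSum_eq_zero_of_before F hc.before]
        have h : N.extHead a = N.extTail c := hc
        simp [reroute, edgeVar, h]
      · have h : ¬ N.extHead a = N.extTail c := hc
        simp [edgeVar, h, hc]
    · by_cases hab : a = b
      · subst hab
        rw [pathSum_self, map_one, map_one]
        by_cases h0 : N.pathSum F a e = 0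
        · simp [h0]
        · have h1 := before_of_pathSum_ne_zero h0 hae
          have h2 : N.outForm F v e A a = 0 := by
            refine Finset.sum_eq_zero fun c hc => ?_
            have hc' : N.Adj e c := by simpa using hc
            rw [N.pathSum_eq_zero_of_before F (h1.trans hc'.before), map_zero, mul_zero]
          rw [h2, N.pathSum_eq_zero_of_before F h1]
          simp
      · rw [N.pathSum_of_ne F hab, N.pathSum_of_ne F hae, map_sum, map_sum, map_sum,
          Finset.sum_mul, ← Finset.sum_add_distrib]
        refine Finset.sum_congr rfl fun c _ => ?_
        rw [map_mul, map_mul, map_mul, reroute_edgeVar_of_ne N v e A hae]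
        by_cases hc : N.Adj a c
        · rw [ih c hc.before]
          ring
        · have h : ¬ N.extHead a = N.extTail c := hc
          simp [edgeVar, h]

/-- Paths that end in `e` do not use the coding coefficients leaving `e`. -/
lemma reroute_pathSum_self [Fintype E] (a : ExtEdge E) :
    N.reroute v e A (N.pathSum F a e) = MvPolynomial.aeval v (N.pathSum F a e) := by
  induction a using N.wf_before.induction with
  | _ a ih =>
    by_cases hae : a = e
    · subst hae
      rw [pathSum_self, map_one, map_one]
    · rw [N.pathSum_of_ne F hae, map_sum, map_sum]
      refine Finset.sum_congr rfl fun c _ => ?_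
      rw [map_mul, map_mul, reroute_edgeVar_of_ne N v e A hae]
      by_cases hc : N.Adj a c
      · rw [ih c hc.before]
      · have h : ¬ N.extHead a = N.extTail c := hc
        simp [edgeVar, h]

end Eval

end UnicastNetwork

/-! ### Path sums as rational functions -/

namespace UnicastNetwork

variable {V E : Type*}

section RationalPathSums

variable {F : Type*} [Field F] [Fintype E] (N : UnicastNetwork V E)

/-- The path sum from `a` to `b`, as a rational function of the coding coefficients. -/
noncomputable def ratSum (F : Type*) [Field F] (a b : ExtEdge E) : RatFun F N :=
  algebraMap (MvPolynomial N.CodingVar F) (RatFun F N) (N.pathSum F a b)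

lemma ratSum_self (b : ExtEdge E) : N.ratSum F b b = 1 := by
  rw [ratSum, pathSum_self, map_one]

variable {N} in
lemma before_of_ratSum_ne_zero {a b : ExtEdge E} (h : N.ratSum F a b ≠ 0) (hab : a ≠ b) :
    N.Before a b :=
  before_of_pathSum_ne_zero (F := F) (fun h' => h (by rw [ratSum, h', map_zero])) hab

lemma ratSum_tau {a : ExtEdge E} {i : Fin 3} (h : tau i ≠ a) : N.ratSum F (tau i) a = 0 := by
  by_contra h'
  obtain ⟨c, hc, -⟩ := Relation.TransGen.head'_iff.1 (before_of_ratSum_ne_zero h' h)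
  exact N.not_adj_tau i c hc

omit [Fintype E] in
lemma tau_injective : Function.Injective (tau : Fin 3 → ExtEdge E) := by
  intro i j h
  simpa [tau] using h

variable {N} in
/-- An edge from which two receivers are reached is none of the virtual edges `τⱼ`. -/
lemma tau_ne_of_ratSum_ne_zero {e : ExtEdge E} {i k : Fin 3} (hik : i ≠ k)
    (hi : N.ratSum F e (tau i) ≠ 0) (hk : N.ratSum F e (tau k) ≠ 0) (j : Fin 3) : tau j ≠ e := by
  rintro rfl
  have h : ∀ l, N.ratSum F (tau j) (tau l) ≠ 0 → l = j := by
    intro l hl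
    by_contra h'
    exact hl (N.ratSum_tau fun h => h' (tau_injective h).symm)
  exact hik ((h i hi).trans (h k hk).symm)

lemma exists_adj_ratSum_ne_zero {a b : ExtEdge E} (hab : a ≠ b) (h : N.ratSum F a b ≠ 0) :
    ∃ c, N.Adj a c ∧ N.ratSum F c b ≠ 0 := by
  by_contra! h'
  apply h
  rw [ratSum, N.pathSum_of_ne F hab, map_sum]
  refine Finset.sum_eq_zero fun c _ => ?_
  rw [map_mul]
  by_cases hc : N.Adj a c
  · rw [show algebraMap _ (RatFun F N) (N.pathSum F c b) = 0 from h' c hc, mul_zero]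
  · have h : ¬ N.extHead a = N.extTail c := hc
    simp [edgeVar, h]

variable {R : Type*} [CommRing R] [Algebra (RatFun F N) R]

/-- The generic value of the coding coefficients, in an algebra over the rational functions. -/
noncomputable def genericPoint (F : Type*) [Field F] (R : Type*) [CommRing R]
    [Algebra (RatFun F N) R] (q : N.CodingVar) : R :=
  algebraMap (RatFun F N) R
    (algebraMap (MvPolynomial N.CodingVar F) (RatFun F N) (MvPolynomial.X q))

open Classical in
/-- The homomorphism that moves the vector of the coding coefficients leaving `e` to `s` times
itself plus `t` times the unit vector of the edge `c`, and fixes all other coding coefficients. -/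
noncomputable def moveLine [Algebra F R] (e c : ExtEdge E) (s t : R) :
    MvPolynomial N.CodingVar F →ₐ[F] R :=
  N.reroute (N.genericPoint F R) e
    (fun a => s * algebraMap (RatFun F N) R
        (algebraMap (MvPolynomial N.CodingVar F) (RatFun F N) (N.edgeVar F e a)) +
      if a = c then t else 0)

variable [Algebra F R] [IsScalarTower F (RatFun F N) R]

omit [Fintype E] in
lemma aeval_genericPoint (P : MvPolynomial N.CodingVar F) :
    MvPolynomial.aeval (N.genericPoint F R) P =
      algebraMap (RatFun F N) R
        (algebraMap (MvPolynomial N.CodingVar F) (RatFun F N) P) := by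
  have : MvPolynomial.aeval (N.genericPoint F R) =
      ((IsScalarTower.toAlgHom F (RatFun F N) R).comp
        (IsScalarTower.toAlgHom F (MvPolynomial N.CodingVar F) (RatFun F N))) := by
    apply MvPolynomial.algHom_ext
    intro q
    simp [genericPoint]
  rw [this]
  rfl

/-- A path sum splits into the part that avoids `e`, which stays fixed, and the part through `e`,
whose last factor moves linearly. -/
lemma moveLine_pathSum {e c : ExtEdge E} {s t : R} (hc : N.Adj e c ∨ t = 0) {b : ExtEdge E}
    (hb : b ≠ e) (a : ExtEdge E) :
    N.moveLine e c s t (N.pathSum F a b) =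
      algebraMap (RatFun F N) R (N.ratSum F a b - N.ratSum F a e * N.ratSum F e b) +
      algebraMap (RatFun F N) R (N.ratSum F a e) *
        (s * algebraMap (RatFun F N) R (N.ratSum F e b) +
          t * algebraMap (RatFun F N) R (N.ratSum F c b)) := by
  classical
  rw [moveLine, reroute_pathSum _ _ _ _ hb]
  have h : N.outForm F (N.genericPoint F R) e
      (fun a => s * algebraMap (RatFun F N) R
          (algebraMap (MvPolynomial N.CodingVar F) (RatFun F N) (N.edgeVar F e a)) +
        if a = c then t else 0) b = s * algebraMap (RatFun F N) R (N.ratSum F e b) +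
          t * algebraMap (RatFun F N) R (N.ratSum F c b) := by
    simp only [outForm, aeval_genericPoint, add_mul, Finset.sum_add_distrib]
    congr 1
    · rw [ratSum, N.pathSum_of_ne F hb.symm, map_sum, map_sum, Finset.mul_sum, Finset.sum_filter]
      refine Finset.sum_congr rfl fun a _ => ?_
      split_ifs with ha
      · simp only [map_mul, mul_assoc]
      · have h : ¬ N.extHead e = N.extTail a := ha
        simp [edgeVar, h]
    · rw [Finset.sum_filter]
      rcases hc with hc | rfl
      · rw [Finset.sum_eq_single c]
        · simp [hc, ratSum]
        · intro a _ hac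
          simp [hac]
        · simp
      · simp
  rw [h]
  simp only [aeval_genericPoint, ratSum, map_sub, map_mul]
  ring

/-- Paths that end in an edge before `e`, or in `e`, do not use the coefficients that move. -/
lemma moveLine_pathSum_of_ne_zero {e c : ExtEdge E} {s t : R} {a : ExtEdge E}
    (ha : a = e ∨ N.ratSum F a e ≠ 0) (b : ExtEdge E) :
    N.moveLine e c s t (N.pathSum F b a) = algebraMap (RatFun F N) R (N.ratSum F b a) := by
  by_cases hae : a = e
  · subst hae
    rw [moveLine, reroute_pathSum_self, aeval_genericPoint, ratSum]
  · rw [moveLine, reroute_pathSum _ _ _ _ hae]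
    have h1 := before_of_ratSum_ne_zero (ha.resolve_left hae) hae
    have h2 : ∀ A : ExtEdge E → R, N.outForm F (N.genericPoint F R) e A a = 0 := by
      intro A
      refine Finset.sum_eq_zero fun c hc => ?_
      have hc' : N.Adj e c := by simpa using hc
      rw [N.pathSum_eq_zero_of_before F (h1.trans hc'.before), map_zero, mul_zero]
    rw [h2, N.pathSum_eq_zero_of_before F h1]
    simp [aeval_genericPoint, ratSum]

end RationalPathSums

section Structure

variable {F : Type*} [Field F] [Fintype E] {N : UnicastNetwork V E}

omit [Fintype E] in
/-- Every polynomial identity between path sums persists under a substitution. -/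
lemma eq_of_ratSum_eq {R : Type*} [CommRing R] [Algebra F R]
    (φ : MvPolynomial N.CodingVar F →ₐ[F] R) {P Q : MvPolynomial N.CodingVar F}
    (h : algebraMap _ (RatFun F N) P = algebraMap _ (RatFun F N) Q) : φ P = φ Q := by
  rw [IsFractionRing.injective (MvPolynomial N.CodingVar F) (RatFun F N) h]

/-- Being reached by paths is transitive. -/
lemma ratSum_mul_ne_zero {a b c : ExtEdge E} (hab : N.ratSum F a b ≠ 0)
    (hbc : N.ratSum F b c ≠ 0) : N.ratSum F a c ≠ 0 := by
  by_cases h : c = b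
  · exact h ▸ hab
  intro h0
  have h1 := eq_of_ratSum_eq (N.moveLine (R := RatFun F N) b b 0 0) (P := N.pathSum F a c) (Q := 0)
    (by rw [map_zero]; exact h0)
  rw [N.moveLine_pathSum (.inr rfl) h, h0, map_zero] at h1
  simp only [Algebra.algebraMap_self, RingHom.id_apply] at h1
  exact mul_ne_zero hab hbc (by linear_combination -h1)

/-- Among the edges whose path sums to two receivers have the same ratio as those of `a`, the last
one has a successor at which the ratio differs. -/
lemma exists_last_parallel {a : ExtEdge E} {i k : Fin 3} (hik : i ≠ k)
    (hi : N.ratSum F a (tau i) ≠ 0) (hk : N.ratSum F a (tau k) ≠ 0) :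
    ∃ e c, N.ratSum F e (tau i) ≠ 0 ∧ N.ratSum F e (tau k) ≠ 0 ∧
      N.ratSum F a (tau i) * N.ratSum F e (tau k) = N.ratSum F a (tau k) * N.ratSum F e (tau i) ∧
      N.Adj e c ∧
      N.ratSum F c (tau i) * N.ratSum F e (tau k) ≠
        N.ratSum F c (tau k) * N.ratSum F e (tau i) := by
  obtain ⟨e, ⟨h1, h2, h3⟩, h4⟩ := N.wf_before.has_min
    {e | N.ratSum F e (tau i) ≠ 0 ∧ N.ratSum F e (tau k) ≠ 0 ∧
      N.ratSum F a (tau i) * N.ratSum F e (tau k) = N.ratSum F a (tau k) * N.ratSum F e (tau i)}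
    ⟨a, hi, hk, mul_comm _ _⟩
  by_contra! h5
  obtain ⟨c, hc, hc0⟩ := N.exists_adj_ratSum_ne_zero (tau_ne_of_ratSum_ne_zero hik h1 h2 i).symm h1
  have h6 := h5 e c h1 h2 h3 hc
  have h7 : N.ratSum F c (tau k) ≠ 0 := by
    intro h
    rw [h, zero_mul] at h6
    exact mul_ne_zero hc0 h2 h6
  refine h4 c ⟨hc0, h7, ?_⟩ hc.before
  apply mul_right_cancel₀ h2
  apply mul_right_cancel₀ h1
  linear_combination N.ratSum F e (tau i) * N.ratSum F c (tau k) * h3 -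
    N.ratSum F a (tau k) * N.ratSum F e (tau i) * h6

/-- All paths from `a` to either of two receivers pass through the last edge whose path sums to
these receivers have the same ratio as those of `a`. -/
lemma ratSum_eq_mul_of_last_parallel {a e c : ExtEdge E} {i k : Fin 3} (hik : i ≠ k)
    (hi : N.ratSum F e (tau i) ≠ 0) (hk : N.ratSum F e (tau k) ≠ 0)
    (h : N.ratSum F a (tau i) * N.ratSum F e (tau k) =
      N.ratSum F a (tau k) * N.ratSum F e (tau i))
    (hc : N.Adj e c)
    (hne : N.ratSum F c (tau i) * N.ratSum F e (tau k) ≠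
      N.ratSum F c (tau k) * N.ratSum F e (tau i)) :
    N.ratSum F a (tau i) = N.ratSum F a e * N.ratSum F e (tau i) := by
  have hn := tau_ne_of_ratSum_ne_zero hik hi hk
  have h1 := eq_of_ratSum_eq (N.moveLine (R := RatFun F N) e c 0 1)
    (P := N.pathSum F a (tau i) * N.pathSum F e (tau k))
    (Q := N.pathSum F a (tau k) * N.pathSum F e (tau i)) (by simpa [ratSum] using h)
  simp only [map_mul, N.moveLine_pathSum (.inl hc) (hn _), N.ratSum_self,
    Algebra.algebraMap_self, RingHom.id_apply] at h1
  have h2 : (N.ratSum F a (tau i) - N.ratSum F a e * N.ratSum F e (tau i)) *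
      (N.ratSum F c (tau i) * N.ratSum F e (tau k) -
        N.ratSum F c (tau k) * N.ratSum F e (tau i)) = 0 := by
    linear_combination (-N.ratSum F e (tau i)) * h1 + N.ratSum F c (tau i) * h
  rcases mul_eq_zero.1 h2 with h3 | h3
  · exact sub_eq_zero.1 h3
  · exact absurd (sub_eq_zero.1 h3) hne

end Structure

end UnicastNetwork

/-! ### Cuts, and sums of ratios of path sums -/

/-- A polynomial of degree at most four that vanishes on an infinite field is zero. -/
lemma coeff_eq_zero_of_forall_eval {K : Type*} [Field K] [Infinite K] {a₀ a₁ a₂ a₃ a₄ : K}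
    (h : ∀ r : K, a₀ + a₁ * r + a₂ * r ^ 2 + a₃ * r ^ 3 + a₄ * r ^ 4 = 0) :
    a₀ = 0 ∧ a₁ = 0 ∧ a₂ = 0 ∧ a₃ = 0 ∧ a₄ = 0 := by
  have h1 : (Polynomial.C a₀ + Polynomial.C a₁ * Polynomial.X + Polynomial.C a₂ * Polynomial.X ^ 2 +
      Polynomial.C a₃ * Polynomial.X ^ 3 + Polynomial.C a₄ * Polynomial.X ^ 4) = 0 := by
    apply Polynomial.funext
    intro r
    simpa using h r
  have h2 := fun i => congrArg (fun p => Polynomial.coeff p i) h1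
  simp only [Polynomial.coeff_add, Polynomial.coeff_C_mul, Polynomial.coeff_X_pow,
    Polynomial.coeff_X, Polynomial.coeff_C, Polynomial.coeff_zero] at h2
  exact ⟨by simpa using h2 0, by simpa using h2 1, by simpa using h2 2, by simpa using h2 3,
    by simpa using h2 4⟩

namespace UnicastNetwork

variable {V E : Type*} {F : Type*} [Field F] [Fintype E] {N : UnicastNetwork V E}

omit [Fintype E] in
lemma infinite_ratFun {e c : ExtEdge E} (h : N.Adj e c) : Infinite (RatFun F N) := by
  have : Nonempty N.CodingVar := ⟨⟨(e, c), h⟩⟩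
  have : Infinite (MvPolynomial N.CodingVar F) := inferInstance
  exact Infinite.of_injective _
    (IsFractionRing.injective (MvPolynomial N.CodingVar F) (RatFun F N))

lemma ratSum_eq_zero_trans {a b c : ExtEdge E} (hab : N.ratSum F a b ≠ 0)
    (hac : N.ratSum F a c = 0) : N.ratSum F b c = 0 := by
  by_contra h
  exact ratSum_mul_ne_zero hab h hac

/-- Two edges through which all paths from `s` to `i` pass are comparable. -/
lemma ratSum_ne_zero_or_of_cuts {s b e₁ e₂ : ExtEdge E} (h1b : e₁ ≠ b)
    (h0 : N.ratSum F s b ≠ 0)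
    (h₁ : N.ratSum F s b = N.ratSum F s e₁ * N.ratSum F e₁ b)
    (h₂ : N.ratSum F s b = N.ratSum F s e₂ * N.ratSum F e₂ b) :
    N.ratSum F e₁ e₂ ≠ 0 ∨ N.ratSum F e₂ e₁ ≠ 0 := by
  by_contra! h
  obtain ⟨h12, h21⟩ := h
  have hne : e₂ ≠ e₁ := by
    rintro rfl
    rw [ratSum_self] at h12
    exact one_ne_zero h12
  -- sending the coefficients leaving `e₁` to zero does not change the right-hand side
  have h3 := eq_of_ratSum_eq (N.moveLine (R := RatFun F N) e₁ e₁ 0 0)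
    (P := N.pathSum F s b) (Q := N.pathSum F s e₂ * N.pathSum F e₂ b)
    (by rw [map_mul]; exact h₂)
  rw [map_mul, N.moveLine_pathSum (.inr rfl) h1b.symm,
    N.moveLine_pathSum (.inr rfl) hne, N.moveLine_pathSum (.inr rfl) h1b.symm] at h3
  simp only [h12, h21, Algebra.algebraMap_self, RingHom.id_apply] at h3
  apply h0
  linear_combination -h3 + h₁ + h₂

omit [Fintype E] in
lemma charTwo_ratFun [CharP F 2] : (2 : RatFun F N) = 0 := by
  have hchar : CharP (RatFun F N) 2 := charP_of_injective_algebraMap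
    (algebraMap F (RatFun F N)).injective 2
  exact CharP.cast_eq_zero (RatFun F N) 2

/-- If an edge `c` reaches receiver `p` but not receiver `q`, and the sum of the ratios of the path
sums of `c` and `s` vanishes, then some edge lies on all paths from `s` to the receivers other than
`q`, and does not reach `q`. -/
lemma exists_cut_of_sum_eq_zero [CharP F 2] {p q r : Fin 3} (hpr : p ≠ r) {s c : ExtEdge E}
    (hsq : N.ratSum F s (tau q) ≠ 0) (hsr : N.ratSum F s (tau r) ≠ 0)
    (hcp : N.ratSum F c (tau p) ≠ 0) (hcq : N.ratSum F c (tau q) = 0)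
    (h : N.ratSum F c (tau p) * N.ratSum F s (tau q) * N.ratSum F s (tau r) +
      N.ratSum F c (tau q) * N.ratSum F s (tau p) * N.ratSum F s (tau r) +
      N.ratSum F c (tau r) * N.ratSum F s (tau p) * N.ratSum F s (tau q) = 0) :
    ∃ e, N.ratSum F s (tau p) = N.ratSum F s e * N.ratSum F e (tau p) ∧
      N.ratSum F s (tau r) = N.ratSum F s e * N.ratSum F e (tau r) ∧
      N.ratSum F e (tau q) = 0 ∧ ∀ l, tau l ≠ e := by
  have h2 := charTwo_ratFun (F := F) (N := N)
  have h3 : N.ratSum F c (tau p) * N.ratSum F s (tau r) =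
      N.ratSum F c (tau r) * N.ratSum F s (tau p) := by
    apply mul_right_cancel₀ hsq
    linear_combination h - N.ratSum F s (tau p) * N.ratSum F s (tau r) * hcq -
      N.ratSum F c (tau r) * N.ratSum F s (tau p) * N.ratSum F s (tau q) * h2
  have hcr : N.ratSum F c (tau r) ≠ 0 := by
    intro h0
    rw [h0, zero_mul] at h3
    exact mul_ne_zero hcp hsr h3
  obtain ⟨e, d, hep, her, hpar, had, hne⟩ := exists_last_parallel hpr hcp hcr
  have hs : N.ratSum F s (tau p) * N.ratSum F e (tau r) =
      N.ratSum F s (tau r) * N.ratSum F e (tau p) := by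
    apply mul_right_cancel₀ hcp
    linear_combination N.ratSum F s (tau p) * hpar - N.ratSum F e (tau p) * h3
  refine ⟨e, ratSum_eq_mul_of_last_parallel hpr hep her hs had hne,
    ratSum_eq_mul_of_last_parallel hpr.symm her hep hs.symm had hne.symm,
    ?_, tau_ne_of_ratSum_ne_zero hpr hep her⟩
  have hce := ratSum_eq_mul_of_last_parallel hpr hep her hpar had hne
  exact ratSum_eq_zero_trans (a := c) (fun h0 => hcp (by rw [hce, h0, zero_mul])) hcq

/-- Two cuts between `s` and a common receiver `r` cannot miss two receivers alternately. -/
lemma false_of_cuts {s e₁ e₂ : ExtEdge E} {x q r : Fin 3}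
    (hsx : N.ratSum F s (tau x) ≠ 0) (hsq : N.ratSum F s (tau q) ≠ 0)
    (hsr : N.ratSum F s (tau r) ≠ 0)
    (h1x : N.ratSum F s (tau x) = N.ratSum F s e₁ * N.ratSum F e₁ (tau x))
    (h1r : N.ratSum F s (tau r) = N.ratSum F s e₁ * N.ratSum F e₁ (tau r))
    (h1q : N.ratSum F e₁ (tau q) = 0) (h1 : ∀ l, tau l ≠ e₁)
    (h2q : N.ratSum F s (tau q) = N.ratSum F s e₂ * N.ratSum F e₂ (tau q))
    (h2r : N.ratSum F s (tau r) = N.ratSum F s e₂ * N.ratSum F e₂ (tau r))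
    (h2x : N.ratSum F e₂ (tau x) = 0) : False := by
  rcases ratSum_ne_zero_or_of_cuts (h1 r).symm hsr h1r h2r with h | h
  · exact right_ne_zero_of_mul (h2q ▸ hsq) (ratSum_eq_zero_trans h h1q)
  · exact right_ne_zero_of_mul (h1x ▸ hsx) (ratSum_eq_zero_trans h h2x)

/-- The ratios of the path sums of two edges `e` and `s` to the three receivers do not add up to
zero. By induction on `e`: if `e` is not reached from `s`, a vanishing sum persists at the
    successors
of `e`, each of which therefore misses a receiver, and these yield cuts that exclude each other. If
`e` is reached from `s`, the sum is a polynomial in a common factor of the coefficients leaving `e`,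
whose leading coefficient is odd. -/
lemma sum_ratSum_mul_ne_zero [CharP F 2] {i j k : Fin 3} (hij : i ≠ j) (hik : i ≠ k) (hjk : j ≠ k)
    {s : ExtEdge E} (hsi : N.ratSum F s (tau i) ≠ 0) (hsj : N.ratSum F s (tau j) ≠ 0)
    (hsk : N.ratSum F s (tau k) ≠ 0) (e : ExtEdge E) (hei : N.ratSum F e (tau i) ≠ 0)
    (hej : N.ratSum F e (tau j) ≠ 0) (hek : N.ratSum F e (tau k) ≠ 0) :
    N.ratSum F e (tau i) * N.ratSum F s (tau j) * N.ratSum F s (tau k) +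
      N.ratSum F e (tau j) * N.ratSum F s (tau i) * N.ratSum F s (tau k) +
      N.ratSum F e (tau k) * N.ratSum F s (tau i) * N.ratSum F s (tau j) ≠ 0 := by
  have h2 := charTwo_ratFun (F := F) (N := N)
  induction e using N.wf_before.induction with
  | _ e ih =>
    intro h
    have hn := tau_ne_of_ratSum_ne_zero hij hei hej
    obtain ⟨c₀, hc₀, hc₀i⟩ := N.exists_adj_ratSum_ne_zero (hn i).symm hei
    have hinf := infinite_ratFun (F := F) hc₀
    have hP : algebraMap (MvPolynomial N.CodingVar F) (RatFun F N)
        (N.pathSum F e (tau i) * N.pathSum F s (tau j) * N.pathSum F s (tau k) +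
        N.pathSum F e (tau j) * N.pathSum F s (tau i) * N.pathSum F s (tau k) +
        N.pathSum F e (tau k) * N.pathSum F s (tau i) * N.pathSum F s (tau j)) =
        algebraMap _ _ 0 := by
      simpa [ratSum] using h
    by_cases hse : N.ratSum F s e = 0
    · -- the relation is linear in the coefficients leaving `e`, so it holds at all successors
      have hlin : ∀ c, N.Adj e c →
          N.ratSum F c (tau i) * N.ratSum F s (tau j) * N.ratSum F s (tau k) +
          N.ratSum F c (tau j) * N.ratSum F s (tau i) * N.ratSum F s (tau k) +
          N.ratSum F c (tau k) * N.ratSum F s (tau i) * N.ratSum F s (tau j) = 0 := by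
        intro c hc
        have h1 := eq_of_ratSum_eq (N.moveLine (R := RatFun F N) e c 0 1) hP
        simp only [map_mul, map_add, N.moveLine_pathSum (.inl hc) (hn _), N.ratSum_self,
          Algebra.algebraMap_self, RingHom.id_apply, hse, map_zero] at h1
        linear_combination h1
      -- hence, by induction, every successor misses one of the receivers
      have hmiss : ∀ c, N.Adj e c → N.ratSum F c (tau i) ≠ 0 → N.ratSum F c (tau j) ≠ 0 →
          N.ratSum F c (tau k) = 0 := by
        intro c hc h1 h2
        by_contra h3
        exact ih c hc.before h1 h2 h3 (hlin c hc)
      -- the cuts of two successors that miss different receivers exclude each other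
      have key : ∀ x q r : Fin 3, x ≠ r → q ≠ r →
          N.ratSum F s (tau x) ≠ 0 → N.ratSum F s (tau q) ≠ 0 → N.ratSum F s (tau r) ≠ 0 →
          (∀ c, N.Adj e c →
            N.ratSum F c (tau x) * N.ratSum F s (tau q) * N.ratSum F s (tau r) +
            N.ratSum F c (tau q) * N.ratSum F s (tau x) * N.ratSum F s (tau r) +
            N.ratSum F c (tau r) * N.ratSum F s (tau x) * N.ratSum F s (tau q) = 0) →
          ∀ c c', N.Adj e c → N.Adj e c' → N.ratSum F c (tau x) ≠ 0 →
            N.ratSum F c (tau q) = 0 → N.ratSum F c' (tau q) ≠ 0 →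
            N.ratSum F c' (tau x) = 0 → False := by
        intro x q r hxr hqr hsx hsq hsr hrel c c' hc hc' h1 h2 h3 h4
        obtain ⟨e₁, h5, h6, h7, h8⟩ :=
          exists_cut_of_sum_eq_zero hxr hsq hsr h1 h2 (hrel c hc)
        obtain ⟨e₂, h9, h10, h11, -⟩ :=
          exists_cut_of_sum_eq_zero hqr hsx hsr h3 h4
            (by linear_combination hrel c' hc')
        exact false_of_cuts hsx hsq hsr h5 h6 h7 h8 h9 h10 h11
      obtain ⟨cj, hcj, hcjj⟩ := N.exists_adj_ratSum_ne_zero (hn j).symm hej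
      obtain ⟨ck, hck, hckk⟩ := N.exists_adj_ratSum_ne_zero (hn k).symm hek
      have key_ij := key i j k hik hjk hsi hsj hsk hlin
      have key_ik := key i k j hij hjk.symm hsi hsk hsj
        (fun c hc => by linear_combination hlin c hc)
      have key_jk := key j k i hij.symm hik.symm hsj hsk hsi
        (fun c hc => by linear_combination hlin c hc)
      by_cases h0j : N.ratSum F c₀ (tau j) = 0
      · by_cases hji : N.ratSum F cj (tau i) = 0
        · exact key_ij c₀ cj hc₀ hcj hc₀i h0j hcjj hji
        · have hjk0 := hmiss cj hcj hji hcjj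
          by_cases hkj : N.ratSum F ck (tau j) = 0
          · exact key_jk cj ck hcj hck hcjj hjk0 hckk hkj
          · by_cases hki : N.ratSum F ck (tau i) = 0
            · exact key_ik cj ck hcj hck hji hjk0 hckk hki
            · exact hckk (hmiss ck hck hki hkj)
      · have h0k := hmiss c₀ hc₀ hc₀i h0j
        by_cases hki : N.ratSum F ck (tau i) = 0
        · exact key_ik c₀ ck hc₀ hck hc₀i h0k hckk hki
        · have hkj : N.ratSum F ck (tau j) = 0 := by
            by_contra hkj
            exact hckk (hmiss ck hck hki hkj)
          exact key_jk c₀ ck hc₀ hck h0j h0k hckk hkj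
    · -- otherwise the leading coefficient in a common factor of the coefficients leaving `e` is
      -- three times a product of nonzero path sums
      have h1 := fun r : RatFun F N =>
        eq_of_ratSum_eq (N.moveLine (R := RatFun F N) e e r 0) hP
      simp only [map_mul, map_add, N.moveLine_pathSum (.inr rfl) (hn _), N.ratSum_self,
        Algebra.algebraMap_self, RingHom.id_apply, map_zero] at h1
      set D := fun l : Fin 3 => N.ratSum F s (tau l) - N.ratSum F s e * N.ratSum F e (tau l)
        with hD
      set l := fun l : Fin 3 => N.ratSum F e (tau l) with hl
      set d := N.ratSum F s e
      obtain ⟨-, -, -, h3, -⟩ := coeff_eq_zero_of_forall_eval (a₀ := 0)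
        (a₁ := l i * D j * D k + l j * D i * D k + l k * D i * D j)
        (a₂ := d * (l i * (D j * l k + D k * l j) + l j * (D i * l k + D k * l i) +
          l k * (D i * l j + D j * l i)))
        (a₃ := d ^ 2 * (3 * (l i * l j * l k))) (a₄ := 0) (by
          intro r
          have := h1 r
          simp only [hD, hl]
          linear_combination this)
      have h4 : d ^ 2 * (l i * l j * l k) = 0 := by
        linear_combination h3 - d ^ 2 * (l i * l j * l k) * h2
      exact mul_ne_zero (pow_ne_zero 2 hse) (mul_ne_zero (mul_ne_zero hei hej) hek) h4

/-- If all paths from `s` to receiver `i` and all paths from `s'` to receiver `k` pass through `e`,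
then the path sums that avoid `e`, from `s` to `k` and from `s'` to `i`, are not tied to the ratio
    of
the path sums from `e` to `k` and `i`: the coefficients that leave the last edge common to all paths
from `e` to `i` and `k` change this ratio and nothing else in the relation. -/
lemma avoiding_mul_ne {i k : Fin 3} (hik : i ≠ k) {s s' e : ExtEdge E}
    (hei : N.ratSum F e (tau i) ≠ 0) (hek : N.ratSum F e (tau k) ≠ 0)
    (hsi : N.ratSum F s (tau i) = N.ratSum F s e * N.ratSum F e (tau i))
    (hsk : N.ratSum F s' (tau k) = N.ratSum F s' e * N.ratSum F e (tau k))
    (hs : N.ratSum F s e ≠ 0)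
    (hs' : N.ratSum F s' (tau i) ≠ N.ratSum F s' e * N.ratSum F e (tau i)) :
    (N.ratSum F s (tau k) - N.ratSum F s e * N.ratSum F e (tau k)) *
        N.ratSum F s' e * N.ratSum F e (tau i) ≠
      N.ratSum F s e * (N.ratSum F s' (tau i) - N.ratSum F s' e * N.ratSum F e (tau i)) *
        N.ratSum F e (tau k) := by
  intro h
  obtain ⟨g, c, hgi, hgk, hpar, hc, hne⟩ := exists_last_parallel hik hei hek
  have hn := tau_ne_of_ratSum_ne_zero hik hgi hgk
  have hegi := ratSum_eq_mul_of_last_parallel hik hgi hgk hpar hc hne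
  have hegk := ratSum_eq_mul_of_last_parallel hik.symm hgk hgi hpar.symm hc hne.symm
  have heg : N.ratSum F e g ≠ 0 := fun h0 => hei (by rw [hegi, h0, zero_mul])
  have hmove : ∀ (x y : RatFun F N) (a : ExtEdge E),
      N.moveLine g c x y (N.pathSum F a e) = N.ratSum F a e :=
    fun x y a => N.moveLine_pathSum_of_ne_zero (.inr heg) a
  -- all paths from `a` to `g` pass through `e`, if all paths from `a` to some receiver do
  have hcut : ∀ (a : ExtEdge E) (l : Fin 3), N.ratSum F g (tau l) ≠ 0 →
      N.ratSum F e (tau l) = N.ratSum F e g * N.ratSum F g (tau l) →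
      N.ratSum F a (tau l) = N.ratSum F a e * N.ratSum F e (tau l) →
      N.ratSum F a g = N.ratSum F a e * N.ratSum F e g := by
    intro a l hgl hegl h1
    have h2 := eq_of_ratSum_eq (N.moveLine (R := RatFun F N) g c 0 0)
      (P := N.pathSum F a (tau l)) (Q := N.pathSum F a e * N.pathSum F e (tau l))
      (by rw [map_mul]; exact h1)
    simp only [map_mul, hmove, N.moveLine_pathSum (.inr rfl) (hn _), Algebra.algebraMap_self,
      RingHom.id_apply] at h2
    apply mul_right_cancel₀ hgl
    linear_combination h1 - h2
  have hsg := hcut s i hgi hegi hsi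
  have hsg' := hcut s' k hgk hegk hsk
  have h1 := eq_of_ratSum_eq (N.moveLine (R := RatFun F N) g c 0 1)
    (P := (N.pathSum F s (tau k) - N.pathSum F s e * N.pathSum F e (tau k)) *
        N.pathSum F s' e * N.pathSum F e (tau i))
    (Q := N.pathSum F s e * (N.pathSum F s' (tau i) - N.pathSum F s' e * N.pathSum F e (tau i)) *
        N.pathSum F e (tau k)) (by simpa only [map_mul, map_sub, ratSum] using h)
  simp only [map_mul, map_sub, hmove, N.moveLine_pathSum (.inl hc) (hn _),
    Algebra.algebraMap_self, RingHom.id_apply, hsg, hsg', hegi, hegk] at h1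
  rw [hegi, hegk] at h
  apply hne
  have h3 : N.ratSum F s e * (N.ratSum F s' (tau i) - N.ratSum F s' e * N.ratSum F e (tau i)) *
      N.ratSum F e g ≠ 0 := mul_ne_zero (mul_ne_zero hs (sub_ne_zero.2 hs')) heg
  rw [hegi] at h3
  apply mul_left_cancel₀ h3
  linear_combination N.ratSum F g (tau i) * h1 - N.ratSum F c (tau i) * h

end UnicastNetwork

/-! ### Relations between path sums that are polynomial in two variables -/

/-- A polynomial of degree at most three in each of two variables that vanishes on an infinite field
is zero. -/
lemma coeff_eq_zero_of_forall_eval₂ {K : Type*} [Field K] [Infinite K] (c : Fin 4 → Fin 4 → K)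
    (h : ∀ s t : K, ∑ i, ∑ j, c i j * s ^ (i : ℕ) * t ^ (j : ℕ) = 0) (i j : Fin 4) :
    c i j = 0 := by
  have h1 : ∀ t i, ∑ j, c i j * t ^ (j : ℕ) = 0 := by
    intro t
    obtain ⟨h0, h1, h2, h3, -⟩ := coeff_eq_zero_of_forall_eval
      (a₀ := ∑ j, c 0 j * t ^ (j : ℕ)) (a₁ := ∑ j, c 1 j * t ^ (j : ℕ))
      (a₂ := ∑ j, c 2 j * t ^ (j : ℕ)) (a₃ := ∑ j, c 3 j * t ^ (j : ℕ)) (a₄ := 0) (by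
        intro s
        have := h s t
        simp only [Fin.sum_univ_four] at this ⊢
        norm_num at this ⊢
        linear_combination this)
    intro i
    fin_cases i <;> assumption
  obtain ⟨h0, h1, h2, h3, -⟩ := coeff_eq_zero_of_forall_eval
    (a₀ := c i 0) (a₁ := c i 1) (a₂ := c i 2) (a₃ := c i 3) (a₄ := 0) (by
        intro t
        have := h1 t i
        simp only [Fin.sum_univ_four] at this ⊢
        norm_num at this ⊢
        linear_combination this)
  fin_cases j <;> assumption

section Relations

/-! Each relation below is polynomial in the path sums `s`, `t` from an edge to two receivers; the
path sum to the third receiver is `μ * s + ν * t`. The `aᵢⱼ` are the path sums from sender `j` to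
receiver `i` that avoid the edge, and the `cⱼ` are the path sums from sender `j` to the edge. The
relation is arranged as a table of the coefficients of the monomials `s ^ i * t ^ j`, all of which
vanish. -/

variable {K : Type*} [Field K] [Infinite K]
  {a₂₂ a₃₂ a₁₂ a₂₃ a₁₃ c₂ c₃ μ ν : K}

/-- The coefficients of the relation `p (1 + η) = 1`. -/
lemma relation_inv_one_add (h2 : (2 : K) = 0)
    (h₃₂ : a₃₂ ≠ 0 ∨ c₂ ≠ 0)
    (h₁₂ : a₁₂ ≠ 0 ∨ c₂ ≠ 0 ∧ (μ ≠ 0 ∨ ν ≠ 0))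
    (h₁₃ : a₁₃ ≠ 0 ∨ c₃ ≠ 0 ∧ (μ ≠ 0 ∨ ν ≠ 0))
    (hne : a₂₂ ≠ 0 ∨ a₃₂ ≠ 0)
    (h : ∀ s t : K, (a₂₂ + c₂ * s) * t * (s * (a₃₂ + c₂ * t) * (a₁₃ + c₃ * (μ * s + ν * t)) +
        t * (a₁₂ + c₂ * (μ * s + ν * t)) * (a₂₃ + c₃ * s)) =
      s ^ 2 * (a₃₂ + c₂ * t) ^ 2 * (a₁₃ + c₃ * (μ * s + ν * t))) :
    False := by
  have hc := coeff_eq_zero_of_forall_eval₂ ![![0, 0, a₁₂ * a₂₂ * a₂₃, a₂₂ * a₂₃ * c₂ * ν],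
      ![0, a₁₃ * a₂₂ * a₃₂, a₁₂ * a₂₂ * c₃ + a₁₂ * a₂₃ * c₂ + a₁₃ * a₂₂ * c₂ + a₂₂ * a₂₃ * c₂ * μ +
        a₂₂ * a₃₂ * c₃ * ν, 2 * a₂₂ * c₂ * c₃ * ν + a₂₃ * c₂ ^ 2 * ν],
      ![-a₁₃ * a₃₂ ^ 2, -a₁₃ * a₃₂ * c₂ + a₂₂ * a₃₂ * c₃ * μ - a₃₂ ^ 2 * c₃ * ν, a₁₂ * c₂ * c₃ + 2
        * a₂₂ * c₂ * c₃ * μ + a₂₃ * c₂ ^ 2 * μ - a₃₂ * c₂ * c₃ * ν, c₂ ^ 2 * c₃ * ν],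
      ![-a₃₂ ^ 2 * c₃ * μ, -a₃₂ * c₂ * c₃ * μ, c₂ ^ 2 * c₃ * μ, 0]] (by
      intro s t
      simp only [Fin.sum_univ_four, Matrix.cons_val]
      norm_num
      linear_combination h s t)
  have h02 : a₁₂ * a₂₂ * a₂₃ = 0 := hc 0 2
  have h03 : a₂₂ * a₂₃ * c₂ * ν = 0 := hc 0 3
  have h11 : a₁₃ * a₂₂ * a₃₂ = 0 := hc 1 1
  have h12 : a₁₂ * a₂₂ * c₃ + a₁₂ * a₂₃ * c₂ + a₁₃ * a₂₂ * c₂ + a₂₂ * a₂₃ * c₂ * μ + a₂₂ * a₃₂ * c₃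
      * ν = 0 := hc 1 2
  have h13 : 2 * a₂₂ * c₂ * c₃ * ν + a₂₃ * c₂ ^ 2 * ν = 0 := hc 1 3
  have h20 : -a₁₃ * a₃₂ ^ 2 = 0 := hc 2 0
  have h21 : -a₁₃ * a₃₂ * c₂ + a₂₂ * a₃₂ * c₃ * μ - a₃₂ ^ 2 * c₃ * ν = 0 := hc 2 1
  have h22 : a₁₂ * c₂ * c₃ + 2 * a₂₂ * c₂ * c₃ * μ + a₂₃ * c₂ ^ 2 * μ - a₃₂ * c₂ * c₃ * ν = 0 := hc
      2 2
  have h23 : c₂ ^ 2 * c₃ * ν = 0 := hc 2 3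
  have h30 : -a₃₂ ^ 2 * c₃ * μ = 0 := hc 3 0
  have h31 : -a₃₂ * c₂ * c₃ * μ = 0 := hc 3 1
  have h32 : c₂ ^ 2 * c₃ * μ = 0 := hc 3 2
  clear h hc
  grind

/-- The coefficients of the relation `p η = 1 + η`. -/
lemma relation_one_add_inv (h2 : (2 : K) = 0)
    (h₂₂ : a₂₂ ≠ 0 ∨ c₂ ≠ 0)
    (h₁₂ : a₁₂ ≠ 0 ∨ c₂ ≠ 0 ∧ (μ ≠ 0 ∨ ν ≠ 0))
    (h₂₃ : a₂₃ ≠ 0 ∨ c₃ ≠ 0)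
    (h₁₃ : a₁₃ ≠ 0 ∨ c₃ ≠ 0 ∧ (μ ≠ 0 ∨ ν ≠ 0))
    (hne : a₂₂ ≠ 0 ∨ a₃₂ ≠ 0)
    (h : ∀ s t : K, (a₂₂ + c₂ * s) * t ^ 2 * (a₁₂ + c₂ * (μ * s + ν * t)) * (a₂₃ + c₃ * s) =
      s * (a₃₂ + c₂ * t) * (s * (a₃₂ + c₂ * t) * (a₁₃ + c₃ * (μ * s + ν * t)) +
        t * (a₁₂ + c₂ * (μ * s + ν * t)) * (a₂₃ + c₃ * s))) :
    False := by
  have hc := coeff_eq_zero_of_forall_eval₂ ![![0, 0, a₁₂ * a₂₂ * a₂₃, a₂₂ * a₂₃ * c₂ * ν],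
      ![0, -a₁₂ * a₂₃ * a₃₂, a₁₂ * a₂₂ * c₃ + a₂₂ * a₂₃ * c₂ * μ - a₂₃ * a₃₂ * c₂ * ν, a₂₂ * c₂ *
        c₃ * ν],
      ![-a₁₃ * a₃₂ ^ 2, -a₁₂ * a₃₂ * c₃ - 2 * a₁₃ * a₃₂ * c₂ - a₂₃ * a₃₂ * c₂ * μ - a₃₂ ^ 2 * c₃ *
        ν, -a₁₃ * c₂ ^ 2 + a₂₂ * c₂ * c₃ * μ - 3 * a₃₂ * c₂ * c₃ * ν, -c₂ ^ 2 * c₃ * ν],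
      ![-a₃₂ ^ 2 * c₃ * μ, -3 * a₃₂ * c₂ * c₃ * μ, -c₂ ^ 2 * c₃ * μ, 0]] (by
      intro s t
      simp only [Fin.sum_univ_four, Matrix.cons_val]
      norm_num
      linear_combination h s t)
  have h02 : a₁₂ * a₂₂ * a₂₃ = 0 := hc 0 2
  have h03 : a₂₂ * a₂₃ * c₂ * ν = 0 := hc 0 3
  have h11 : -a₁₂ * a₂₃ * a₃₂ = 0 := hc 1 1
  have h12 : a₁₂ * a₂₂ * c₃ + a₂₂ * a₂₃ * c₂ * μ - a₂₃ * a₃₂ * c₂ * ν = 0 := hc 1 2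
  have h13 : a₂₂ * c₂ * c₃ * ν = 0 := hc 1 3
  have h20 : -a₁₃ * a₃₂ ^ 2 = 0 := hc 2 0
  have h21 : -a₁₂ * a₃₂ * c₃ - 2 * a₁₃ * a₃₂ * c₂ - a₂₃ * a₃₂ * c₂ * μ - a₃₂ ^ 2 * c₃ * ν = 0 := hc
      2 1
  have h22 : -a₁₃ * c₂ ^ 2 + a₂₂ * c₂ * c₃ * μ - 3 * a₃₂ * c₂ * c₃ * ν = 0 := hc 2 2
  have h23 : -c₂ ^ 2 * c₃ * ν = 0 := hc 2 3
  have h30 : -a₃₂ ^ 2 * c₃ * μ = 0 := hc 3 0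
  have h31 : -3 * a₃₂ * c₂ * c₃ * μ = 0 := hc 3 1
  have h32 : -c₂ ^ 2 * c₃ * μ = 0 := hc 3 2
  clear h hc
  grind

/-- The coefficients of the relation `p (1 + η) = η`. -/
lemma relation_div_one_add (h2 : (2 : K) = 0)
    (h₃₂ : a₃₂ ≠ 0 ∨ c₂ ≠ 0)
    (h₁₂ : a₁₂ ≠ 0 ∨ c₂ ≠ 0 ∧ (μ ≠ 0 ∨ ν ≠ 0))
    (h₂₃ : a₂₃ ≠ 0 ∨ c₃ ≠ 0)
    (h₁₃ : a₁₃ ≠ 0 ∨ c₃ ≠ 0 ∧ (μ ≠ 0 ∨ ν ≠ 0))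
    (hne : a₂₂ ≠ 0 ∨ a₃₂ ≠ 0)
    (h : ∀ s t : K, (a₂₂ + c₂ * s) * (s * (a₃₂ + c₂ * t) * (a₁₃ + c₃ * (μ * s + ν * t)) +
        t * (a₁₂ + c₂ * (μ * s + ν * t)) * (a₂₃ + c₃ * s)) =
      (a₁₂ + c₂ * (μ * s + ν * t)) * (a₂₃ + c₃ * s) * s * (a₃₂ + c₂ * t)) :
    a₂₃ = 0 ∧ a₁₃ = 0 := by
  have hc := coeff_eq_zero_of_forall_eval₂ ![![0, a₁₂ * a₂₂ * a₂₃, a₂₂ * a₂₃ * c₂ * ν, 0],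
      ![-a₁₂ * a₂₃ * a₃₂ + a₁₃ * a₂₂ * a₃₂, a₁₂ * a₂₂ * c₃ + a₁₃ * a₂₂ * c₂ + a₂₂ * a₂₃ * c₂ * μ +
        a₂₂ * a₃₂ * c₃ * ν - a₂₃ * a₃₂ * c₂ * ν, 2 * a₂₂ * c₂ * c₃ * ν, 0],
      ![-a₁₂ * a₃₂ * c₃ + a₁₃ * a₃₂ * c₂ + a₂₂ * a₃₂ * c₃ * μ - a₂₃ * a₃₂ * c₂ * μ, a₁₃ * c₂ ^ 2 +
        2 * a₂₂ * c₂ * c₃ * μ, c₂ ^ 2 * c₃ * ν, 0],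
      ![0, c₂ ^ 2 * c₃ * μ, 0, 0]] (by
      intro s t
      simp only [Fin.sum_univ_four, Matrix.cons_val]
      norm_num
      linear_combination h s t)
  have h01 : a₁₂ * a₂₂ * a₂₃ = 0 := hc 0 1
  have h02 : a₂₂ * a₂₃ * c₂ * ν = 0 := hc 0 2
  have h10 : -a₁₂ * a₂₃ * a₃₂ + a₁₃ * a₂₂ * a₃₂ = 0 := hc 1 0
  have h11 : a₁₂ * a₂₂ * c₃ + a₁₃ * a₂₂ * c₂ + a₂₂ * a₂₃ * c₂ * μ + a₂₂ * a₃₂ * c₃ * ν - a₂₃ * a₃₂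
      * c₂ * ν = 0 := hc 1 1
  have h12 : 2 * a₂₂ * c₂ * c₃ * ν = 0 := hc 1 2
  have h20 : -a₁₂ * a₃₂ * c₃ + a₁₃ * a₃₂ * c₂ + a₂₂ * a₃₂ * c₃ * μ - a₂₃ * a₃₂ * c₂ * μ = 0 := hc 2
      0
  have h21 : a₁₃ * c₂ ^ 2 + 2 * a₂₂ * c₂ * c₃ * μ = 0 := hc 2 1
  have h22 : c₂ ^ 2 * c₃ * ν = 0 := hc 2 2
  have h31 : c₂ ^ 2 * c₃ * μ = 0 := hc 3 1
  clear h hc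
  grind

/-- The coefficients of the relation `p η = 1`. -/
lemma relation_inv (h2 : (2 : K) = 0)
    (h₂₂ : a₂₂ ≠ 0 ∨ c₂ ≠ 0)
    (h₁₂ : a₁₂ ≠ 0 ∨ c₂ ≠ 0 ∧ (μ ≠ 0 ∨ ν ≠ 0))
    (h₂₃ : a₂₃ ≠ 0 ∨ c₃ ≠ 0)
    (h₁₃ : a₁₃ ≠ 0 ∨ c₃ ≠ 0 ∧ (μ ≠ 0 ∨ ν ≠ 0))
    (hne : a₂₂ ≠ 0 ∨ a₃₂ ≠ 0)
    (h : ∀ s t : K, (a₂₂ + c₂ * s) * t ^ 2 * (a₁₂ + c₂ * (μ * s + ν * t)) * (a₂₃ + c₃ * s) =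
      s ^ 2 * (a₃₂ + c₂ * t) ^ 2 * (a₁₃ + c₃ * (μ * s + ν * t))) :
    a₃₂ = 0 ∧ a₁₂ = 0 ∧ a₂₃ = 0 := by
  have hc := coeff_eq_zero_of_forall_eval₂ ![![0, 0, a₁₂ * a₂₂ * a₂₃, a₂₂ * a₂₃ * c₂ * ν],
      ![0, 0, a₁₂ * a₂₂ * c₃ + a₁₂ * a₂₃ * c₂ + a₂₂ * a₂₃ * c₂ * μ, a₂₂ * c₂ * c₃ * ν + a₂₃ * c₂ ^
        2 * ν],
      ![-a₁₃ * a₃₂ ^ 2, -2 * a₁₃ * a₃₂ * c₂ - a₃₂ ^ 2 * c₃ * ν, a₁₂ * c₂ * c₃ - a₁₃ * c₂ ^ 2 + a₂₂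
        * c₂ * c₃ * μ + a₂₃ * c₂ ^ 2 * μ - 2 * a₃₂ * c₂ * c₃ * ν, 0],
      ![-a₃₂ ^ 2 * c₃ * μ, -2 * a₃₂ * c₂ * c₃ * μ, 0, 0]] (by
      intro s t
      simp only [Fin.sum_univ_four, Matrix.cons_val]
      norm_num
      linear_combination h s t)
  have h02 : a₁₂ * a₂₂ * a₂₃ = 0 := hc 0 2
  have h03 : a₂₂ * a₂₃ * c₂ * ν = 0 := hc 0 3
  have h12 : a₁₂ * a₂₂ * c₃ + a₁₂ * a₂₃ * c₂ + a₂₂ * a₂₃ * c₂ * μ = 0 := hc 1 2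
  have h13 : a₂₂ * c₂ * c₃ * ν + a₂₃ * c₂ ^ 2 * ν = 0 := hc 1 3
  have h20 : -a₁₃ * a₃₂ ^ 2 = 0 := hc 2 0
  have h21 : -2 * a₁₃ * a₃₂ * c₂ - a₃₂ ^ 2 * c₃ * ν = 0 := hc 2 1
  have h22 : a₁₂ * c₂ * c₃ - a₁₃ * c₂ ^ 2 + a₂₂ * c₂ * c₃ * μ + a₂₃ * c₂ ^ 2 * μ - 2 * a₃₂ * c₂ *
      c₃ * ν = 0 := hc 2 2
  have h30 : -a₃₂ ^ 2 * c₃ * μ = 0 := hc 3 0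
  have h31 : -2 * a₃₂ * c₂ * c₃ * μ = 0 := hc 3 1
  clear h hc
  grind

end Relations

/-! ### Möbius transformations of the variable of a rational function field -/

section RationalFunctionField

open Polynomial IntermediateField

variable {K : Type*} [Field K]

lemma Polynomial.aeval_ne_zero_of_isCoprime_of_eq_mul {L : Type*} [Field L] [Algebra K L] {f g :
    K[X]}
    (hfg : IsCoprime f g) {p η : L} (h : aeval η f = p * aeval η g) : aeval η g ≠ 0 := by
  intro h0
  rw [h0, mul_zero] at h
  obtain ⟨u, v, huv⟩ := hfg
  have := congrArg (aeval η) huv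
  simp [h, h0] at this

/-- If a Möbius transformation `p` of the variable is the value at `η` of a quotient of coprime
polynomials, then these have degree at most one: the variable generates the whole field of rational
functions, hence so does the quotient. -/
lemma natDegree_le_one_of_moebius {f g : K[X]} (hfg : IsCoprime f g) {p η : RatFunc K}
    {α β γ δ : K} (hdet : α * δ - β * γ ≠ 0)
    (hp : (RatFunc.C γ * RatFunc.X + RatFunc.C δ) * p = RatFunc.C α * RatFunc.X + RatFunc.C β)
    (h : aeval η f = p * aeval η g) : f.natDegree ≤ 1 ∧ g.natDegree ≤ 1 := by
  have hg0 := Polynomial.aeval_ne_zero_of_isCoprime_of_eq_mul hfg h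
  have htop : K⟮p⟯ = ⊤ := by
    rw [eq_top_iff, ← RatFunc.adjoin_X, adjoin_simple_le_iff]
    have hne : RatFunc.C γ * p - RatFunc.C α ≠ 0 := by
      intro h0
      apply hdet
      apply RatFunc.C_injective
      rw [map_sub, map_mul, map_mul, map_zero]
      linear_combination (RatFunc.C γ) * hp - (RatFunc.C γ * RatFunc.X + RatFunc.C δ) * h0
    have hX : (RatFunc.X : RatFunc K) =
        (RatFunc.C β - RatFunc.C δ * p) / (RatFunc.C γ * p - RatFunc.C α) := by
      rw [eq_div_iff hne]
      linear_combination hp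
    have hC : ∀ c : K, RatFunc.C c ∈ K⟮p⟯ := fun c => (K⟮p⟯).algebraMap_mem c
    have hpm : p ∈ K⟮p⟯ := mem_adjoin_simple_self K p
    rw [hX]
    exact div_mem (sub_mem (hC _) (mul_mem (hC _) hpm)) (sub_mem (mul_mem (hC _) hpm) (hC _))
  have hηC : ¬ ∃ c, η = RatFunc.C c := by
    rintro ⟨c, rfl⟩
    have h1 : ∀ q : K[X], aeval (RatFunc.C c) q = RatFunc.C (q.eval c) := fun q =>
      aeval_algebraMap_apply_eq_algebraMap_eval c q
    rw [h1, h1] at h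
    have h2 : p = RatFunc.C (f.eval c / g.eval c) := by
      rw [map_div₀, eq_div_iff, h]
      rwa [h1] at hg0
    obtain ⟨d, rfl⟩ : ∃ d, p = RatFunc.C d := ⟨_, h2⟩
    have h3 := RatFunc.finrank_eq_max_natDegree (RatFunc.C d)
    rw [htop] at h3
    simp at h3
  have htr := RatFunc.transcendental_of_ne_C η hηC
  have hinj : Function.Injective (aeval (R := K) η) := transcendental_iff_injective.1 htr
  have hgne : g ≠ 0 := by
    rintro rfl
    simp at hg0
  set θ : RatFunc K →ₐ[K] RatFunc K := RatFunc.liftAlgHom (aeval η)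
    (nonZeroDivisors_le_comap_nonZeroDivisors_of_injective _ hinj) with hθ
  have hθinj : Function.Injective θ := RatFunc.liftAlgHom_injective _ hinj
  set q : RatFunc K := algebraMap K[X] (RatFunc K) f / algebraMap K[X] (RatFunc K) g with hq
  have hθq : θ q = p := by
    rw [hθ, hq, RatFunc.liftAlgHom_apply_div, h, mul_div_assoc, div_self hg0, mul_one]
  have hqtop : K⟮q⟯ = ⊤ := by
    rw [eq_top_iff]
    intro y _
    have h1 : θ y ∈ (K⟮q⟯).map θ := by
      rw [adjoin_map, Set.image_singleton, hθq, htop]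
      trivial
    obtain ⟨z, hz, hzy⟩ := h1
    exact hθinj hzy ▸ hz
  have hdeg := RatFunc.finrank_eq_max_natDegree q
  rw [hqtop, IntermediateField.finrank_top] at hdeg
  have hnd := (RatFunc.num_mul_eq_mul_denom_iff hgne).2 hq
  constructor
  · by_cases hf : f = 0
    · simp [hf]
    have hnum : q.num ≠ 0 := by
      intro h0
      rw [h0, zero_mul] at hnd
      exact mul_ne_zero hf q.denom_ne_zero hnd.symm
    have hdvd : f ∣ q.num := hfg.dvd_of_dvd_mul_right (hnd ▸ dvd_mul_right _ _)
    exact (natDegree_le_of_dvd hdvd hnum).trans ((le_max_left _ _).trans hdeg.symm.le)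
  · have hdvd : g ∣ q.denom := hfg.symm.dvd_of_dvd_mul_left (hnd ▸ dvd_mul_left _ _)
    exact (natDegree_le_of_dvd hdvd q.denom_ne_zero).trans ((le_max_right _ _).trans hdeg.symm.le)

end RationalFunctionField

section AlgebraicElements

/-- The prime field is algebraically closed in a field of rational functions over it. -/
lemma eq_zero_or_one_of_isAlgebraic {σ K : Type*} [Field K] [Algebra (MvPolynomial σ (ZMod 2)) K]
    [Algebra (ZMod 2) K] [IsScalarTower (ZMod 2) (MvPolynomial σ (ZMod 2)) K]
    [IsFractionRing (MvPolynomial σ (ZMod 2)) K] {x : K} (hx : IsAlgebraic (ZMod 2) x) :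
    x = 0 ∨ x = 1 := by
  have h1 : IsIntegral (MvPolynomial σ (ZMod 2)) x := hx.isIntegral.tower_top
  obtain ⟨y, rfl⟩ := IsIntegrallyClosed.isIntegral_iff.1 h1
  have h2 : IsIntegral (ZMod 2) y := by
    have := hx.isIntegral
    rwa [isIntegral_algebraMap_iff
      (IsFractionRing.injective (MvPolynomial σ (ZMod 2)) K)] at this
  by_cases hy : y = 0
  · left; rw [hy, map_zero]
  right
  obtain ⟨r, hr, hyr⟩ := MvPolynomial.isUnit_iff_eq_C_of_isReduced.1 (h2.isUnit hy)
  have : r = 1 := by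
    have h3 := hr.ne_zero
    revert h3
    clear hyr hr
    revert r
    decide
  rw [hyr, this, map_one, map_one]

end AlgebraicElements

/-! ### Moving the path sums of an edge to two receivers -/

namespace UnicastNetwork

variable {V E : Type*}

section Move

variable {F : Type*} [Field F] [Fintype E] {N : UnicastNetwork V E}
  {R : Type*} [CommRing R] [Algebra (RatFun F N) R] [Algebra F R] [IsScalarTower F (RatFun F N) R]

omit [Fintype E] in
lemma algHom_moveLine {R' : Type*} [CommRing R'] [Algebra (RatFun F N) R'] [Algebra F R']
    [IsScalarTower F (RatFun F N) R'] (ψ : R →ₐ[RatFun F N] R') (e c : ExtEdge E) (s t : R)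
    (P : MvPolynomial N.CodingVar F) :
    ψ (N.moveLine e c s t P) = N.moveLine e c (ψ s) (ψ t) P := by
  have : (ψ.restrictScalars F).comp (N.moveLine e c s t) = N.moveLine e c (ψ s) (ψ t) := by
    apply MvPolynomial.algHom_ext
    intro q
    simp only [moveLine, reroute, AlgHom.comp_apply, MvPolynomial.aeval_X,
      AlgHom.restrictScalars_apply, genericPoint]
    split_ifs <;> simp
  exact DFunLike.congr_fun this P

omit [Fintype E] in
lemma moveLine_one_zero (e c : ExtEdge E) (P : MvPolynomial N.CodingVar F) :
    N.moveLine (R := RatFun F N) e c 1 0 P = algebraMap _ (RatFun F N) P := by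
  have : N.moveLine (R := RatFun F N) e c 1 0 =
      IsScalarTower.toAlgHom F (MvPolynomial N.CodingVar F) (RatFun F N) := by
    apply MvPolynomial.algHom_ext
    rintro ⟨⟨a, b⟩, hab⟩
    have hab' : N.extHead a = N.extTail b := hab
    simp only [moveLine, reroute, MvPolynomial.aeval_X, genericPoint]
    split_ifs with h1 h2 <;> subst_vars <;> simp_all [edgeVar]
  exact DFunLike.congr_fun this P

variable (N) in
/-- The homomorphism that moves the coding coefficients leaving `e` within the plane spanned by
their generic value and the unit vector of the edge `c`, in such a way that the path sums from `e`
to the receivers `i` and `k` become `u` and `v`. -/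
noncomputable def movePlane (e c : ExtEdge E) (i k : Fin 3) (u v : R) :
    MvPolynomial N.CodingVar F →ₐ[F] R :=
  N.moveLine e c
    (algebraMap (RatFun F N) R (N.ratSum F c (tau i) * N.ratSum F e (tau k) -
        N.ratSum F c (tau k) * N.ratSum F e (tau i))⁻¹ *
      (algebraMap (RatFun F N) R (N.ratSum F c (tau i)) * v -
        algebraMap (RatFun F N) R (N.ratSum F c (tau k)) * u))
    (algebraMap (RatFun F N) R (N.ratSum F c (tau i) * N.ratSum F e (tau k) -
        N.ratSum F c (tau k) * N.ratSum F e (tau i))⁻¹ *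
      (algebraMap (RatFun F N) R (N.ratSum F e (tau k)) * u -
        algebraMap (RatFun F N) R (N.ratSum F e (tau i)) * v))

variable {e c : ExtEdge E} {i k : Fin 3}

/-- The coordinates of the path sum to a third receiver after `movePlane`. -/
lemma movePlane_pathSum (hc : N.Adj e c) (u v : R) {l : Fin 3} (hl : tau l ≠ e) (a : ExtEdge E) :
    N.movePlane e c i k u v (N.pathSum F a (tau l)) =
      algebraMap (RatFun F N) R (N.ratSum F a (tau l) - N.ratSum F a e * N.ratSum F e (tau l)) +
      algebraMap (RatFun F N) R (N.ratSum F a e) *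
        (algebraMap (RatFun F N) R ((N.ratSum F c (tau i) * N.ratSum F e (tau k) -
          N.ratSum F c (tau k) * N.ratSum F e (tau i))⁻¹ *
            (N.ratSum F c (tau l) * N.ratSum F e (tau k) -
              N.ratSum F c (tau k) * N.ratSum F e (tau l))) * u +
          algebraMap (RatFun F N) R ((N.ratSum F c (tau i) * N.ratSum F e (tau k) -
          N.ratSum F c (tau k) * N.ratSum F e (tau i))⁻¹ *
            (N.ratSum F c (tau i) * N.ratSum F e (tau l) -
              N.ratSum F c (tau l) * N.ratSum F e (tau i))) * v) := by
  rw [movePlane, N.moveLine_pathSum (.inl hc) hl]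
  simp only [map_mul, map_sub]
  ring

variable (hne : N.ratSum F c (tau i) * N.ratSum F e (tau k) ≠
  N.ratSum F c (tau k) * N.ratSum F e (tau i))

include hne in
lemma movePlane_pathSum_left (hc : N.Adj e c) (u v : R) (hl : tau i ≠ e) (a : ExtEdge E) :
    N.movePlane e c i k u v (N.pathSum F a (tau i)) =
      algebraMap (RatFun F N) R (N.ratSum F a (tau i) - N.ratSum F a e * N.ratSum F e (tau i)) +
      algebraMap (RatFun F N) R (N.ratSum F a e) * u := by
  rw [movePlane_pathSum hc u v hl, inv_mul_cancel₀ (sub_ne_zero.2 hne),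
    show N.ratSum F c (tau i) * N.ratSum F e (tau i) -
      N.ratSum F c (tau i) * N.ratSum F e (tau i) = 0 by ring]
  simp

include hne in
lemma movePlane_pathSum_right (hc : N.Adj e c) (u v : R) (hl : tau k ≠ e) (a : ExtEdge E) :
    N.movePlane e c i k u v (N.pathSum F a (tau k)) =
      algebraMap (RatFun F N) R (N.ratSum F a (tau k) - N.ratSum F a e * N.ratSum F e (tau k)) +
      algebraMap (RatFun F N) R (N.ratSum F a e) * v := by
  rw [movePlane_pathSum hc u v hl, inv_mul_cancel₀ (sub_ne_zero.2 hne),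
    show N.ratSum F c (tau k) * N.ratSum F e (tau k) -
      N.ratSum F c (tau k) * N.ratSum F e (tau k) = 0 by ring]
  simp

include hne in
/-- A motion to indeterminate values is injective, because the generic value is one of its
specializations. -/
lemma movePlane_injective (u v : Polynomial (RatFun F N)) (x : RatFun F N)
    (hu : u.eval x = N.ratSum F e (tau i)) (hv : v.eval x = N.ratSum F e (tau k)) :
    Function.Injective (N.movePlane (F := F) e c i k u v) := by
  rw [injective_iff_map_eq_zero]
  intro P hP
  have h1 := algHom_moveLine (Polynomial.aeval (R := RatFun F N) x) e c
    (algebraMap (RatFun F N) (Polynomial (RatFun F N))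
      (N.ratSum F c (tau i) * N.ratSum F e (tau k) -
        N.ratSum F c (tau k) * N.ratSum F e (tau i))⁻¹ *
      (algebraMap (RatFun F N) (Polynomial (RatFun F N)) (N.ratSum F c (tau i)) * v -
        algebraMap (RatFun F N) (Polynomial (RatFun F N)) (N.ratSum F c (tau k)) * u))
    (algebraMap (RatFun F N) (Polynomial (RatFun F N))
      (N.ratSum F c (tau i) * N.ratSum F e (tau k) -
        N.ratSum F c (tau k) * N.ratSum F e (tau i))⁻¹ *
      (algebraMap (RatFun F N) (Polynomial (RatFun F N)) (N.ratSum F e (tau k)) * u -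
        algebraMap (RatFun F N) (Polynomial (RatFun F N)) (N.ratSum F e (tau i)) * v)) P
  rw [movePlane] at hP
  rw [hP, map_zero] at h1
  have h2 : ∀ a b : RatFun F N, a = 1 → b = 0 →
      N.moveLine (R := RatFun F N) e c a b P = 0 → P = 0 := by
    rintro _ _ rfl rfl h
    rw [moveLine_one_zero] at h
    exact (map_eq_zero_iff _
      (IsFractionRing.injective (MvPolynomial N.CodingVar F) (RatFun F N))).1 h
  refine h2 _ _ ?_ ?_ h1.symm
  · simp only [map_mul, map_sub, Polynomial.coe_aeval_eq_eval, Polynomial.algebraMap_eq,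
      Polynomial.eval_C, hu, hv]
    exact inv_mul_cancel₀ (sub_ne_zero.2 hne)
  · simp only [map_mul, map_sub, Polynomial.coe_aeval_eq_eval, Polynomial.algebraMap_eq,
      Polynomial.eval_C, hu, hv]
    ring

end Move

end UnicastNetwork

/-! ### The degree of a relation between the ratios -/

namespace UnicastNetwork

variable {V E : Type*} [Fintype E] {N : UnicastNetwork V E}

lemma algebraMap_pathSum {F : Type*} [Field F] (a b : ExtEdge E) :
    algebraMap (MvPolynomial N.CodingVar F) (RatFun F N) (N.pathSum F a b) = N.ratSum F a b := rfl

section Degree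

open Polynomial

omit [Fintype E] in
/-- If the image of `p` under an injective substitution of rational functions is a Möbius
transformation of the variable, then coprime polynomials over the prime field whose quotient takes
the value `p` have degree at most one. -/
lemma natDegree_le_one_of_substitution
    {φ : MvPolynomial N.CodingVar (ZMod 2) →ₐ[ZMod 2] (RatFun (ZMod 2) N)[X]}
    (hφ : Function.Injective φ) {f g : (ZMod 2)[X]} (hfg : IsCoprime f g)
    {η : RatFun (ZMod 2) N} {P Q : MvPolynomial N.CodingVar (ZMod 2)} (hQ : Q ≠ 0)
    (h : aeval η f = algebraMap _ (RatFun (ZMod 2) N) P / algebraMap _ _ Q * aeval η g)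
    {α β γ δ : RatFun (ZMod 2) N} (hdet : α * δ - β * γ ≠ 0)
    (hPQ : (C γ * X + C δ) * φ P = (C α * X + C β) * φ Q) :
    f.natDegree ≤ 1 ∧ g.natDegree ≤ 1 := by
  have hinj : Function.Injective ((algebraMap (RatFun (ZMod 2) N)[X] (RatFunc (RatFun (ZMod 2)
      N))).comp φ.toRingHom) :=
    (RatFunc.algebraMap_injective _).comp hφ
  set θ : RatFun (ZMod 2) N →+* RatFunc (RatFun (ZMod 2) N) := IsFractionRing.lift hinj with hθ
  have hθP : ∀ p, θ (algebraMap _ _ p) = algebraMap (RatFun (ZMod 2) N)[X] (RatFunc (RatFun (ZMod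
      2) N)) (φ p) := fun p =>
    IsFractionRing.lift_algebraMap hinj p
  have hmap : ∀ q : (ZMod 2)[X], aeval (θ η) (q.map (algebraMap (ZMod 2) (RatFun (ZMod 2) N))) = θ
      (aeval η q) := by
    intro q
    rw [aeval_def, eval₂_map, aeval_def, hom_eval₂]
    congr 1
    exact Subsingleton.elim _ _
  have hcop : IsCoprime (f.map (algebraMap (ZMod 2) (RatFun (ZMod 2) N))) (g.map (algebraMap (ZMod
      2) (RatFun (ZMod 2) N))) :=
    hfg.map (mapRingHom (algebraMap (ZMod 2) (RatFun (ZMod 2) N)))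
  have h1 := natDegree_le_one_of_moebius hcop (η := θ η)
    (p := θ (algebraMap _ (RatFun (ZMod 2) N) P / algebraMap _ (RatFun (ZMod 2) N) Q)) hdet ?_ ?_
  · rwa [natDegree_map, natDegree_map] at h1
  · have hQ0 : algebraMap (RatFun (ZMod 2) N)[X] (RatFunc (RatFun (ZMod 2) N)) (φ Q) ≠ 0 := by
      rw [Ne, map_eq_zero_iff _ (RatFunc.algebraMap_injective _), map_eq_zero_iff _ hφ]
      exact hQ
    rw [map_div₀, hθP, hθP, ← mul_div_assoc, div_eq_iff hQ0]
    have := congrArg (algebraMap (RatFun (ZMod 2) N)[X] (RatFunc (RatFun (ZMod 2) N))) hPQ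
    simpa only [map_mul, map_add, RatFunc.algebraMap_C, RatFunc.algebraMap_X] using this
  · rw [hmap, hmap, h, map_mul]

/-- Here `e` is the last edge parallel to `s₁`, so that the given ratio, rewritten with `e` in place
of `s₁`, is a Möbius transformation of one of the two path sums of `e`. -/
lemma natDegree_le_one_of_relation {s₁ s₂ e c : ExtEdge E} {j k : Fin 3} (hjk : j ≠ k)
    (hej : N.ratSum (ZMod 2) e (tau j) ≠ 0) (hek : N.ratSum (ZMod 2) e (tau k) ≠ 0)
    (hpar : N.ratSum (ZMod 2) s₁ (tau j) * N.ratSum (ZMod 2) e (tau k) =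
      N.ratSum (ZMod 2) s₁ (tau k) * N.ratSum (ZMod 2) e (tau j))
    (hc : N.Adj e c)
    (hne : N.ratSum (ZMod 2) c (tau j) * N.ratSum (ZMod 2) e (tau k) ≠
      N.ratSum (ZMod 2) c (tau k) * N.ratSum (ZMod 2) e (tau j))
    (h1j : N.ratSum (ZMod 2) s₁ (tau j) ≠ 0)
    (h2j : N.ratSum (ZMod 2) s₂ (tau j) ≠ 0) (h2k : N.ratSum (ZMod 2) s₂ (tau k) ≠ 0)
    (hp : N.ratSum (ZMod 2) s₂ (tau j) * N.ratSum (ZMod 2) s₁ (tau k) ≠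
      N.ratSum (ZMod 2) s₁ (tau j) * N.ratSum (ZMod 2) s₂ (tau k))
    {f g : (ZMod 2)[X]} (hfg : IsCoprime f g) {η : RatFun (ZMod 2) N}
    (h : aeval η f = N.ratSum (ZMod 2) s₂ (tau j) * N.ratSum (ZMod 2) s₁ (tau k) /
      (N.ratSum (ZMod 2) s₁ (tau j) * N.ratSum (ZMod 2) s₂ (tau k)) * aeval η g) :
    f.natDegree ≤ 1 ∧ g.natDegree ≤ 1 := by
  have hn := tau_ne_of_ratSum_ne_zero hjk hej hek
  -- the ratio of the path sums of `s₁` is that of `e`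
  have hfrac : N.ratSum (ZMod 2) s₂ (tau j) * N.ratSum (ZMod 2) s₁ (tau k) /
      (N.ratSum (ZMod 2) s₁ (tau j) * N.ratSum (ZMod 2) s₂ (tau k)) =
      algebraMap _ _ (N.pathSum (ZMod 2) s₂ (tau j) * N.pathSum (ZMod 2) e (tau k)) /
      algebraMap _ _ (N.pathSum (ZMod 2) e (tau j) * N.pathSum (ZMod 2) s₂ (tau k)) := by
    rw [map_mul, map_mul]
    simp only [algebraMap_pathSum]
    rw [div_eq_div_iff (mul_ne_zero h1j h2k) (mul_ne_zero hej h2k)]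
    linear_combination (-N.ratSum (ZMod 2) s₂ (tau j) * N.ratSum (ZMod 2) s₂ (tau k)) * hpar
  have hQ : N.pathSum (ZMod 2) e (tau j) * N.pathSum (ZMod 2) s₂ (tau k) ≠ 0 := by
    intro h0
    have := congrArg (algebraMap _ (RatFun (ZMod 2) N)) h0
    rw [map_mul, map_zero] at this
    exact mul_ne_zero hej h2k this
  rw [hfrac] at h
  by_cases ha : N.ratSum (ZMod 2) s₂ (tau k) -
      N.ratSum (ZMod 2) s₂ e * N.ratSum (ZMod 2) e (tau k) = 0
  · -- all paths from `s₂` to `k` pass through `e`: let the path sum from `e` to `j` vary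
    have ha' : N.ratSum (ZMod 2) s₂ (tau j) -
        N.ratSum (ZMod 2) s₂ e * N.ratSum (ZMod 2) e (tau j) ≠ 0 := by
      intro h0
      apply hp
      linear_combination N.ratSum (ZMod 2) s₁ (tau k) * h0 -
        N.ratSum (ZMod 2) s₁ (tau j) * ha - N.ratSum (ZMod 2) s₂ e * hpar
    have hd : N.ratSum (ZMod 2) s₂ e ≠ 0 := by
      intro h0
      rw [h0, zero_mul, sub_zero] at ha
      exact h2k ha
    refine natDegree_le_one_of_substitution
      (movePlane_injective hne X (C (N.ratSum (ZMod 2) e (tau k))) (N.ratSum (ZMod 2) e (tau j))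
        (by simp) (by simp)) hfg hQ h
      (α := N.ratSum (ZMod 2) s₂ e * N.ratSum (ZMod 2) e (tau k))
      (β := (N.ratSum (ZMod 2) s₂ (tau j) -
        N.ratSum (ZMod 2) s₂ e * N.ratSum (ZMod 2) e (tau j)) * N.ratSum (ZMod 2) e (tau k))
      (γ := N.ratSum (ZMod 2) s₂ e * N.ratSum (ZMod 2) e (tau k)) (δ := 0) ?_ ?_
    · rw [mul_zero, zero_sub, neg_ne_zero]
      exact mul_ne_zero (mul_ne_zero ha' hek) (mul_ne_zero hd hek)
    · simp only [map_mul, movePlane_pathSum_left hne hc _ _ (hn j),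
        movePlane_pathSum_right hne hc _ _ (hn k), ratSum_self, ha, Polynomial.algebraMap_eq,
        map_zero, map_one, one_mul, sub_self, zero_add, add_zero]
      ring
  · -- otherwise let the path sum from `e` to `k` vary
    refine natDegree_le_one_of_substitution
      (movePlane_injective hne (C (N.ratSum (ZMod 2) e (tau j))) X (N.ratSum (ZMod 2) e (tau k))
        (by simp) (by simp)) hfg hQ h
      (α := N.ratSum (ZMod 2) s₂ (tau j)) (β := 0)
      (γ := N.ratSum (ZMod 2) s₂ e * N.ratSum (ZMod 2) e (tau j))
      (δ := (N.ratSum (ZMod 2) s₂ (tau k) -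
        N.ratSum (ZMod 2) s₂ e * N.ratSum (ZMod 2) e (tau k)) * N.ratSum (ZMod 2) e (tau j)) ?_ ?_
    · rw [zero_mul, sub_zero]
      exact mul_ne_zero h2j (mul_ne_zero ha hej)
    · simp only [map_mul, movePlane_pathSum_left hne hc _ _ (hn j),
        movePlane_pathSum_right hne hc _ _ (hn k), ratSum_self, Polynomial.algebraMap_eq,
        map_zero, map_one, one_mul, sub_self, zero_add, add_zero, map_sub]
      ring

/-- A quotient of two polynomials of degree at most one over the prime field, evaluated at an
element other than `0` and `1`. -/
lemma moebius_cases {K : Type*} [Field K] [Algebra (ZMod 2) K] {f g : (ZMod 2)[X]}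
    (hfg : IsCoprime f g) (hf : f.natDegree ≤ 1) (hg : g.natDegree ≤ 1) {p η : K}
    (hp : p ≠ 0) (hη0 : η ≠ 0) (hη1 : η ≠ 1) (h : aeval η f = p * aeval η g) :
    p = 1 ∨ p = η ∨ p = 1 + η ∨ p * η = 1 ∨ p * η = 1 + η ∨ p * (1 + η) = 1 ∨
      p * (1 + η) = η := by
  have h2 : (2 : K) = 0 := by
    have : CharP K 2 := charP_of_injective_algebraMap (algebraMap (ZMod 2) K).injective 2
    exact CharP.cast_eq_zero K 2
  have hg0 := Polynomial.aeval_ne_zero_of_isCoprime_of_eq_mul hfg h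
  have hz : ∀ x : ZMod 2, algebraMap (ZMod 2) K x = 0 ∨ algebraMap (ZMod 2) K x = 1 := by
    intro x
    have : x = 0 ∨ x = 1 := by revert x; decide
    rcases this with rfl | rfl <;> simp
  rw [eq_X_add_C_of_natDegree_le_one hf, eq_X_add_C_of_natDegree_le_one hg] at h
  rw [eq_X_add_C_of_natDegree_le_one hg] at hg0
  simp only [map_add, map_mul, aeval_C, aeval_X] at h hg0
  have h1η : 1 + η ≠ 0 := fun h0 => hη1 (by linear_combination h0 - h2)
  rcases hz (f.coeff 1) with a | a <;> rcases hz (f.coeff 0) with b | b <;>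
    rcases hz (g.coeff 1) with c | c <;> rcases hz (g.coeff 0) with d | d <;>
    rw [a, b, c, d] at h <;> rw [c, d] at hg0 <;> grind

end Degree

end UnicastNetwork

/-! ### The possible relations between the ratios -/

namespace UnicastNetwork

variable {V E : Type*} [Fintype E] {N : UnicastNetwork V E}

section Refutation

variable {s₁ s₂ s₃ e c : ExtEdge E} {i j k : Fin 3}

/-- Of the six Möbius transformations over the prime field, the four that do not fix infinity never
take `η` to the ratio `p`. Both ratios are written with the edge `e`, the last one parallel to the
first sender, in place of that sender. -/
lemma false_of_moebius_relation (hij : i ≠ j) (hik : i ≠ k) (hjk : j ≠ k)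
    (hej : N.ratSum (ZMod 2) e (tau j) ≠ 0) (hek : N.ratSum (ZMod 2) e (tau k) ≠ 0)
    (hc : N.Adj e c)
    (hne : N.ratSum (ZMod 2) c (tau j) * N.ratSum (ZMod 2) e (tau k) ≠
      N.ratSum (ZMod 2) c (tau k) * N.ratSum (ZMod 2) e (tau j))
    (h12 : N.ratSum (ZMod 2) s₂ (tau i) ≠ 0) (h22 : N.ratSum (ZMod 2) s₂ (tau j) ≠ 0)
    (h32 : N.ratSum (ZMod 2) s₂ (tau k) ≠ 0) (h13 : N.ratSum (ZMod 2) s₃ (tau i) ≠ 0)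
    (h23 : N.ratSum (ZMod 2) s₃ (tau j) ≠ 0) {p η : RatFun (ZMod 2) N}
    (hp1 : p ≠ 1)
    (hp : p * (N.ratSum (ZMod 2) e (tau j) * N.ratSum (ZMod 2) s₂ (tau k)) =
      N.ratSum (ZMod 2) s₂ (tau j) * N.ratSum (ZMod 2) e (tau k))
    (hη : η * (N.ratSum (ZMod 2) e (tau j) * N.ratSum (ZMod 2) s₂ (tau k) *
        N.ratSum (ZMod 2) s₃ (tau i)) =
      N.ratSum (ZMod 2) e (tau k) * N.ratSum (ZMod 2) s₂ (tau i) * N.ratSum (ZMod 2) s₃ (tau j))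
    (h : p * η = 1 ∨ p * η = 1 + η ∨ p * (1 + η) = 1 ∨ p * (1 + η) = η) : False := by
  have h2 := charTwo_ratFun (F := ZMod 2) (N := N)
  have hinf := infinite_ratFun (F := ZMod 2) hc
  have hn := tau_ne_of_ratSum_ne_zero hjk hej hek
  set D := (N.ratSum (ZMod 2) c (tau j) * N.ratSum (ZMod 2) e (tau k) -
    N.ratSum (ZMod 2) c (tau k) * N.ratSum (ZMod 2) e (tau j))⁻¹ with hD
  have hD1 : D * (N.ratSum (ZMod 2) c (tau j) * N.ratSum (ZMod 2) e (tau k) -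
    N.ratSum (ZMod 2) c (tau k) * N.ratSum (ZMod 2) e (tau j)) = 1 :=
    inv_mul_cancel₀ (sub_ne_zero.2 hne)
  have hφj := fun (s t : RatFun (ZMod 2) N) a => movePlane_pathSum_left hne hc s t (hn j) a
  have hφk := fun (s t : RatFun (ZMod 2) N) a => movePlane_pathSum_right hne hc s t (hn k) a
  have hφi := fun (s t : RatFun (ZMod 2) N) a =>
    movePlane_pathSum (F := ZMod 2) (N := N) (i := j) (k := k) hc s t (hn i) a
  rw [← hD] at hφi
  set μ := D * (N.ratSum (ZMod 2) c (tau i) * N.ratSum (ZMod 2) e (tau k) -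
    N.ratSum (ZMod 2) c (tau k) * N.ratSum (ZMod 2) e (tau i)) with hμ
  set ν := D * (N.ratSum (ZMod 2) c (tau j) * N.ratSum (ZMod 2) e (tau i) -
    N.ratSum (ZMod 2) c (tau i) * N.ratSum (ZMod 2) e (tau j)) with hν
  have hli : N.ratSum (ZMod 2) e (tau i) =
      μ * N.ratSum (ZMod 2) e (tau j) + ν * N.ratSum (ZMod 2) e (tau k) := by
    rw [hμ, hν]
    linear_combination (-N.ratSum (ZMod 2) e (tau i)) * hD1
  simp only [Algebra.algebraMap_self, RingHom.id_apply] at hφj hφk hφi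
  -- the part of a path sum that avoids `e`, and the part through `e`, do not both vanish
  have hor : ∀ {m d l : RatFun (ZMod 2) N}, m ≠ 0 → m - d * l ≠ 0 ∨ d ≠ 0 := by
    intro m d l hm
    by_contra! h0
    rw [h0.2, zero_mul, sub_zero] at h0
    exact hm h0.1
  have hor' : ∀ {m d : RatFun (ZMod 2) N}, m ≠ 0 →
      m - d * N.ratSum (ZMod 2) e (tau i) ≠ 0 ∨ d ≠ 0 ∧ (μ ≠ 0 ∨ ν ≠ 0) := by
    intro m d hm
    by_contra! h0
    obtain ⟨h0, h1⟩ := h0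
    by_cases hd : d = 0
    · rw [hd, zero_mul, sub_zero] at h0
      exact hm h0
    · obtain ⟨h3, h4⟩ := h1 hd
      rw [hli, h3, h4] at h0
      exact hm (by linear_combination h0)
  have a22 := hor (d := N.ratSum (ZMod 2) s₂ e) (l := N.ratSum (ZMod 2) e (tau j)) h22
  have a32 := hor (d := N.ratSum (ZMod 2) s₂ e) (l := N.ratSum (ZMod 2) e (tau k)) h32
  have a23 := hor (d := N.ratSum (ZMod 2) s₃ e) (l := N.ratSum (ZMod 2) e (tau j)) h23
  have a12 := hor' (d := N.ratSum (ZMod 2) s₂ e) h12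
  have a13 := hor' (d := N.ratSum (ZMod 2) s₃ e) h13
  have hne' : N.ratSum (ZMod 2) s₂ (tau j) - N.ratSum (ZMod 2) s₂ e * N.ratSum (ZMod 2) e (tau j)
      ≠ 0 ∨ N.ratSum (ZMod 2) s₂ (tau k) - N.ratSum (ZMod 2) s₂ e * N.ratSum (ZMod 2) e (tau k)
      ≠ 0 := by
    by_contra! h0
    apply hp1
    apply mul_right_cancel₀ (mul_ne_zero hej h32)
    linear_combination hp + N.ratSum (ZMod 2) e (tau k) * h0.1 -
      N.ratSum (ZMod 2) e (tau j) * h0.2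
  rcases h with h | h | h | h
  · -- `p = 1 / η`
    have hrel : N.ratSum (ZMod 2) s₂ (tau j) * N.ratSum (ZMod 2) e (tau k) ^ 2 *
        N.ratSum (ZMod 2) s₂ (tau i) * N.ratSum (ZMod 2) s₃ (tau j) =
        N.ratSum (ZMod 2) e (tau j) ^ 2 * N.ratSum (ZMod 2) s₂ (tau k) ^ 2 *
        N.ratSum (ZMod 2) s₃ (tau i) := by
      linear_combination (N.ratSum (ZMod 2) e (tau j) * N.ratSum (ZMod 2) s₂ (tau k)) ^ 2 *
        N.ratSum (ZMod 2) s₃ (tau i) * h - η * N.ratSum (ZMod 2) e (tau j) *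
        N.ratSum (ZMod 2) s₂ (tau k) * N.ratSum (ZMod 2) s₃ (tau i) * hp -
        N.ratSum (ZMod 2) s₂ (tau j) * N.ratSum (ZMod 2) e (tau k) * hη
    obtain ⟨b32, b12, b23⟩ := relation_inv h2 a22 a12 a23 a13 hne' (by
      intro s t
      have h3 := eq_of_ratSum_eq (N.movePlane e c j k s t)
        (P := N.pathSum (ZMod 2) s₂ (tau j) * N.pathSum (ZMod 2) e (tau k) ^ 2 *
          N.pathSum (ZMod 2) s₂ (tau i) * N.pathSum (ZMod 2) s₃ (tau j))
        (Q := N.pathSum (ZMod 2) e (tau j) ^ 2 * N.pathSum (ZMod 2) s₂ (tau k) ^ 2 *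
          N.pathSum (ZMod 2) s₃ (tau i)) (by
            simpa only [map_mul, map_pow, algebraMap_pathSum] using hrel)
      simp only [map_mul, map_pow, hφj, hφk, hφi, ratSum_self, one_mul, sub_self, zero_add] at h3
      exact h3)
    have hli0 : N.ratSum (ZMod 2) e (tau i) ≠ 0 := by
      intro h0
      rw [h0, mul_zero, sub_zero] at b12
      exact h12 b12
    have hd2 : N.ratSum (ZMod 2) s₂ e ≠ 0 := by
      intro h0
      rw [h0, zero_mul, sub_zero] at b12
      exact h12 b12
    have hd3 : N.ratSum (ZMod 2) s₃ e ≠ 0 := by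
      intro h0
      rw [h0, zero_mul, sub_zero] at b23
      exact h23 b23
    have hrel' : (N.ratSum (ZMod 2) s₂ (tau j) -
        N.ratSum (ZMod 2) s₂ e * N.ratSum (ZMod 2) e (tau j)) *
        N.ratSum (ZMod 2) s₃ e * N.ratSum (ZMod 2) e (tau i) =
        N.ratSum (ZMod 2) s₂ e * (N.ratSum (ZMod 2) s₃ (tau i) -
          N.ratSum (ZMod 2) s₃ e * N.ratSum (ZMod 2) e (tau i)) *
        N.ratSum (ZMod 2) e (tau j) := by
      rw [sub_eq_zero.1 b32, sub_eq_zero.1 b12, sub_eq_zero.1 b23] at hrel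
      have h0 : N.ratSum (ZMod 2) e (tau k) ^ 2 * N.ratSum (ZMod 2) s₂ e *
        N.ratSum (ZMod 2) e (tau j) ≠ 0 := mul_ne_zero (mul_ne_zero (pow_ne_zero 2 hek) hd2) hej
      apply mul_left_cancel₀ h0
      linear_combination hrel
    refine avoiding_mul_ne hij hli0 hej (sub_eq_zero.1 b12) (sub_eq_zero.1 b23) hd2 ?_ hrel'
    intro h0
    rw [h0, sub_self, mul_zero, zero_mul] at hrel'
    have b22 := hne'.resolve_right (not_not.2 b32)
    exact mul_ne_zero (mul_ne_zero b22 hd3) hli0 hrel'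
  · -- `p = (1 + η) / η`
    have hrel : N.ratSum (ZMod 2) s₂ (tau j) * N.ratSum (ZMod 2) e (tau k) ^ 2 *
        N.ratSum (ZMod 2) s₂ (tau i) * N.ratSum (ZMod 2) s₃ (tau j) =
        N.ratSum (ZMod 2) e (tau j) * N.ratSum (ZMod 2) s₂ (tau k) *
        (N.ratSum (ZMod 2) e (tau j) * N.ratSum (ZMod 2) s₂ (tau k) *
        N.ratSum (ZMod 2) s₃ (tau i) + N.ratSum (ZMod 2) e (tau k) *
        N.ratSum (ZMod 2) s₂ (tau i) * N.ratSum (ZMod 2) s₃ (tau j)) := by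
      linear_combination (N.ratSum (ZMod 2) e (tau j) * N.ratSum (ZMod 2) s₂ (tau k)) ^ 2 *
        N.ratSum (ZMod 2) s₃ (tau i) * h - η * N.ratSum (ZMod 2) e (tau j) *
        N.ratSum (ZMod 2) s₂ (tau k) * N.ratSum (ZMod 2) s₃ (tau i) * hp -
        N.ratSum (ZMod 2) s₂ (tau j) * N.ratSum (ZMod 2) e (tau k) * hη +
        N.ratSum (ZMod 2) e (tau j) * N.ratSum (ZMod 2) s₂ (tau k) * hη
    refine relation_one_add_inv h2 a22 a12 a23 a13 hne' fun s t => ?_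
    have h3 := eq_of_ratSum_eq (N.movePlane e c j k s t)
      (P := N.pathSum (ZMod 2) s₂ (tau j) * N.pathSum (ZMod 2) e (tau k) ^ 2 *
        N.pathSum (ZMod 2) s₂ (tau i) * N.pathSum (ZMod 2) s₃ (tau j))
      (Q := N.pathSum (ZMod 2) e (tau j) * N.pathSum (ZMod 2) s₂ (tau k) *
        (N.pathSum (ZMod 2) e (tau j) * N.pathSum (ZMod 2) s₂ (tau k) *
        N.pathSum (ZMod 2) s₃ (tau i) + N.pathSum (ZMod 2) e (tau k) *
        N.pathSum (ZMod 2) s₂ (tau i) * N.pathSum (ZMod 2) s₃ (tau j))) (by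
          simpa only [map_mul, map_pow, map_add, algebraMap_pathSum] using hrel)
    simp only [map_mul, map_pow, map_add, hφj, hφk, hφi, ratSum_self, one_mul, sub_self,
      zero_add] at h3
    exact h3
  · -- `p = 1 / (1 + η)`
    have hrel : N.ratSum (ZMod 2) s₂ (tau j) * N.ratSum (ZMod 2) e (tau k) *
        (N.ratSum (ZMod 2) e (tau j) * N.ratSum (ZMod 2) s₂ (tau k) *
        N.ratSum (ZMod 2) s₃ (tau i) + N.ratSum (ZMod 2) e (tau k) *
        N.ratSum (ZMod 2) s₂ (tau i) * N.ratSum (ZMod 2) s₃ (tau j)) =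
        N.ratSum (ZMod 2) e (tau j) ^ 2 * N.ratSum (ZMod 2) s₂ (tau k) ^ 2 *
        N.ratSum (ZMod 2) s₃ (tau i) := by
      linear_combination (N.ratSum (ZMod 2) e (tau j) * N.ratSum (ZMod 2) s₂ (tau k)) ^ 2 *
        N.ratSum (ZMod 2) s₃ (tau i) * h - (1 + η) * N.ratSum (ZMod 2) e (tau j) *
        N.ratSum (ZMod 2) s₂ (tau k) * N.ratSum (ZMod 2) s₃ (tau i) * hp -
        N.ratSum (ZMod 2) s₂ (tau j) * N.ratSum (ZMod 2) e (tau k) * hη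
    refine relation_inv_one_add (a₂₃ := N.ratSum (ZMod 2) s₃ (tau j) -
      N.ratSum (ZMod 2) s₃ e * N.ratSum (ZMod 2) e (tau j)) h2 a32 a12 a13 hne' fun s t => ?_
    have h3 := eq_of_ratSum_eq (N.movePlane e c j k s t)
      (P := N.pathSum (ZMod 2) s₂ (tau j) * N.pathSum (ZMod 2) e (tau k) *
        (N.pathSum (ZMod 2) e (tau j) * N.pathSum (ZMod 2) s₂ (tau k) *
        N.pathSum (ZMod 2) s₃ (tau i) + N.pathSum (ZMod 2) e (tau k) *
        N.pathSum (ZMod 2) s₂ (tau i) * N.pathSum (ZMod 2) s₃ (tau j)))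
      (Q := N.pathSum (ZMod 2) e (tau j) ^ 2 * N.pathSum (ZMod 2) s₂ (tau k) ^ 2 *
        N.pathSum (ZMod 2) s₃ (tau i)) (by
          simpa only [map_mul, map_pow, map_add, algebraMap_pathSum] using hrel)
    simp only [map_mul, map_pow, map_add, hφj, hφk, hφi, ratSum_self, one_mul, sub_self,
      zero_add] at h3
    exact h3
  · -- `p = η / (1 + η)`
    have hrel : N.ratSum (ZMod 2) s₂ (tau j) *
        (N.ratSum (ZMod 2) e (tau j) * N.ratSum (ZMod 2) s₂ (tau k) *
        N.ratSum (ZMod 2) s₃ (tau i) + N.ratSum (ZMod 2) e (tau k) *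
        N.ratSum (ZMod 2) s₂ (tau i) * N.ratSum (ZMod 2) s₃ (tau j)) =
        N.ratSum (ZMod 2) s₂ (tau i) * N.ratSum (ZMod 2) s₃ (tau j) *
        N.ratSum (ZMod 2) e (tau j) * N.ratSum (ZMod 2) s₂ (tau k) := by
      apply mul_left_cancel₀ hek
      linear_combination (N.ratSum (ZMod 2) e (tau j) * N.ratSum (ZMod 2) s₂ (tau k)) ^ 2 *
        N.ratSum (ZMod 2) s₃ (tau i) * h - (1 + η) * N.ratSum (ZMod 2) e (tau j) *
        N.ratSum (ZMod 2) s₂ (tau k) * N.ratSum (ZMod 2) s₃ (tau i) * hp -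
        N.ratSum (ZMod 2) s₂ (tau j) * N.ratSum (ZMod 2) e (tau k) * hη +
        N.ratSum (ZMod 2) e (tau j) * N.ratSum (ZMod 2) s₂ (tau k) * hη
    obtain ⟨b23, b13⟩ := relation_div_one_add h2 a32 a12 a23 a13 hne' (by
      intro s t
      have h3 := eq_of_ratSum_eq (N.movePlane e c j k s t)
        (P := N.pathSum (ZMod 2) s₂ (tau j) *
          (N.pathSum (ZMod 2) e (tau j) * N.pathSum (ZMod 2) s₂ (tau k) *
          N.pathSum (ZMod 2) s₃ (tau i) + N.pathSum (ZMod 2) e (tau k) *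
          N.pathSum (ZMod 2) s₂ (tau i) * N.pathSum (ZMod 2) s₃ (tau j)))
        (Q := N.pathSum (ZMod 2) s₂ (tau i) * N.pathSum (ZMod 2) s₃ (tau j) *
          N.pathSum (ZMod 2) e (tau j) * N.pathSum (ZMod 2) s₂ (tau k)) (by
            simpa only [map_mul, map_pow, map_add, algebraMap_pathSum] using hrel)
      simp only [map_mul, map_add, hφj, hφk, hφi, ratSum_self, one_mul, sub_self,
        zero_add] at h3
      exact h3)
    have hli0 : N.ratSum (ZMod 2) e (tau i) ≠ 0 := by
      intro h0
      rw [h0, mul_zero, sub_zero] at b13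
      exact h13 b13
    have hd3 : N.ratSum (ZMod 2) s₃ e ≠ 0 := by
      intro h0
      rw [h0, zero_mul, sub_zero] at b23
      exact h23 b23
    refine sum_ratSum_mul_ne_zero hij hik hjk h12 h22 h32 e hli0 hej hek ?_
    rw [sub_eq_zero.1 b23, sub_eq_zero.1 b13] at hrel
    apply mul_left_cancel₀ (mul_ne_zero hd3 hej)
    linear_combination hrel + N.ratSum (ZMod 2) s₃ e * N.ratSum (ZMod 2) e (tau j) ^ 2 *
      N.ratSum (ZMod 2) s₂ (tau i) * N.ratSum (ZMod 2) s₂ (tau k) * h2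

end Refutation

open Polynomial in
/-- If `f(η) = p g(η)` for polynomials `f`, `g` over the prime field that are not both zero, where
`p` is a cross ratio of the path sums of the senders `s₁`, `s₂` to the receivers `j`, `k`, and `η`
    is
the cyclic ratio of all three senders, then `p` is `1`, `η` or `1 + η`. -/
theorem ratio_cases {s₁ s₂ s₃ : ExtEdge E} {i j k : Fin 3} (hij : i ≠ j) (hik : i ≠ k) (hjk : j ≠ k)
    (h21 : N.ratSum (ZMod 2) s₁ (tau j) ≠ 0) (h31 : N.ratSum (ZMod 2) s₁ (tau k) ≠ 0)
    (h12 : N.ratSum (ZMod 2) s₂ (tau i) ≠ 0) (h22 : N.ratSum (ZMod 2) s₂ (tau j) ≠ 0)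
    (h32 : N.ratSum (ZMod 2) s₂ (tau k) ≠ 0) (h13 : N.ratSum (ZMod 2) s₃ (tau i) ≠ 0)
    (h23 : N.ratSum (ZMod 2) s₃ (tau j) ≠ 0) {p η : RatFun (ZMod 2) N}
    (hp : p = N.ratSum (ZMod 2) s₂ (tau j) * N.ratSum (ZMod 2) s₁ (tau k) /
      (N.ratSum (ZMod 2) s₁ (tau j) * N.ratSum (ZMod 2) s₂ (tau k)))
    (hη : η = N.ratSum (ZMod 2) s₁ (tau k) * N.ratSum (ZMod 2) s₂ (tau i) *
        N.ratSum (ZMod 2) s₃ (tau j) / (N.ratSum (ZMod 2) s₁ (tau j) *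
        N.ratSum (ZMod 2) s₂ (tau k) * N.ratSum (ZMod 2) s₃ (tau i)))
    (hη1 : η ≠ 1) {f g : (ZMod 2)[X]} (hfg : f ≠ 0 ∨ g ≠ 0) (h : aeval η f = p * aeval η g) :
    p = 1 ∨ p = η ∨ p = 1 + η := by
  have hη0 : η ≠ 0 := by
    rw [hη]
    exact div_ne_zero (mul_ne_zero (mul_ne_zero h31 h12) h23)
      (mul_ne_zero (mul_ne_zero h21 h32) h13)
  have hp0 : p ≠ 0 := by
    rw [hp]
    exact div_ne_zero (mul_ne_zero h22 h31) (mul_ne_zero h21 h32)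
  by_cases hp1 : p = 1
  · exact .inl hp1
  -- divide by the greatest common divisor, which does not vanish at the transcendental `η`
  obtain ⟨f', g', hcop, hf', hg'⟩ : ∃ f' g', IsCoprime f' g' ∧
      f = EuclideanDomain.gcd f g * f' ∧ g = EuclideanDomain.gcd f g * g' := by
    obtain ⟨f', hf'⟩ := EuclideanDomain.gcd_dvd_left f g
    obtain ⟨g', hg'⟩ := EuclideanDomain.gcd_dvd_right f g
    refine ⟨f', g', ?_, hf', hg'⟩
    have hd : EuclideanDomain.gcd f g ≠ 0 := by
      rw [Ne, EuclideanDomain.gcd_eq_zero_iff]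
      tauto
    refine ⟨EuclideanDomain.gcdA f g, EuclideanDomain.gcdB f g, mul_left_cancel₀ hd ?_⟩
    have := EuclideanDomain.gcd_eq_gcd_ab f g
    linear_combination -this - EuclideanDomain.gcdA f g * hf' - EuclideanDomain.gcdB f g * hg'
  have hd0 : aeval η (EuclideanDomain.gcd f g) ≠ 0 := by
    intro h0
    have hd : EuclideanDomain.gcd f g ≠ 0 := by
      rw [Ne, EuclideanDomain.gcd_eq_zero_iff]
      tauto
    rcases eq_zero_or_one_of_isAlgebraic (σ := N.CodingVar) ⟨_, hd, h0⟩ with h1 | h1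
    · exact hη0 h1
    · exact hη1 h1
  have h' : aeval η f' = p * aeval η g' := by
    have e1 := congrArg (aeval η) hf'
    have e2 := congrArg (aeval η) hg'
    rw [map_mul] at e1 e2
    apply mul_left_cancel₀ hd0
    linear_combination h - e1 + p * e2
  obtain ⟨e, c, hej, hek, hpar, hc, hne⟩ := exists_last_parallel hjk h21 h31
  have hdeg := natDegree_le_one_of_relation (s₂ := s₂) hjk hej hek hpar hc hne h21 h22 h32
    (fun h0 => hp1 (by rw [hp, h0, div_self (mul_ne_zero h21 h32)])) hcop (hp ▸ h')
  have hpe : p * (N.ratSum (ZMod 2) e (tau j) * N.ratSum (ZMod 2) s₂ (tau k)) =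
      N.ratSum (ZMod 2) s₂ (tau j) * N.ratSum (ZMod 2) e (tau k) := by
    rw [hp, div_mul_eq_mul_div, div_eq_iff (mul_ne_zero h21 h32)]
    linear_combination (-N.ratSum (ZMod 2) s₂ (tau j) * N.ratSum (ZMod 2) s₂ (tau k)) * hpar
  have hηe : η * (N.ratSum (ZMod 2) e (tau j) * N.ratSum (ZMod 2) s₂ (tau k) *
        N.ratSum (ZMod 2) s₃ (tau i)) =
      N.ratSum (ZMod 2) e (tau k) * N.ratSum (ZMod 2) s₂ (tau i) *
        N.ratSum (ZMod 2) s₃ (tau j) := by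
    rw [hη, div_mul_eq_mul_div, div_eq_iff (mul_ne_zero (mul_ne_zero h21 h32) h13)]
    linear_combination (-N.ratSum (ZMod 2) s₂ (tau i) * N.ratSum (ZMod 2) s₃ (tau j) *
      N.ratSum (ZMod 2) s₂ (tau k) * N.ratSum (ZMod 2) s₃ (tau i)) * hpar
  rcases moebius_cases hcop hdeg.1 hdeg.2 hp0 hη0 hη1 h' with h1 | h1 | h1 | h1
  · exact .inl h1
  · exact .inr (.inl h1)
  · exact .inr (.inr h1)
  · exact (false_of_moebius_relation hij hik hjk hej hek hc hne h12 h22 h32 h13 h23 hp1 hpe hηe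
      h1).elim

end UnicastNetwork

/-! ### The non-identities as polynomial conditions over the prime field -/

namespace UnicastNetwork

variable {V E : Type*}

section BaseChange

variable {F K : Type*} [CommSemiring F] [CommSemiring K] (φ : F →+* K) (N : UnicastNetwork V E)

lemma map_pathTerm (P : List (ExtEdge E)) :
    MvPolynomial.map φ (N.pathTerm F P) = N.pathTerm K P := by
  induction P with
  | nil => simp [pathTerm]
  | cons a P ih =>
    cases P with
    | nil => simp [pathTerm]
    | cons b P =>
      rw [pathTerm, pathTerm, map_mul, ih]
      split_ifs <;> simp

/-- The transfer functions have integer coefficients. -/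
lemma map_transfer [Fintype E] (i j : Fin 3) :
    MvPolynomial.map φ (N.transfer F i j) = N.transfer K i j := by
  simp only [transfer, map_sum, map_pathTerm]

end BaseChange

/-- The non-identities that concern the receiver `b`, without denominators; `a`, `b`, `c` are the
three sessions in cyclic order. -/
def CyclicNonIdentities (F : Type*) [CommRing F] [Fintype E] (N : UnicastNetwork V E)
    (a b c : Fin 3) : Prop :=
  N.transfer F b b * N.transfer F c a ≠ N.transfer F b a * N.transfer F c b ∧
  N.transfer F b b * N.transfer F a c ≠ N.transfer F a b * N.transfer F b c ∧
  N.transfer F b b * (N.transfer F c a * N.transfer F a c) ≠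
    N.transfer F b a * N.transfer F c b * N.transfer F a c +
      N.transfer F a b * N.transfer F b c * N.transfer F c a

section Conditions

variable {F K : Type*} [Field F] [Field K] [Fintype E] (N : UnicastNetwork V E)

/-- The non-identities may be decided over the prime field. -/
lemma cyclicNonIdentities_iff (φ : F →+* K) (a b c : Fin 3) :
    N.CyclicNonIdentities K a b c ↔ N.CyclicNonIdentities F a b c := by
  have h := MvPolynomial.map_injective (σ := N.CodingVar) φ φ.injective
  simp only [CyclicNonIdentities, ← map_transfer φ, ← map_mul, ← map_add, h.ne_iff]

lemma m_ne_zero {i j : Fin 3} (h : N.transfer F i j ≠ 0) : N.m F i j ≠ 0 := by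
  rw [m, Ne, map_eq_zero_iff _ (IsFractionRing.injective _ _)]
  exact h

lemma ratSum_sigma_tau (i j : Fin 3) : N.ratSum F (sigma j) (tau i) = N.m F i j := by
  rw [ratSum, ← transfer_eq_pathSum, m]

lemma cyclicNonIdentities_iff_m (a b c : Fin 3) :
    N.CyclicNonIdentities F a b c ↔
      N.m F b b * N.m F c a ≠ N.m F b a * N.m F c b ∧
      N.m F b b * N.m F a c ≠ N.m F a b * N.m F b c ∧
      N.m F b b * (N.m F c a * N.m F a c) ≠
        N.m F b a * N.m F c b * N.m F a c + N.m F a b * N.m F b c * N.m F c a := by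
  have h := IsFractionRing.injective (MvPolynomial N.CodingVar F) (RatFun F N)
  simp only [CyclicNonIdentities, m, ← map_mul, ← map_add, h.ne_iff]

variable (hm : ∀ i j : Fin 3, N.transfer F i j ≠ 0)

include hm in
lemma transferNonIdentities_iff :
    N.TransferNonIdentities F ↔ N.CyclicNonIdentities F 2 0 1 ∧
      N.CyclicNonIdentities F 0 1 2 ∧ N.CyclicNonIdentities F 1 2 0 := by
  have h0 := fun i j => N.m_ne_zero (hm i j)
  have key : ∀ {x y z w v : RatFun F N}, y ≠ 0 → w ≠ 0 →
      ((∀ a b : RatFun F N, (a = 0 ∨ a = 1) → (b = 0 ∨ b = 1) → ¬ (a = 0 ∧ b = 0) →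
        x ≠ a * (z / y) + b * (v / w)) ↔
      (x * y ≠ z ∧ x * w ≠ v ∧ x * (y * w) ≠ z * w + v * y)) := by
    intro x y z w v hy hw
    have e1 : x = 1 * (z / y) + 0 * (v / w) ↔ x * y = z := by
      rw [one_mul, zero_mul, add_zero, eq_div_iff hy]
    have e2 : x = 0 * (z / y) + 1 * (v / w) ↔ x * w = v := by
      rw [one_mul, zero_mul, zero_add, eq_div_iff hw]
    have e3 : x = 1 * (z / y) + 1 * (v / w) ↔ x * (y * w) = z * w + v * y := by
      rw [one_mul, one_mul, div_add_div _ _ hy hw, eq_div_iff (mul_ne_zero hy hw), mul_comm y v]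
    constructor
    · intro h
      exact ⟨fun h' => h 1 0 (.inr rfl) (.inl rfl) (by simp) (e1.2 h'),
        fun h' => h 0 1 (.inl rfl) (.inr rfl) (by simp) (e2.2 h'),
        fun h' => h 1 1 (.inr rfl) (.inr rfl) (by simp) (e3.2 h')⟩
    · rintro ⟨h1, h2, h3⟩ a b (rfl | rfl) (rfl | rfl) hab
      · simp at hab
      · rwa [Ne, e2]
      · rwa [Ne, e1]
      · rwa [Ne, e3]
  have hA := key (x := N.m F 0 0) (z := N.m F 1 0 * N.m F 0 2) (v := N.m F 2 0 * N.m F 0 1)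
    (h0 1 2) (h0 2 1)
  have hB := key (x := N.m F 1 1) (z := N.m F 2 1 * N.m F 1 0) (v := N.m F 0 1 * N.m F 1 2)
    (h0 2 0) (h0 0 2)
  have hC := key (x := N.m F 2 2) (z := N.m F 0 2 * N.m F 2 1) (v := N.m F 1 2 * N.m F 2 0)
    (h0 0 1) (h0 1 0)
  simp only [cyclicNonIdentities_iff_m]
  rw [mul_comm (N.m F 0 2) (N.m F 1 0), mul_comm (N.m F 1 0) (N.m F 2 1),
    mul_comm (N.m F 2 1) (N.m F 0 2), ← hA, ← hB, ← hC]
  unfold TransferNonIdentities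
  constructor
  · exact fun h => ⟨fun a b ha hb hab => (h a b ha hb hab).1,
      fun a b ha hb hab => (h a b ha hb hab).2.1, fun a b ha hb hab => (h a b ha hb hab).2.2⟩
  · exact fun h a b ha hb hab => ⟨h.1 a b ha hb hab, h.2.1 a b ha hb hab, h.2.2 a b ha hb hab⟩

include hm in
lemma ratioNonIdentities_iff [CharP F 2] (hη : N.eta F ≠ 1) :
    N.RatioNonIdentities F ↔ N.CyclicNonIdentities F 2 0 1 ∧
      N.CyclicNonIdentities F 0 1 2 ∧ N.CyclicNonIdentities F 1 2 0 := by
  have h0 := fun i j => N.m_ne_zero (hm i j)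
  have h2 : (2 : RatFun F N) = 0 := charTwo_ratFun (F := F) (N := N)
  have hη' : 1 + N.eta F ≠ 0 := fun h => hη (by linear_combination h - h2)
  have h00 := h0 0 0
  have h01 := h0 0 1
  have h02 := h0 0 2
  have h10 := h0 1 0
  have h12 := h0 1 2
  have h20 := h0 2 0
  have h21 := h0 2 1
  have hβ : N.m F 1 0 * N.m F 2 1 * N.m F 0 2 ≠ 0 := mul_ne_zero (mul_ne_zero h10 h21) h02
  have hsum : 1 + N.eta F = (N.m F 1 0 * N.m F 2 1 * N.m F 0 2 +
      N.m F 2 0 * N.m F 0 1 * N.m F 1 2) / (N.m F 1 0 * N.m F 2 1 * N.m F 0 2) := by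
    rw [eta, add_div, div_self hβ]
  have hsum' : N.m F 1 0 * N.m F 2 1 * N.m F 0 2 + N.m F 2 0 * N.m F 0 1 * N.m F 1 2 ≠ 0 := by
    intro h
    rw [hsum, h, zero_div] at hη'
    exact hη' rfl
  have cancel : ∀ {x y z w c : RatFun F N}, c ≠ 0 → x - y = c * (z - w) → (x = y ↔ z = w) := by
    intro x y z w c hc h
    rw [← sub_eq_zero, h, mul_eq_zero, or_iff_right hc, sub_eq_zero]
  have a1 : N.p₁ F = 1 ↔ N.m F 0 0 * N.m F 2 1 = N.m F 2 0 * N.m F 0 1 := by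
    rw [p₁, div_eq_one_iff_eq (mul_ne_zero (h0 0 0) h21), eq_comm]
  have a2 : N.p₁ F = N.eta F ↔ N.m F 0 0 * N.m F 1 2 = N.m F 0 2 * N.m F 1 0 := by
    rw [p₁, eta, div_eq_div_iff (mul_ne_zero (h0 0 0) h21) hβ]
    exact cancel (c := -(N.m F 2 0 * N.m F 0 1 * N.m F 2 1))
      (neg_ne_zero.2 (mul_ne_zero (mul_ne_zero h20 h01) h21)) (by ring)
  have a3 : N.p₁ F = N.eta F / (1 + N.eta F) ↔
      N.m F 0 0 * (N.m F 1 2 * N.m F 2 1) =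
        N.m F 0 2 * N.m F 1 0 * N.m F 2 1 + N.m F 2 0 * N.m F 0 1 * N.m F 1 2 := by
    rw [p₁, hsum, eta, div_div_div_cancel_right₀ hβ,
      div_eq_div_iff (mul_ne_zero (h0 0 0) h21) hsum']
    exact cancel (c := -(N.m F 2 0 * N.m F 0 1)) (neg_ne_zero.2 (mul_ne_zero h20 h01)) (by ring)
  have b1 : N.p₂ F = 1 ↔ N.m F 1 1 * N.m F 2 0 = N.m F 1 0 * N.m F 2 1 := by
    rw [p₂, div_eq_one_iff_eq (mul_ne_zero h10 h21), mul_comm (N.m F 2 0)]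
  have b2 : N.p₂ F = N.eta F ↔ N.m F 1 1 * N.m F 0 2 = N.m F 0 1 * N.m F 1 2 := by
    rw [p₂, eta, div_eq_div_iff (mul_ne_zero h10 h21) hβ]
    exact cancel (c := N.m F 2 0 * N.m F 1 0 * N.m F 2 1)
      (mul_ne_zero (mul_ne_zero h20 h10) h21) (by ring)
  have b3 : N.p₂ F = 1 + N.eta F ↔ N.m F 1 1 * (N.m F 2 0 * N.m F 0 2) =
      N.m F 1 0 * N.m F 2 1 * N.m F 0 2 + N.m F 0 1 * N.m F 1 2 * N.m F 2 0 := by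
    rw [p₂, hsum, div_eq_div_iff (mul_ne_zero h10 h21) hβ]
    exact cancel (c := N.m F 1 0 * N.m F 2 1) (mul_ne_zero h10 h21) (by ring)
  have c1 : N.p₃ F = 1 ↔ N.m F 2 2 * N.m F 0 1 = N.m F 2 1 * N.m F 0 2 := by
    rw [p₃, div_eq_one_iff_eq (mul_ne_zero h21 h02), mul_comm (N.m F 0 1)]
  have c2 : N.p₃ F = N.eta F ↔ N.m F 2 2 * N.m F 1 0 = N.m F 1 2 * N.m F 2 0 := by
    rw [p₃, eta, div_eq_div_iff (mul_ne_zero h21 h02) hβ]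
    exact cancel (c := N.m F 0 1 * N.m F 2 1 * N.m F 0 2)
      (mul_ne_zero (mul_ne_zero h01 h21) h02) (by ring)
  have c3 : N.p₃ F = 1 + N.eta F ↔ N.m F 2 2 * (N.m F 0 1 * N.m F 1 0) =
      N.m F 2 1 * N.m F 0 2 * N.m F 1 0 + N.m F 1 2 * N.m F 2 0 * N.m F 0 1 := by
    rw [p₃, hsum, div_eq_div_iff (mul_ne_zero h21 h02) hβ]
    exact cancel (c := N.m F 2 1 * N.m F 0 2) (mul_ne_zero h21 h02) (by ring)
  simp only [RatioNonIdentities, Set.mem_insert_iff, Set.mem_singleton_iff, not_or, a1, a2, a3,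
    b1, b2, b3, c1, c2, c3, cyclicNonIdentities_iff_m, Ne]
  constructor
  · rintro ⟨⟨h3, h4, h5⟩, ⟨h6, h7, h8⟩, h9, h10, h11⟩
    exact ⟨⟨h4, h3, h5⟩, ⟨h6, h7, h8⟩, h9, h10, h11⟩
  · rintro ⟨⟨h4, h3, h5⟩, ⟨h6, h7, h8⟩, h9, h10, h11⟩
    exact ⟨⟨h3, h4, h5⟩, ⟨h6, h7, h8⟩, h9, h10, h11⟩

end Conditions

end UnicastNetwork

/-! ### Generic values of linearly independent polynomials -/

section IndependentCopies

open MvPolynomial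

variable {K σ : Type*} [Field K] {L : ℕ}

/-- Linearly independent polynomials have a non-singular square matrix of coefficients. -/
lemma exists_det_coeff_ne_zero {h : Fin L → MvPolynomial σ K} (hh : LinearIndependent K h) :
    ∃ μ : Fin L → σ →₀ ℕ, (Matrix.of fun k j => coeff (μ k) (h j)).det ≠ 0 := by
  set w : (σ →₀ ℕ) → Fin L → K := fun μ j => coeff μ (h j) with hw
  have hspan : Submodule.span K (Set.range w) = ⊤ := by
    by_contra hlt
    obtain ⟨f, hf0, hf⟩ := Submodule.exists_le_ker_of_lt_top _ (lt_top_iff_ne_top.2 hlt)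
    apply hf0
    have hsum : ∑ j, f (fun l => if j = l then 1 else 0) • h j = 0 := by
      ext μ
      have h1 : f (w μ) = 0 := hf (Submodule.subset_span ⟨μ, rfl⟩)
      rw [LinearMap.pi_apply_eq_sum_univ] at h1
      simp only [coeff_sum, coeff_smul, coeff_zero, smul_eq_mul]
      refine Eq.trans ?_ h1
      exact Finset.sum_congr rfl fun j _ => mul_comm _ _
    have h2 := Fintype.linearIndependent_iff.1 hh _ hsum
    refine LinearMap.ext fun v => ?_
    rw [LinearMap.pi_apply_eq_sum_univ]
    simp [h2]
  obtain ⟨f, hf, -, hli⟩ := Submodule.exists_fun_fin_finrank_span_eq K (Set.range w)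
  have hL : L = Module.finrank K (Submodule.span K (Set.range w)) := by
    rw [hspan, finrank_top, Module.finrank_fin_fun]
  choose μ hμ using hf
  refine ⟨fun k => μ (Fin.cast hL k), ?_⟩
  have h1 : LinearIndependent K
      (Matrix.of fun (k : Fin L) j => coeff (μ (Fin.cast hL k)) (h j)).row := by
    have h2 := hli.comp (Fin.cast hL) (Fin.cast_injective hL)
    have h3 : (Matrix.of fun (k : Fin L) j => coeff (μ (Fin.cast hL k)) (h j)).row =
        f ∘ Fin.cast hL := funext fun k => hμ (Fin.cast hL k)
    rwa [h3]
  exact ((Matrix.isUnit_iff_isUnit_det _).1 (Matrix.linearIndependent_rows_iff_isUnit.1 h1)).ne_zero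

/-- The coefficient of a monomial in a product of polynomials in disjoint sets of variables. -/
lemma coeff_prod_rename (μ : Fin L → σ →₀ ℕ) (g : Fin L → MvPolynomial σ K) :
    coeff (∑ k, (μ k).mapDomain (Prod.mk k)) (∏ k, rename (Prod.mk k) (g k)) =
      ∏ k, coeff (μ k) (g k) := by
  classical
  let f₁ : MultilinearMap K (fun _ : Fin L => MvPolynomial σ K) K :=
    (lcoeff K (∑ k, (μ k).mapDomain (Prod.mk k))).compMultilinearMap
      ((MultilinearMap.mkPiAlgebra K (Fin L) (MvPolynomial (Fin L × σ) K)).compLinearMap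
        fun k => (rename (Prod.mk k)).toLinearMap)
  let f₂ : MultilinearMap K (fun _ : Fin L => MvPolynomial σ K) K :=
    (MultilinearMap.mkPiAlgebra K (Fin L) K).compLinearMap fun k => lcoeff K (μ k)
  suffices h : f₁ = f₂ from congrArg (fun f => f g) h
  refine Module.Basis.ext_multilinear (fun _ => basisMonomials σ K) fun ν => ?_
  have h1 : ∀ (ρ : Fin L → σ →₀ ℕ) k q,
      (∑ k, (ρ k).mapDomain (Prod.mk k)) (k, q) = ρ k q := by
    intro ρ k q
    rw [Finsupp.finsetSum_apply, Finset.sum_eq_single k]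
    · exact Finsupp.mapDomain_apply (Prod.mk_right_injective k) _ _
    · intro l _ hl
      refine Finsupp.mapDomain_of_notMem_range _ _ ?_
      rintro ⟨q', hq'⟩
      exact hl (congrArg Prod.fst hq')
    · simp
  have h2 : (∑ k, (ν k).mapDomain (Prod.mk k) = ∑ k, (μ k).mapDomain (Prod.mk k)) ↔ ν = μ := by
    refine ⟨fun h => ?_, fun h => h ▸ rfl⟩
    funext k
    ext q
    rw [← h1 ν, h, h1]
  have h3 : ∏ k, rename (Prod.mk k) (monomial (ν k) (1 : K)) =
      monomial (∑ k, (ν k).mapDomain (Prod.mk k)) 1 := by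
    simp only [rename_monomial]
    rw [monomial_sum_one]
  simp only [f₁, f₂, LinearMap.compMultilinearMap_apply, MultilinearMap.compLinearMap_apply,
    MultilinearMap.mkPiAlgebra_apply, AlgHom.toLinearMap_apply, coe_basisMonomials, h3,
    lcoeff_apply, coeff_monomial, Finset.prod_ite_zero, h2, funext_iff]
  simp

/-- If linearly independent polynomials are evaluated at several independent generic points, the
matrix of their values is non-singular. -/
lemma det_rename_ne_zero {h : Fin L → MvPolynomial σ K} (hh : LinearIndependent K h) :
    (Matrix.of fun k j => rename (Prod.mk k) (h j) :
      Matrix (Fin L) (Fin L) (MvPolynomial (Fin L × σ) K)).det ≠ 0 := by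
  obtain ⟨μ, hμ⟩ := exists_det_coeff_ne_zero hh
  intro h0
  apply hμ
  rw [← Matrix.det_transpose, Matrix.det_apply] at h0 ⊢
  have h1 := congrArg (lcoeff K (∑ k, (μ k).mapDomain (Prod.mk k))) h0
  simp only [map_sum, Units.smul_def, map_zsmul, Matrix.transpose_apply, Matrix.of_apply,
    lcoeff_apply, coeff_prod_rename, map_zero] at h1
  simpa only [Units.smul_def, Matrix.transpose_apply, Matrix.of_apply] using h1

/-- A non-zero polynomial over the prime field does not vanish identically on any sufficiently large
finite field. -/
lemma exists_aeval_ne_zero [Finite σ] {P : MvPolynomial σ (ZMod 2)} (hP : P ≠ 0) :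
    ∃ k₀ : ℕ, ∀ k, k₀ ≤ k → ∃ x : σ → GaloisField 2 k, aeval x P ≠ 0 := by
  classical
  refine ⟨P.totalDegree + 1, fun k hk => ?_⟩
  by_contra! h
  have hinj := (algebraMap (ZMod 2) (GaloisField 2 k)).injective
  have : Fintype (GaloisField 2 k) := Fintype.ofFinite _
  have h0 : map (algebraMap (ZMod 2) (GaloisField 2 k)) P = 0 := by
    refine eq_zero_of_eval_zero_at_prod_finset _ (fun _ => Finset.univ) (fun i => ?_) fun x _ => ?_
    · rw [Finset.card_univ, ← Nat.card_eq_fintype_card, GaloisField.card 2 k (by omega),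
        degreeOf_def, degrees_map_of_injective _ hinj, ← degreeOf_def]
      exact ((degreeOf_le_totalDegree P i).trans_lt hk).trans Nat.lt_two_pow_self
    · rw [eval_map, ← aeval_def]
      exact h x
  exact hP ((map_eq_zero_iff _ (map_injective _ hinj)).1 h0)

end IndependentCopies

/-! ### Precoding matrices and the independence of the received columns -/

namespace UnicastNetwork

variable {V E : Type*} [Fintype E]

section Precoders

variable (F : Type*) [CommSemiring F] (N : UnicastNetwork V E) (n : ℕ)

/-- The numerator `m₃₁ m₁₂ m₂₃` of `η`. -/
noncomputable def etaNum : MvPolynomial N.CodingVar F :=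
  N.transfer F 2 0 * N.transfer F 0 1 * N.transfer F 1 2

/-- The denominator `m₂₁ m₃₂ m₁₃` of `η`. -/
noncomputable def etaDen : MvPolynomial N.CodingVar F :=
  N.transfer F 1 0 * N.transfer F 2 1 * N.transfer F 0 2

/-- The entries of the precoding matrix of the first sender: the powers `1, η, …, ηⁿ`, cleared of
denominators. -/
noncomputable def precoder₁ (j : Fin (n + 1)) : MvPolynomial N.CodingVar F :=
  N.transfer F 2 1 * N.transfer F 1 2 * (N.etaNum F ^ (j : ℕ) * N.etaDen F ^ (n - j))

/-- The entries of the precoding matrix of the second sender. -/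
noncomputable def precoder₂ (j : Fin n) : MvPolynomial N.CodingVar F :=
  N.transfer F 2 0 * N.transfer F 1 2 * (N.etaNum F ^ (j : ℕ) * N.etaDen F ^ (n - j))

/-- The entries of the precoding matrix of the third sender. -/
noncomputable def precoder₃ (j : Fin n) : MvPolynomial N.CodingVar F :=
  N.transfer F 2 1 * N.transfer F 1 0 * (N.etaNum F ^ (j + 1 : ℕ) * N.etaDen F ^ (n - 1 - j))

lemma transfer_mul_precoder₂_eq (j : Fin n) :
    N.transfer F 0 1 * N.precoder₂ F n j = N.transfer F 0 2 * N.precoder₃ F n j := by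
  have h : n - j = n - 1 - j + 1 := by omega
  rw [precoder₂, precoder₃, h, pow_succ (N.etaDen F), pow_succ (N.etaNum F)]
  nth_rw 2 [etaDen]
  nth_rw 3 [etaNum]
  ring

lemma transfer_mul_precoder₃_eq (j : Fin n) :
    N.transfer F 1 2 * N.precoder₃ F n j = N.transfer F 1 0 * N.precoder₁ F n j.succ := by
  have h : n - (j.succ : ℕ) = n - 1 - j := by simp; omega
  rw [precoder₁, precoder₃, h, Fin.val_succ]
  ring

lemma transfer_mul_precoder₂_eq_castSucc (j : Fin n) :
    N.transfer F 2 1 * N.precoder₂ F n j = N.transfer F 2 0 * N.precoder₁ F n j.castSucc := by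
  rw [precoder₁, precoder₂, Fin.val_castSucc]
  ring

end Precoders

section Independence

open Polynomial

variable {N : UnicastNetwork V E} {n : ℕ}

omit [Fintype E] in
/-- Multiples of the powers of `η` by two weights `u` and `v` are linearly independent over the
prime field if there is no relation `u f(η) + v g(η) = 0` with polynomials `f`, `g`. -/
lemma linearIndependent_sumElim {u v η : RatFun (ZMod 2) N}
    (huv : ∀ f g : (ZMod 2)[X], u * aeval η f + v * aeval η g = 0 → f = 0 ∧ g = 0)
    {h₁ : Fin (n + 1) → MvPolynomial N.CodingVar (ZMod 2)}
    {h₂ : Fin n → MvPolynomial N.CodingVar (ZMod 2)}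
    (hh₁ : ∀ j, algebraMap _ (RatFun (ZMod 2) N) (h₁ j) = u * η ^ (j : ℕ))
    (hh₂ : ∀ j, algebraMap _ (RatFun (ZMod 2) N) (h₂ j) = v * η ^ (j : ℕ)) :
    LinearIndependent (ZMod 2) (Sum.elim h₁ h₂) := by
  rw [Fintype.linearIndependent_iff]
  intro c hc
  have hcoeff : ∀ {l : ℕ} (d : Fin l → ZMod 2), ∑ j, C (d j) * X ^ (j : ℕ) = 0 → ∀ j, d j = 0 := by
    intro l d hd j
    have h := congrArg (fun f => f.coeff (j : ℕ)) hd
    simpa [finsetSum_coeff, coeff_C_mul_X_pow, Fin.val_inj] using h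
  have h0 := congrArg (algebraMap _ (RatFun (ZMod 2) N)) hc
  rw [Fintype.sum_sum_type, map_add, map_sum, map_sum, map_zero] at h0
  obtain ⟨hf, hg⟩ := huv (∑ j, C (c (.inl j)) * X ^ (j : ℕ)) (∑ j, C (c (.inr j)) * X ^ (j : ℕ)) (by
    rw [← h0, map_sum, map_sum, Finset.mul_sum, Finset.mul_sum]
    congr 1
    · refine Finset.sum_congr rfl fun j _ => ?_
      rw [Sum.elim_inl, Algebra.smul_def, map_mul, map_pow, aeval_C, aeval_X, map_mul, hh₁,
        ← IsScalarTower.algebraMap_apply]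
      ring
    · refine Finset.sum_congr rfl fun j _ => ?_
      rw [Sum.elim_inr, Algebra.smul_def, map_mul, map_pow, aeval_C, aeval_X, map_mul, hh₂,
        ← IsScalarTower.algebraMap_apply]
      ring)
  rintro (j | j)
  · exact hcoeff _ hf j
  · exact hcoeff _ hg j

variable (hm : ∀ i j : Fin 3, N.transfer (ZMod 2) i j ≠ 0) (hη1 : N.eta (ZMod 2) ≠ 1)

include hm hη1 in
/-- The non-identities at the receiver `b` exclude every polynomial relation, of whatever degree,
between `η` and the ratio at `b`. -/
lemma eq_zero_of_aeval_eta_eq {a b c : Fin 3} (hab : a ≠ b) (hac : a ≠ c) (hbc : b ≠ c)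
    (hη : N.eta (ZMod 2) =
      N.m (ZMod 2) c a * N.m (ZMod 2) a b * N.m (ZMod 2) b c /
        (N.m (ZMod 2) b a * N.m (ZMod 2) c b * N.m (ZMod 2) a c))
    (hC : N.CyclicNonIdentities (ZMod 2) a b c) {f g : (ZMod 2)[X]}
    (h : N.m (ZMod 2) b a * N.m (ZMod 2) c b * aeval (N.eta (ZMod 2)) f +
      N.m (ZMod 2) b b * N.m (ZMod 2) c a * aeval (N.eta (ZMod 2)) g = 0) : f = 0 ∧ g = 0 := by
  have h0 := fun i j => N.m_ne_zero (hm i j)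
  by_contra hfg
  rw [cyclicNonIdentities_iff_m] at hC
  obtain ⟨c1, c2, c3⟩ := hC
  have h2 := charTwo_ratFun (F := ZMod 2) (N := N)
  have hd := mul_ne_zero (h0 b a) (h0 c b)
  have hd' := mul_ne_zero hd (h0 a c)
  have hf : aeval (N.eta (ZMod 2)) f = N.m (ZMod 2) b b * N.m (ZMod 2) c a /
      (N.m (ZMod 2) b a * N.m (ZMod 2) c b) * aeval (N.eta (ZMod 2)) g := by
    rw [div_mul_eq_mul_div, eq_div_iff hd]
    linear_combination h - N.m (ZMod 2) b b * N.m (ZMod 2) c a * aeval (N.eta (ZMod 2)) g * h2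
  have hr : ∀ i j, N.ratSum (ZMod 2) (sigma j) (tau i) ≠ 0 := fun i j => by
    rw [ratSum_sigma_tau]
    exact h0 i j
  have hp : N.m (ZMod 2) b b * N.m (ZMod 2) c a / (N.m (ZMod 2) b a * N.m (ZMod 2) c b) =
      N.ratSum (ZMod 2) (sigma b) (tau b) * N.ratSum (ZMod 2) (sigma a) (tau c) /
      (N.ratSum (ZMod 2) (sigma a) (tau b) * N.ratSum (ZMod 2) (sigma b) (tau c)) := by
    simp only [ratSum_sigma_tau]
  have hη' : N.eta (ZMod 2) = N.ratSum (ZMod 2) (sigma a) (tau c) *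
      N.ratSum (ZMod 2) (sigma b) (tau a) * N.ratSum (ZMod 2) (sigma c) (tau b) /
      (N.ratSum (ZMod 2) (sigma a) (tau b) * N.ratSum (ZMod 2) (sigma b) (tau c) *
        N.ratSum (ZMod 2) (sigma c) (tau a)) := by
    simp only [ratSum_sigma_tau]
    exact hη
  have hcases := ratio_cases hab hac hbc (hr b a) (hr c a) (hr a b) (hr b b) (hr c b) (hr a c)
    (hr b c) hp hη' hη1 (f := f) (g := g) (not_and_or.1 hfg) hf
  rcases hcases with h1 | h1 | h1
  · rw [div_eq_one_iff_eq hd] at h1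
    exact c1 h1
  · rw [hη, div_eq_div_iff hd hd'] at h1
    apply c2
    apply mul_left_cancel₀ (mul_ne_zero hd (h0 c a))
    linear_combination h1
  · have h3 : (1 : RatFun (ZMod 2) N) =
        (N.m (ZMod 2) b a * N.m (ZMod 2) c b * N.m (ZMod 2) a c) /
        (N.m (ZMod 2) b a * N.m (ZMod 2) c b * N.m (ZMod 2) a c) := (div_self hd').symm
    rw [hη, h3, ← add_div, div_eq_div_iff hd hd'] at h1
    apply c3
    apply mul_left_cancel₀ hd
    linear_combination h1

include hm in
lemma algebraMap_etaNum_pow_mul {l j : ℕ} (hj : j ≤ l) :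
    algebraMap _ (RatFun (ZMod 2) N) (N.etaNum (ZMod 2) ^ j * N.etaDen (ZMod 2) ^ (l - j)) =
      algebraMap _ (RatFun (ZMod 2) N) (N.etaDen (ZMod 2)) ^ l * N.eta (ZMod 2) ^ j := by
  have h0 : algebraMap _ (RatFun (ZMod 2) N) (N.etaDen (ZMod 2)) ≠ 0 := by
    rw [Ne, map_eq_zero_iff _ (IsFractionRing.injective _ _)]
    exact mul_ne_zero (mul_ne_zero (hm 1 0) (hm 2 1)) (hm 0 2)
  have h1 : N.eta (ZMod 2) = algebraMap _ (RatFun (ZMod 2) N) (N.etaNum (ZMod 2)) /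
      algebraMap _ (RatFun (ZMod 2) N) (N.etaDen (ZMod 2)) := by
    simp only [eta, etaNum, etaDen, m, map_mul]
  rw [h1, div_pow, map_mul, map_pow, map_pow, mul_div_assoc', eq_div_iff (pow_ne_zero _ h0),
    mul_assoc, ← pow_add, Nat.sub_add_cancel hj, mul_comm]

include hm hη1 in
lemma linearIndependent_receiver₁ (hC : N.CyclicNonIdentities (ZMod 2) 2 0 1) :
    LinearIndependent (ZMod 2)
      (Sum.elim (fun j => N.transfer (ZMod 2) 0 0 * N.precoder₁ (ZMod 2) n j)
        (fun j => N.transfer (ZMod 2) 0 1 * N.precoder₂ (ZMod 2) n j)) := by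
  have h0 := fun i j => N.m_ne_zero (hm i j)
  have hB : algebraMap _ (RatFun (ZMod 2) N) (N.etaDen (ZMod 2)) =
      N.m (ZMod 2) 1 0 * N.m (ZMod 2) 2 1 * N.m (ZMod 2) 0 2 := by
    simp only [etaDen, m, map_mul]
  have hB0 : algebraMap _ (RatFun (ZMod 2) N) (N.etaDen (ZMod 2)) ≠ 0 := by
    rw [hB]
    exact mul_ne_zero (mul_ne_zero (h0 1 0) (h0 2 1)) (h0 0 2)
  refine linearIndependent_sumElim (η := N.eta (ZMod 2))
    (u := N.m (ZMod 2) 0 0 * N.m (ZMod 2) 2 1 * N.m (ZMod 2) 1 2 *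
      algebraMap _ (RatFun (ZMod 2) N) (N.etaDen (ZMod 2)) ^ n)
    (v := N.m (ZMod 2) 0 1 * N.m (ZMod 2) 2 0 * N.m (ZMod 2) 1 2 *
      algebraMap _ (RatFun (ZMod 2) N) (N.etaDen (ZMod 2)) ^ n) ?_ ?_ ?_
  · intro f g h
    -- the second summand has the factor `η`, which is absorbed into the polynomial
    have h1 := eq_zero_of_aeval_eta_eq (f := X * g) (g := f) hm hη1 (a := 2) (b := 0) (c := 1)
      (by decide) (by decide) (by decide) (by rw [eta]; ring) hC (by
        apply mul_left_cancel₀ (mul_ne_zero (h0 2 1) (pow_ne_zero n hB0))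
        rw [map_mul, aeval_X]
        have h2 : N.eta (ZMod 2) * (N.m (ZMod 2) 1 0 * N.m (ZMod 2) 2 1 * N.m (ZMod 2) 0 2) =
            N.m (ZMod 2) 2 0 * N.m (ZMod 2) 0 1 * N.m (ZMod 2) 1 2 := by
          rw [eta, div_mul_cancel₀]
          rwa [← hB]
        linear_combination h + algebraMap _ (RatFun (ZMod 2) N) (N.etaDen (ZMod 2)) ^ n *
          aeval (N.eta (ZMod 2)) g * h2)
    exact ⟨h1.2, (mul_eq_zero.1 h1.1).resolve_left X_ne_zero⟩
  · intro j
    rw [precoder₁, map_mul, map_mul, algebraMap_etaNum_pow_mul hm (Nat.lt_succ_iff.1 j.2), map_mul]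
    simp only [m]
    ring
  · intro j
    rw [precoder₂, map_mul, map_mul, algebraMap_etaNum_pow_mul hm j.2.le, map_mul]
    simp only [m]
    ring

include hm hη1 in
lemma linearIndependent_receiver₂ (hC : N.CyclicNonIdentities (ZMod 2) 0 1 2) :
    LinearIndependent (ZMod 2)
      (Sum.elim (fun j => N.transfer (ZMod 2) 1 0 * N.precoder₁ (ZMod 2) n j)
        (fun j => N.transfer (ZMod 2) 1 1 * N.precoder₂ (ZMod 2) n j)) := by
  have h0 := fun i j => N.m_ne_zero (hm i j)
  have hB0 : algebraMap _ (RatFun (ZMod 2) N) (N.etaDen (ZMod 2)) ≠ 0 := by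
    simp only [etaDen, map_mul]
    exact mul_ne_zero (mul_ne_zero (h0 1 0) (h0 2 1)) (h0 0 2)
  refine linearIndependent_sumElim (η := N.eta (ZMod 2))
    (u := N.m (ZMod 2) 1 0 * N.m (ZMod 2) 2 1 * N.m (ZMod 2) 1 2 *
      algebraMap _ (RatFun (ZMod 2) N) (N.etaDen (ZMod 2)) ^ n)
    (v := N.m (ZMod 2) 1 1 * N.m (ZMod 2) 2 0 * N.m (ZMod 2) 1 2 *
      algebraMap _ (RatFun (ZMod 2) N) (N.etaDen (ZMod 2)) ^ n) ?_ ?_ ?_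
  · intro f g h
    refine eq_zero_of_aeval_eta_eq hm hη1 (a := 0) (b := 1) (c := 2)
      (by decide) (by decide) (by decide) (by rw [eta]) hC ?_
    apply mul_left_cancel₀ (mul_ne_zero (h0 1 2) (pow_ne_zero n hB0))
    linear_combination h
  · intro j
    rw [precoder₁, map_mul, map_mul, algebraMap_etaNum_pow_mul hm (Nat.lt_succ_iff.1 j.2), map_mul]
    simp only [m]
    ring
  · intro j
    rw [precoder₂, map_mul, map_mul, algebraMap_etaNum_pow_mul hm j.2.le, map_mul]
    simp only [m]
    ring

include hm hη1 in
lemma linearIndependent_receiver₃ (hn : n ≠ 0) (hC : N.CyclicNonIdentities (ZMod 2) 1 2 0) :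
    LinearIndependent (ZMod 2)
      (Sum.elim (fun j => N.transfer (ZMod 2) 2 0 * N.precoder₁ (ZMod 2) n j)
        (fun j => N.transfer (ZMod 2) 2 2 * N.precoder₃ (ZMod 2) n j)) := by
  have h0 := fun i j => N.m_ne_zero (hm i j)
  have hB : algebraMap _ (RatFun (ZMod 2) N) (N.etaDen (ZMod 2)) =
      N.m (ZMod 2) 1 0 * N.m (ZMod 2) 2 1 * N.m (ZMod 2) 0 2 := by
    simp only [etaDen, m, map_mul]
  have hB0 : algebraMap _ (RatFun (ZMod 2) N) (N.etaDen (ZMod 2)) ≠ 0 := by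
    rw [hB]
    exact mul_ne_zero (mul_ne_zero (h0 1 0) (h0 2 1)) (h0 0 2)
  obtain ⟨n, rfl⟩ := Nat.exists_eq_succ_of_ne_zero hn
  refine linearIndependent_sumElim (η := N.eta (ZMod 2))
    (u := N.m (ZMod 2) 2 0 * N.m (ZMod 2) 2 1 * N.m (ZMod 2) 1 2 *
      algebraMap _ (RatFun (ZMod 2) N) (N.etaDen (ZMod 2)) ^ (n + 1))
    (v := N.m (ZMod 2) 2 2 * N.m (ZMod 2) 2 1 * N.m (ZMod 2) 1 0 *
      algebraMap _ (RatFun (ZMod 2) N) (N.etaNum (ZMod 2)) *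
      algebraMap _ (RatFun (ZMod 2) N) (N.etaDen (ZMod 2)) ^ n) ?_ ?_ ?_
  · intro f g h
    refine eq_zero_of_aeval_eta_eq hm hη1 (a := 1) (b := 2) (c := 0)
      (by decide) (by decide) (by decide) (by rw [eta]; ring) hC ?_
    apply mul_left_cancel₀ (mul_ne_zero (mul_ne_zero (mul_ne_zero (mul_ne_zero (h0 2 0) (h0 2 1))
      (h0 1 2)) (h0 1 0)) (pow_ne_zero n hB0))
    have hA : algebraMap _ (RatFun (ZMod 2) N) (N.etaNum (ZMod 2)) =
        N.m (ZMod 2) 2 0 * N.m (ZMod 2) 0 1 * N.m (ZMod 2) 1 2 := by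
      simp only [etaNum, m, map_mul]
    rw [pow_succ, hA] at h
    nth_rw 2 [hB] at h
    linear_combination h
  · intro j
    rw [precoder₁, map_mul, map_mul, algebraMap_etaNum_pow_mul hm (Nat.lt_succ_iff.1 j.2), map_mul]
    simp only [m]
    ring
  · intro j
    rw [precoder₃, pow_succ', Nat.succ_sub_one, mul_assoc (N.etaNum (ZMod 2)), map_mul, map_mul,
      map_mul (algebraMap _ _) (N.etaNum (ZMod 2)),
      algebraMap_etaNum_pow_mul hm (Nat.lt_succ_iff.1 j.2), map_mul]
    simp only [m]
    ring

end Independence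

end UnicastNetwork

/-! ### Sufficiency of the non-identities -/

namespace UnicastNetwork

variable {V E : Type*} [Fintype E]

section Sufficiency

open MvPolynomial

lemma colSpan_le_of_forall_col {F : Type*} [Field F] {r c d : ℕ} {A : Matrix (Fin r) (Fin c) F}
    {B : Matrix (Fin r) (Fin d) F} (f : Fin c → Fin d) (h : ∀ k j, A k j = B k (f j)) :
    colSpan A ≤ colSpan B := by
  refine Submodule.span_mono ?_
  rintro _ ⟨j, rfl⟩
  exact ⟨f j, funext fun k => (h k j).symm⟩

variable {N : UnicastNetwork V E}

lemma eval_transfer {K : Type*} [Field K] [Algebra (ZMod 2) K] (x : N.CodingVar → K)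
    (i j : Fin 3) : eval x (N.transfer K i j) = aeval x (N.transfer (ZMod 2) i j) := by
  rw [← map_transfer (algebraMap (ZMod 2) K), eval_map, aeval_def]

/-- If the determinant of the generic values of the columns `h₁`, `h₂` does not vanish at a point,
then these columns are a matrix of full rank there. -/
lemma rank_fromCols_eq {K : Type*} [Field K] [Algebra (ZMod 2) K] {σ : Type*} {a b : ℕ}
    (x : Fin (a + b) × σ → K) (h₁ : Fin a → MvPolynomial σ (ZMod 2))
    (h₂ : Fin b → MvPolynomial σ (ZMod 2))
    (h : aeval x (Matrix.of fun k j => rename (Prod.mk k) (Sum.elim h₁ h₂ (finSumFinEquiv.symm j)) :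
      Matrix (Fin (a + b)) (Fin (a + b)) (MvPolynomial (Fin (a + b) × σ) (ZMod 2))).det ≠ 0) :
    (Matrix.fromCols (Matrix.of fun k j => aeval (fun q => x (k, q)) (h₁ j))
      (Matrix.of fun k j => aeval (fun q => x (k, q)) (h₂ j))).rank = a + b := by
  rw [AlgHom.map_det] at h
  have h1 : (aeval x).mapMatrix (Matrix.of fun k j => rename (Prod.mk k)
      (Sum.elim h₁ h₂ (finSumFinEquiv.symm j)) :
      Matrix (Fin (a + b)) (Fin (a + b)) (MvPolynomial (Fin (a + b) × σ) (ZMod 2))) =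
      (Matrix.fromCols (Matrix.of fun k j => aeval (fun q => x (k, q)) (h₁ j))
        (Matrix.of fun k j => aeval (fun q => x (k, q)) (h₂ j))).submatrix (Equiv.refl _)
        finSumFinEquiv.symm := by
    ext k j
    rw [AlgHom.mapMatrix_apply, Matrix.map_apply, Matrix.of_apply, aeval_rename,
      Matrix.submatrix_apply, Matrix.fromCols]
    rcases finSumFinEquiv.symm j with l | l <;> rfl
  rw [h1] at h
  have h2 := Matrix.rank_of_isUnit _ ((Matrix.isUnit_iff_isUnit_det _).2 (isUnit_iff_ne_zero.2 h))
  rwa [Matrix.rank_submatrix, Fintype.card_fin] at h2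

lemma transferMatrix_mul_of {K : Type*} [Field K] [Algebra (ZMod 2) K] {L c : ℕ}
    (x : Fin L → N.CodingVar → K) (i j : Fin 3) (g : Fin c → MvPolynomial N.CodingVar (ZMod 2)) :
    N.transferMatrix x i j * Matrix.of (fun k l => aeval (x k) (g l)) =
      Matrix.of fun k l => aeval (x k) (N.transfer (ZMod 2) i j * g l) := by
  ext k l
  rw [transferMatrix, Matrix.diagonal_mul, eval_transfer, Matrix.of_apply, Matrix.of_apply, map_mul]

variable (hm : ∀ i j : Fin 3, N.transfer (ZMod 2) i j ≠ 0) (hη1 : N.eta (ZMod 2) ≠ 1)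

include hm hη1 in
/-- The non-identities suffice: the powers of `η` are precoding matrices at a generic point. -/
theorem exists_feasiblePBNA {n : ℕ} (hn : n ≠ 0)
    (h₁ : N.CyclicNonIdentities (ZMod 2) 2 0 1) (h₂ : N.CyclicNonIdentities (ZMod 2) 0 1 2)
    (h₃ : N.CyclicNonIdentities (ZMod 2) 1 2 0) :
    ∃ k₀ : ℕ, ∀ k, k₀ ≤ k → N.FeasiblePBNA (GaloisField 2 k) (n + 1) n := by
  have hfin : Finite N.CodingVar := inferInstance
  have hinj : Function.Injective (finSumFinEquiv.symm : Fin (n + 1 + n) ≃ Fin (n + 1) ⊕ Fin n) :=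
    Equiv.injective _
  have hd₁ := det_rename_ne_zero ((linearIndependent_receiver₁ hm hη1 (n := n) h₁).comp _ hinj)
  have hd₂ := det_rename_ne_zero ((linearIndependent_receiver₂ hm hη1 (n := n) h₂).comp _ hinj)
  have hd₃ := det_rename_ne_zero ((linearIndependent_receiver₃ hm hη1 hn h₃).comp _ hinj)
  have hd₄ : ∏ k : Fin (n + 1 + n), ∏ i, ∏ j,
      rename (Prod.mk k) (N.transfer (ZMod 2) i j) ≠ 0 := by
    simp only [Finset.prod_ne_zero_iff]
    intro k _ i _ j _ h
    exact hm i j ((map_eq_zero_iff _ (rename_injective _ (Prod.mk_right_injective k))).1 h)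
  obtain ⟨k₀, hk₀⟩ :=
    exists_aeval_ne_zero (mul_ne_zero (mul_ne_zero (mul_ne_zero hd₁ hd₂) hd₃) hd₄)
  refine ⟨k₀, fun k hk => ?_⟩
  obtain ⟨x, hx⟩ := hk₀ k hk
  simp only [map_mul, mul_ne_zero_iff] at hx
  obtain ⟨⟨⟨hx₁, hx₂⟩, hx₃⟩, hx₄⟩ := hx
  refine ⟨fun k q => x (k, q),
    Matrix.of fun k j => aeval (fun q => x (k, q)) (N.precoder₁ (ZMod 2) n j),
    Matrix.of fun k j => aeval (fun q => x (k, q)) (N.precoder₂ (ZMod 2) n j),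
    Matrix.of fun k j => aeval (fun q => x (k, q)) (N.precoder₃ (ZMod 2) n j), ?_, ?_, ?_, ?_, ?_⟩
  · intro i j _
    rw [transferMatrix, Matrix.isUnit_diagonal, Pi.isUnit_iff]
    intro l
    rw [map_prod, Finset.prod_ne_zero_iff] at hx₄
    have h := hx₄ l (Finset.mem_univ _)
    rw [map_prod, Finset.prod_ne_zero_iff] at h
    have h := h i (Finset.mem_univ _)
    rw [map_prod, Finset.prod_ne_zero_iff] at h
    have h := h j (Finset.mem_univ _)
    rw [aeval_rename] at h
    rw [eval_transfer]
    exact isUnit_iff_ne_zero.2 h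
  · rw [transferMatrix_mul_of, transferMatrix_mul_of]
    simp only [transfer_mul_precoder₂_eq]
  · rw [transferMatrix_mul_of, transferMatrix_mul_of]
    refine colSpan_le_of_forall_col Fin.succ fun l j => ?_
    rw [Matrix.of_apply, Matrix.of_apply, transfer_mul_precoder₃_eq]
  · rw [transferMatrix_mul_of, transferMatrix_mul_of]
    refine colSpan_le_of_forall_col Fin.castSucc fun l j => ?_
    rw [Matrix.of_apply, Matrix.of_apply, transfer_mul_precoder₂_eq_castSucc]
  · rw [transferMatrix_mul_of, transferMatrix_mul_of, transferMatrix_mul_of,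
      transferMatrix_mul_of, transferMatrix_mul_of, transferMatrix_mul_of]
    exact ⟨rank_fromCols_eq x _ _ hx₁, rank_fromCols_eq x _ _ hx₂, rank_fromCols_eq x _ _ hx₃⟩

end Sufficiency

end UnicastNetwork

/-! ### Necessity of the non-identities -/

namespace UnicastNetwork

variable {V E : Type*} [Fintype E]

section Necessity

variable {F : Type*} [Field F]

lemma exists_mulVec_eq_of_colSpan_le {r c d : ℕ} {A : Matrix (Fin r) (Fin c) F}
    {B : Matrix (Fin r) (Fin d) F} (h : colSpan A ≤ colSpan B) (v : Fin c → F) :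
    ∃ w, A *ᵥ v = B *ᵥ w := by
  have h1 : A.mulVecLin v ∈ colSpan B := h <| by
    have h2 : LinearMap.range A.mulVecLin = colSpan A := Matrix.range_mulVecLin A
    exact h2 ▸ LinearMap.mem_range_self _ v
  have h2 : LinearMap.range B.mulVecLin = colSpan B := Matrix.range_mulVecLin B
  rw [← h2] at h1
  obtain ⟨w, hw⟩ := h1
  exact ⟨w, hw.symm⟩

/-- Full column rank means that the two blocks can be decoded. -/
lemma eq_zero_of_rank_fromCols {r c d : ℕ} {A : Matrix (Fin r) (Fin c) F}
    {B : Matrix (Fin r) (Fin d) F} (h : (Matrix.fromCols A B).rank = c + d) {v : Fin c → F}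
    {w : Fin d → F} (hvw : A *ᵥ v = B *ᵥ w) : v = 0 ∧ w = 0 := by
  have h1 : LinearIndependent F (Matrix.fromCols A B).col := by
    rw [linearIndependent_iff_card_eq_finrank_span, Fintype.card_sum, Fintype.card_fin,
      Fintype.card_fin, Set.finrank, ← Matrix.rank_eq_finrank_span_cols, h]
  have h2 := Matrix.mulVec_injective_iff.2 h1 (a₁ := Sum.elim v (-w)) (a₂ := 0) (by
    rw [Matrix.fromCols_mulVec_sumElim, Matrix.mulVec_neg, hvw, add_neg_cancel, Matrix.mulVec_zero])
  exact ⟨funext fun j => congrFun h2 (.inl j), funext fun j =>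
    neg_eq_zero.1 (congrFun h2 (.inr j))⟩

variable {N : UnicastNetwork V E}

/-- The non-identities are necessary: under any of the nine identities, some vector of the desired
signal at a receiver is aligned with the interference. -/
theorem FeasiblePBNA.cyclicNonIdentities {n : ℕ} (hn : 1 < n) (h : N.FeasiblePBNA F (n + 1) n) :
    N.CyclicNonIdentities F 2 0 1 ∧ N.CyclicNonIdentities F 0 1 2 ∧
      N.CyclicNonIdentities F 1 2 0 := by
  obtain ⟨x, V₁, V₂, V₃, hM, hA₁, hA₂, hA₃, hD₁, hD₂, hD₃⟩ := h
  set d : Fin 3 → Fin 3 → Fin (n + 1 + n) → F :=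
    fun i j k => MvPolynomial.eval (x k) (N.transfer F i j) with hd
  have hmul : ∀ {c : ℕ} i j (A : Matrix (Fin (n + 1 + n)) (Fin c) F) b,
      (N.transferMatrix x i j * A) *ᵥ b = fun k => d i j k * (A *ᵥ b) k := by
    intro c i j A b
    funext k
    rw [← Matrix.mulVec_mulVec, transferMatrix, Matrix.mulVec_diagonal]
  have hne : ∀ {i j}, i ≠ j → ∀ k, d i j k ≠ 0 := by
    intro i j hij k
    have h := hM i j hij
    rw [transferMatrix, Matrix.isUnit_diagonal, Pi.isUnit_iff] at h
    exact (h k).ne_zero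
  -- the alignment and decodability conditions in terms of vectors of coefficients
  have a₁ : ∀ b, ∃ c, ∀ k, d 0 1 k * (V₂ *ᵥ b) k = d 0 2 k * (V₃ *ᵥ c) k := by
    intro b
    obtain ⟨c, hc⟩ := exists_mulVec_eq_of_colSpan_le hA₁.le b
    rw [hmul, hmul] at hc
    exact ⟨c, congrFun hc⟩
  have a₁' : ∀ c, ∃ b, ∀ k, d 0 2 k * (V₃ *ᵥ c) k = d 0 1 k * (V₂ *ᵥ b) k := by
    intro b
    obtain ⟨c, hc⟩ := exists_mulVec_eq_of_colSpan_le hA₁.ge b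
    rw [hmul, hmul] at hc
    exact ⟨c, congrFun hc⟩
  have a₂ : ∀ c, ∃ a, ∀ k, d 1 2 k * (V₃ *ᵥ c) k = d 1 0 k * (V₁ *ᵥ a) k := by
    intro b
    obtain ⟨c, hc⟩ := exists_mulVec_eq_of_colSpan_le hA₂ b
    rw [hmul, hmul] at hc
    exact ⟨c, congrFun hc⟩
  have a₃ : ∀ b, ∃ a, ∀ k, d 2 1 k * (V₂ *ᵥ b) k = d 2 0 k * (V₁ *ᵥ a) k := by
    intro b
    obtain ⟨c, hc⟩ := exists_mulVec_eq_of_colSpan_le hA₃ b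
    rw [hmul, hmul] at hc
    exact ⟨c, congrFun hc⟩
  have d₁ : ∀ a b, (∀ k, d 0 0 k * (V₁ *ᵥ a) k = d 0 1 k * (V₂ *ᵥ b) k) → a = 0 ∧ b = 0 := by
    intro a b h
    exact eq_zero_of_rank_fromCols hD₁ (by rw [hmul, hmul]; exact funext h)
  have d₂ : ∀ a b, (∀ k, d 1 0 k * (V₁ *ᵥ a) k = d 1 1 k * (V₂ *ᵥ b) k) → b = 0 := by
    intro a b h
    exact (eq_zero_of_rank_fromCols hD₂ (by rw [hmul, hmul]; exact funext h)).2
  have d₃ : ∀ a c, (∀ k, d 2 0 k * (V₁ *ᵥ a) k = d 2 2 k * (V₃ *ᵥ c) k) → c = 0 := by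
    intro a b h
    exact (eq_zero_of_rank_fromCols hD₃ (by rw [hmul, hmul]; exact funext h)).2
  have h01 := hne (i := 0) (j := 1) (by decide)
  have h02 := hne (i := 0) (j := 2) (by decide)
  have h10 := hne (i := 1) (j := 0) (by decide)
  have h12 := hne (i := 1) (j := 2) (by decide)
  have h20 := hne (i := 2) (j := 0) (by decide)
  have h21 := hne (i := 2) (j := 1) (by decide)
  have hev : ∀ {P Q : MvPolynomial N.CodingVar F}, P = Q → ∀ k,
      MvPolynomial.eval (x k) P = MvPolynomial.eval (x k) Q := fun h k => h ▸ rfl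
  -- a non-zero vector of coefficients
  have h1 : (fun _ => 1 : Fin n → F) ≠ 0 := fun h => one_ne_zero (congrFun h ⟨0, by omega⟩)
  set o : Fin n → F := fun _ => 1
  -- the two ways in which a vector of the second sender is aligned with one of the first sender
  obtain ⟨a, ha⟩ := a₃ o
  obtain ⟨c, hc⟩ := a₁ o
  obtain ⟨a', ha'⟩ := a₂ c
  obtain ⟨b, hb⟩ := a₁' o
  obtain ⟨e, he⟩ := a₃ b
  obtain ⟨e', he'⟩ := a₂ o
  refine ⟨⟨fun h => ?_, fun h => ?_, fun h => ?_⟩, ⟨fun h => ?_, fun h => ?_, fun h => ?_⟩,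
    ⟨fun h => ?_, fun h => ?_, fun h => ?_⟩⟩
  · refine h1 (d₁ a' o fun k => mul_left_cancel₀ (h10 k) ?_).2
    have h2 := hev h k
    simp only [map_mul] at h2
    linear_combination (-d 0 0 k) * ha' k + (V₃ *ᵥ c) k * h2 - d 1 0 k * hc k
  · refine h1 (d₁ a o fun k => mul_left_cancel₀ (h20 k) ?_).2
    have h2 := hev h k
    simp only [map_mul] at h2
    linear_combination (-d 0 0 k) * ha k + (V₂ *ᵥ o) k * h2
  · -- two embeddings of the space of the second sender into the larger space of the first sender
    -- have a common value, because twice the smaller dimension exceeds the larger one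
    let f : Fin (n + 1 + n) → F := fun k => d 2 1 k / d 2 0 k
    let g : Fin (n + 1 + n) → F := fun k => d 0 1 k * d 1 2 k / (d 0 2 k * d 1 0 k)
    let Φ : (Fin n → F) × (Fin n → F) →ₗ[F] (Fin (n + 1 + n) → F) :=
      ((Matrix.diagonal f * V₂).mulVecLin).coprod (-(Matrix.diagonal g * V₂).mulVecLin)
    have hΦ : ∀ b b' k, Φ (b, b') k = f k * (V₂ *ᵥ b) k - g k * (V₂ *ᵥ b') k := by
      intro b b' k
      simp only [Φ, LinearMap.coprod_apply, LinearMap.neg_apply, Matrix.mulVecLin_apply,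
        ← Matrix.mulVec_mulVec, Pi.add_apply, Pi.neg_apply, Matrix.mulVec_diagonal]
      ring
    have hf : ∀ b, ∃ a, ∀ k, f k * (V₂ *ᵥ b) k = (V₁ *ᵥ a) k := by
      intro b
      obtain ⟨a, ha⟩ := a₃ b
      refine ⟨a, fun k => mul_left_cancel₀ (h20 k) ?_⟩
      rw [← ha k, ← mul_assoc, mul_div_cancel₀ _ (h20 k)]
    have hg : ∀ b, ∃ a, ∀ k, g k * (V₂ *ᵥ b) k = (V₁ *ᵥ a) k := by
      intro b
      obtain ⟨c, hc⟩ := a₁ b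
      obtain ⟨a, ha⟩ := a₂ c
      refine ⟨a, fun k => mul_left_cancel₀ (mul_ne_zero (h02 k) (h10 k)) ?_⟩
      rw [← mul_assoc, mul_div_cancel₀ _ (mul_ne_zero (h02 k) (h10 k))]
      linear_combination d 1 2 k * hc k + d 0 2 k * ha k
    have hmem : ∀ v, Φ v ∈ LinearMap.range V₁.mulVecLin := by
      rintro ⟨b, b'⟩
      obtain ⟨a, ha⟩ := hf b
      obtain ⟨a', ha'⟩ := hg b'
      refine ⟨a - a', funext fun k => ?_⟩
      rw [hΦ, ha k, ha' k, map_sub]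
      rfl
    have hker : LinearMap.ker (Φ.codRestrict _ hmem) ≠ ⊥ := by
      apply LinearMap.ker_ne_bot_of_finrank_lt
      have h3 := LinearMap.finrank_range_le V₁.mulVecLin
      rw [Module.finrank_fin_fun] at h3
      rw [Module.finrank_prod, Module.finrank_fin_fun]
      omega
    rw [LinearMap.ker_codRestrict] at hker
    obtain ⟨⟨b, b'⟩, hb, hb0⟩ := Submodule.exists_mem_ne_zero_of_ne_bot hker
    obtain ⟨a, ha⟩ := hf b
    have hb' : ∀ k, f k * (V₂ *ᵥ b) k = g k * (V₂ *ᵥ b') k := fun k =>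
      sub_eq_zero.1 ((hΦ b b' k).symm.trans (congrFun hb k))
    obtain ⟨ha0, hbb⟩ := d₁ a (b + b') fun k => by
      have h2 := hev h k
      simp only [map_mul, map_add] at h2
      have h3 : d 2 1 k * (V₂ *ᵥ b) k = d 2 0 k * (V₁ *ᵥ a) k := by
        rw [← ha k, ← mul_assoc, mul_div_cancel₀ _ (h20 k)]
      have h4 : d 0 1 k * d 1 2 k * (V₂ *ᵥ b') k = d 0 2 k * d 1 0 k * (V₁ *ᵥ a) k := by
        rw [← ha k, hb' k, ← mul_assoc,
          mul_div_cancel₀ _ (mul_ne_zero (h02 k) (h10 k))]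
      rw [Matrix.mulVec_add, Pi.add_apply]
      apply mul_left_cancel₀ (mul_ne_zero (h12 k) (h21 k))
      linear_combination (V₁ *ᵥ a) k * h2 - d 0 1 k * d 1 2 k * h3 - d 2 1 k * h4
    -- the common value vanishes, and both embeddings are injective
    have hinj : ∀ b'', (∀ k, (V₂ *ᵥ b'') k = 0) → b'' = 0 := fun b'' h =>
      (d₁ 0 b'' fun k => by rw [h k, Matrix.mulVec_zero, Pi.zero_apply, mul_zero, mul_zero]).2
    have hb0' : b = 0 := hinj b fun k => by
      have h3 := ha k
      rw [ha0, Matrix.mulVec_zero, Pi.zero_apply] at h3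
      exact (mul_eq_zero.1 h3).resolve_left (div_ne_zero (h21 k) (h20 k))
    rw [hb0', zero_add] at hbb
    exact hb0 (by rw [hb0', hbb]; rfl)
  · refine h1 (d₂ a o fun k => mul_left_cancel₀ (h20 k) ?_)
    have h2 := hev h k
    simp only [map_mul] at h2
    linear_combination (-d 1 0 k) * ha k - (V₂ *ᵥ o) k * h2
  · refine h1 (d₂ a' o fun k => mul_left_cancel₀ (h02 k) ?_)
    have h2 := hev h k
    simp only [map_mul] at h2
    linear_combination (-d 0 2 k) * ha' k - (V₂ *ᵥ o) k * h2 - d 1 2 k * hc k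
  · refine h1 (d₂ (a + a') o fun k => mul_left_cancel₀ (mul_ne_zero (h20 k) (h02 k)) ?_)
    have h2 := hev h k
    simp only [map_mul, map_add] at h2
    rw [Matrix.mulVec_add, Pi.add_apply]
    linear_combination (-d 1 0 k * d 0 2 k) * ha k - (V₂ *ᵥ o) k * h2 -
      d 2 0 k * d 0 2 k * ha' k - d 2 0 k * d 1 2 k * hc k
  · refine h1 (d₃ e o fun k => mul_left_cancel₀ (h01 k) ?_)
    have h2 := hev h k
    simp only [map_mul] at h2
    linear_combination (-d 0 1 k) * he k - (V₃ *ᵥ o) k * h2 - d 2 1 k * hb k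
  · refine h1 (d₃ e' o fun k => mul_left_cancel₀ (h10 k) ?_)
    have h2 := hev h k
    simp only [map_mul] at h2
    linear_combination (-d 2 0 k) * he' k - (V₃ *ᵥ o) k * h2
  · refine h1 (d₃ (e + e') o fun k => mul_left_cancel₀ (mul_ne_zero (h10 k) (h01 k)) ?_)
    have h2 := hev h k
    simp only [map_mul, map_add] at h2
    rw [Matrix.mulVec_add, Pi.add_apply]
    linear_combination (-d 2 0 k * d 0 1 k) * he' k - (V₃ *ᵥ o) k * h2 -
      d 1 0 k * d 0 1 k * he k - d 1 0 k * d 2 1 k * hb k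

end Necessity

end UnicastNetwork

/-! ### The criterion -/

namespace UnicastNetwork

variable {V E : Type*} [Fintype E]

lemma map_etaNum {F K : Type*} [CommSemiring F] [CommSemiring K] (φ : F →+* K)
    (N : UnicastNetwork V E) : MvPolynomial.map φ (N.etaNum F) = N.etaNum K := by
  simp only [etaNum, map_mul, map_transfer]

lemma map_etaDen {F K : Type*} [CommSemiring F] [CommSemiring K] (φ : F →+* K)
    (N : UnicastNetwork V E) : MvPolynomial.map φ (N.etaDen F) = N.etaDen K := by
  simp only [etaDen, map_mul, map_transfer]

lemma eta_eq_one_iff {F : Type*} [Field F] {N : UnicastNetwork V E}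
    (hm : ∀ i j : Fin 3, N.transfer F i j ≠ 0) : N.eta F = 1 ↔ N.etaNum F = N.etaDen F := by
  have h0 := fun i j => N.m_ne_zero (hm i j)
  rw [eta, div_eq_one_iff_eq (mul_ne_zero (mul_ne_zero (h0 1 0) (h0 2 1)) (h0 0 2))]
  simp only [m, ← map_mul]
  exact (IsFractionRing.injective (MvPolynomial N.CodingVar F) (RatFun F N)).eq_iff

end UnicastNetwork

/-- For `n > 1` and all sufficiently large fields `𝔽_{2^k}`, the rate tuple
`((n+1)/(2n+1), n/(2n+1), n/(2n+1))` is feasible through PBNA if and only if the transfer-function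
non-identities hold, equivalently the non-identities for `p₁, p₂, p₃`. -/
theorem theorem3 {V E : Type*} [Fintype V] [Fintype E] (N : UnicastNetwork V E)
    (n : ℕ) (hn : 1 < n) :
    ∃ k₀ : ℕ, ∀ k : ℕ, k₀ ≤ k →
      (∀ i j : Fin 3, N.transfer (GaloisField 2 k) i j ≠ 0) →
      ¬ N.IsConst (GaloisField 2 k) (N.eta (GaloisField 2 k)) →
      (N.FeasiblePBNA (GaloisField 2 k) (n + 1) n ↔
          N.TransferNonIdentities (GaloisField 2 k)) ∧
      (N.TransferNonIdentities (GaloisField 2 k) ↔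
          N.RatioNonIdentities (GaloisField 2 k)) := by
  -- all non-identities are decided over the prime field, which makes the bound independent of `k`
  obtain ⟨k₀, hk₀⟩ : ∃ k₀ : ℕ, ∀ k, k₀ ≤ k →
      (∀ i j : Fin 3, N.transfer (ZMod 2) i j ≠ 0) → N.eta (ZMod 2) ≠ 1 →
      N.CyclicNonIdentities (ZMod 2) 2 0 1 ∧ N.CyclicNonIdentities (ZMod 2) 0 1 2 ∧
        N.CyclicNonIdentities (ZMod 2) 1 2 0 → N.FeasiblePBNA (GaloisField 2 k) (n + 1) n := by
    by_cases h : (∀ i j : Fin 3, N.transfer (ZMod 2) i j ≠ 0) ∧ N.eta (ZMod 2) ≠ 1 ∧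
      N.CyclicNonIdentities (ZMod 2) 2 0 1 ∧ N.CyclicNonIdentities (ZMod 2) 0 1 2 ∧
        N.CyclicNonIdentities (ZMod 2) 1 2 0
    · obtain ⟨hm, hη, h₁, h₂, h₃⟩ := h
      obtain ⟨k₀, hk₀⟩ := UnicastNetwork.exists_feasiblePBNA hm hη (show n ≠ 0 by omega) h₁ h₂ h₃
      exact ⟨k₀, fun k hk _ _ _ => hk₀ k hk⟩
    · exact ⟨0, fun k _ hm hη hC => (h ⟨hm, hη, hC⟩).elim⟩
  refine ⟨k₀, fun k hk hm hconst => ?_⟩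
  have hη : N.eta (GaloisField 2 k) ≠ 1 := by
    intro h
    exact hconst ⟨1, by rw [h, map_one, map_one]⟩
  let φ := algebraMap (ZMod 2) (GaloisField 2 k)
  have hm₂ : ∀ i j : Fin 3, N.transfer (ZMod 2) i j ≠ 0 := by
    intro i j h
    apply hm i j
    rw [← UnicastNetwork.map_transfer φ, h, map_zero]
  have hη₂ : N.eta (ZMod 2) ≠ 1 := by
    rw [Ne, UnicastNetwork.eta_eq_one_iff hm] at hη
    rw [Ne, UnicastNetwork.eta_eq_one_iff hm₂]
    intro h
    apply hη
    rw [← UnicastNetwork.map_etaNum φ, h, UnicastNetwork.map_etaDen]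
  rw [UnicastNetwork.ratioNonIdentities_iff N hm hη, UnicastNetwork.transferNonIdentities_iff N hm]
  refine ⟨⟨fun h => h.cyclicNonIdentities hn, fun h => hk₀ k hk hm₂ hη₂ ?_⟩, Iff.rfl⟩
  simpa only [UnicastNetwork.cyclicNonIdentities_iff N φ] using h
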